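/- Let $p$ be a prime and let $\pi_1,\pi_2$ be representations of $\mathrm{PGL}_2(\mathbf Q_p)$, each isomorphic either to an unramified (irreducible) principal series $\pi(\mu,\nu)$, where $\mu,\nu$ are unramified characters of $\mathbf Q_p^\times$ with $\mu\nu^{-1}\ne|\cdot|^{\pm1}$ ("spherical"), or to an unramified special representation $\mathrm{St}\otimes(\chi\circ\det)$, where $\chi$ is an unramified character ("special"). Let $c_i=0$ if $\pi_i$ is spherical and $c_i=1$ if $\pi_i$ is special. Put $H^0=(\mathrm{GL}_2(\mathbf Q_p)\times\mathrm{GL}_2(\mathbf Q_p))/\mathbf Q_p^\times$ (with $\mathbf Q_p^\times$ embedded as $z\mapsto(z,z)$), $H^0_1=\{(a,d)\in H^0:\det a=\det d\}$ and $\sigma=\pi_1\boxtimes\pi_2$, a representation of $H^0$; assume that $\sigma$ is unitary. For $e\ge 0$ let $R_e$ be the order of matrices in $\mathrm M_2(\mathbf Z_p)$ with lower left entry in $p^e\mathbf Z_p$, let $\varphi^\star_e$ be the characteristic function of $R_e\oplus R_e$ on $\mathbf X=\mathrm M_2(\mathbf Q_p)^{\oplus2}$, and let $\mathcal U_e$ be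 the intersection of $H^0_1$ with the image of $R_e^\times\times R_e^\times$ in $H^0$. Let $f_i$ be a non-zero $R_{c_i}^\times$-invariant vector of $\pi_i$, $f^0=f_1\otimes f_2$, and let $\mathcal B_\sigma$ be the $H^0$-invariant positive definite Hermitian form on $\sigma$ with $\mathcal B_\sigma(f^0,f^0)=1$. For uniformizers $\varpi_1,\varpi_2$ of $\mathbf Q_p$ put $\eta_i=\begin{pmatrix}0&1\\-\varpi_i&0\end{pmatrix}$, and if $\pi_i$ is special let $\varepsilon_i$ be the eigenvalue of $\eta_i$ on $f_i$. Put $f^\dagger=f^0+\varepsilon_2\,\sigma(\eta_1,1)f^0$ if $\pi_1$ is spherical and $\pi_2$ is special, and $f^\dagger=f^0$ otherwise. Let $\varepsilon=1$ if $\pi_1$ is spherical and $\varepsilon=\varepsilon_1\varepsilon_2$ if $\pi_1$ is special and $\pi_2$ is special. The group $H^0_1$ acts on functions on $\mathbf X$ by $(\omega(a,d)\varphi)(x_1,x_2)=\varphi(a^{-1}x_1d,a^{-1}x_2d)$. Let $\mathcal B_\omega(\varphi,\varphi')=\int_{\mathbf X}\varphi\,\overline{\varphi'}\,dx$, where $dx$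 is the Haar measure on $\mathbf X$ that is self-dual with respect to the bilinear form $(x,y)=\sum_{i=1}^2\left(\det(x_i+y_i)-\det x_i-\det y_i\right)$ and an additive character $\psi$ of $\mathbf Q_p$ which is trivial on $\mathbf Z_p$ but not on $p^{-1}\mathbf Z_p$. Fix a Haar measure $dh$ on $H^0_1$ and put $$\mathcal Z_p(\varphi,f)=\int_{H^0_1}\mathcal B_\omega(\omega(h)\varphi,\varphi)\,\mathcal B_\sigma(\sigma(h)f,f)\,dh .$$ Let $\zeta_p(s)=(1-p^{-s})^{-1}$, and let $L(s,\mathrm{As}^+(\pi_p))=L(s,\pi_1\otimes\pi_2)$ be the $L$-factor of the tensor product of the Langlands parameters of $\pi_1$ and $\pi_2$. Then the integrals below converge absolutely, and: (1) if $\pi_1$ and $\pi_2$ are both spherical, $$\mathcal Z_p(\varphi^\star_0,f^\dagger)=\mathrm{vol}(\mathcal U_0)\cdot\frac{L(1,\mathrm{As}^+(\pi_p))}{\zeta_p(2)\zeta_p(4)};$$ (2) if $\pi_2$ is special (and $\pi_1$ is spherical or special), $$\mathcal Z_p(\varphi^\star_1,f^\dagger)=\mathrm{vol}(\mathcal U_1)\cdot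 p^{-2}(1+\varepsilon)\cdot\frac{L(1,\mathrm{As}^+(\pi_p))}{\zeta_p(1)\zeta_p(2)}\cdot\mathcal B_\sigma(f^\dagger,f^\dagger).$$ -/

import Mathlib

open MeasureTheory TensorProduct
open scoped MatrixGroups

noncomputable section

namespace SplitZeta

variable (p : ℕ) [Fact p.Prime]

/-! ### The quadratic space at a split prime

At a prime `p = 𝔭 𝔭ᶜ` that is split in `F` and does not divide `N⁻`, the quaternion algebra
`D₀ ⊗ ℚ_p` is `M₂(ℚ_p)`, and `V ⊗ ℚ_p` is identified with `M₂(ℚ_p)` with its reduced norm. -/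

/-- The quadratic space `V_p = M₂(ℚ_p)`, with quadratic form `n = det`. -/
abbrev V : Type := Matrix (Fin 2) (Fin 2) ℚ_[p]

/-- `𝐗_p = V_p ⊕ V_p`. -/
abbrev X : Type := V p × V p

instance : MeasurableSpace (X p) := borel _
instance : BorelSpace (X p) := ⟨rfl⟩

variable {p}

/-- The bilinear form `(x, y) = n(x + y) - n(x) - n(y)` on `V_p`. -/
def bilin (x y : V p) : ℚ_[p] := (x + y).det - x.det - y.det

/-- The bilinear form on `𝐗_p = V_p ⊕ V_p`. -/
def bilinX (x y : X p) : ℚ_[p] := bilin x.1 y.1 + bilin x.2 y.2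

/-- Bruhat–Schwartz functions on `𝐗_p`. -/
def IsBruhatSchwartz (φ : X p → ℂ) : Prop := IsLocallyConstant φ ∧ HasCompactSupport φ

/-- `ψ` is an additive character of `ℚ_p` that is trivial on `ℤ_p` but not on `p⁻¹ ℤ_p`; the
`p`-component of the standard character of `𝔸 / ℚ` is one. -/
def HasConductorZp (ψ : AddChar ℚ_[p] Circle) : Prop :=
  (∀ x : ℚ_[p], ‖x‖ ≤ 1 → ψ x = 1) ∧ ∃ x : ℚ_[p], ‖x‖ ≤ p ∧ ψ x ≠ 1

/-- The Fourier transform on `𝐗_p` determined by `ψ` and by the bilinear form. -/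
def fourier (ψ : AddChar ℚ_[p] Circle) (dx : Measure (X p)) (φ : X p → ℂ) (y : X p) : ℂ :=
  ∫ x, φ x * (ψ (bilinX x y) : ℂ) ∂dx

/-- `dx` is the self-dual Haar measure on `𝐗_p` with respect to `ψ`. -/
def IsSelfDual (ψ : AddChar ℚ_[p] Circle) (dx : Measure (X p)) : Prop :=
  dx.IsAddHaarMeasure ∧ ∀ φ : X p → ℂ, IsBruhatSchwartz φ →
    ∀ x, fourier ψ dx (fourier ψ dx φ) x = φ (-x)

/-- The pairing `ℬ_ω(φ₁, φ₂) = ∫ φ₁(x) \overline{φ₂(x)} dx`. -/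
def weilPairing (dx : Measure (X p)) (φ₁ φ₂ : X p → ℂ) : ℂ :=
  ∫ x, φ₁ x * (starRingEnd ℂ) (φ₂ x) ∂dx

/-! ### The groups `H⁰(ℚ_p) = GSO(V_p)` and `H⁰₁(ℚ_p) = SO(V_p)` -/

variable (p)

/-- The diagonal embedding `z ↦ (z, z)` of `ℚ_p^×`. -/
def diagScalar : ℚ_[p]ˣ →* GL (Fin 2) ℚ_[p] × GL (Fin 2) ℚ_[p] :=
  (Matrix.GeneralLinearGroup.scalar (Fin 2)).prod (Matrix.GeneralLinearGroup.scalar (Fin 2))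

/-- The subgroup `ℚ_p^×` of `GL₂(ℚ_p) × GL₂(ℚ_p)`, embedded as `(z, z)`. -/
def center2 : Subgroup (GL (Fin 2) ℚ_[p] × GL (Fin 2) ℚ_[p]) := (diagScalar p).range

lemma diagScalar_comm (z : ℚ_[p]ˣ) (g : GL (Fin 2) ℚ_[p] × GL (Fin 2) ℚ_[p]) :
    g * diagScalar p z = diagScalar p z * g :=
  Prod.ext (Matrix.GeneralLinearGroup.scalar_commute z g.1).symm
    (Matrix.GeneralLinearGroup.scalar_commute z g.2).symm

instance : (center2 p).Normal where
  conj_mem := by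
    rintro _ ⟨z, rfl⟩ g
    exact ⟨z, by rw [diagScalar_comm, mul_inv_cancel_right]⟩

/-- `H⁰(ℚ_p) = (GL₂(ℚ_p) × GL₂(ℚ_p)) / ℚ_p^×`. -/
abbrev H0 : Type := (GL (Fin 2) ℚ_[p] × GL (Fin 2) ℚ_[p]) ⧸ center2 p

/-- The similitude character `ν(a, d) = n(a) n(d)⁻¹`. -/
def nu : H0 p →* ℚ_[p]ˣ :=
  QuotientGroup.lift (center2 p)
    (Matrix.GeneralLinearGroup.det.comp (MonoidHom.fst _ _) /
      Matrix.GeneralLinearGroup.det.comp (MonoidHom.snd _ _)) (by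
    rintro _ ⟨z, rfl⟩
    exact div_self' _)

/-- `H⁰₁(ℚ_p)`, the kernel of the similitude character. -/
abbrev H01 : Type := (nu p).ker

instance : MeasurableSpace (H01 p) := borel _
instance : BorelSpace (H01 p) := ⟨rfl⟩

/-- The action of `GL₂ × GL₂` on `V_p`: `ϱ(a, d) x = a x d⁻¹`. -/
def rhoAux : GL (Fin 2) ℚ_[p] × GL (Fin 2) ℚ_[p] →* Module.End ℚ_[p] (V p) where
  toFun g := LinearMap.mulLeft ℚ_[p] (g.1 : V p) ∘ₗ
    LinearMap.mulRight ℚ_[p] ((g.2⁻¹ : GL (Fin 2) ℚ_[p]) : V p)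
  map_one' := by ext1 x; simp
  map_mul' g h := by
    ext1 x
    simp only [Prod.fst_mul, Prod.snd_mul, mul_inv_rev, Units.val_mul, LinearMap.comp_apply,
      LinearMap.mulRight_apply, LinearMap.mulLeft_apply, Module.End.mul_apply, mul_assoc]

/-- The action `ϱ` of `H⁰(ℚ_p)` on `V_p`. -/
def rho : H0 p →* Module.End ℚ_[p] (V p) :=
  QuotientGroup.lift (center2 p) (rhoAux p) (by
    rintro _ ⟨z, rfl⟩
    ext1 x
    change (Matrix.GeneralLinearGroup.scalar (Fin 2) z : V p) *
      (x * ((Matrix.GeneralLinearGroup.scalar (Fin 2) z)⁻¹ : GL (Fin 2) ℚ_[p])) = x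
    rw [← mul_assoc, Matrix.GeneralLinearGroup.coe_scalar,
      Matrix.scalar_comm _ (Commute.all _), ← Matrix.GeneralLinearGroup.coe_scalar, mul_assoc,
      Units.mul_inv, mul_one])

variable {p}

/-- The Weil representation of `H⁰₁(ℚ_p)`: `(ω(h)φ)(x) = φ(h⁻¹x)`. -/
def weil (h : H01 p) (φ : X p → ℂ) (x : X p) : ℂ :=
  φ (rho p (h : H0 p)⁻¹ x.1, rho p (h : H0 p)⁻¹ x.2)

/-! ### Orders, open compact subgroups, the test function -/

/-- The standard Eichler order of level `p ^ e` in `M₂(ℤ_p)`. -/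
def eichler (p : ℕ) [Fact p.Prime] (e : ℕ) : Set (V p) :=
  {x | (∀ i j, ‖x i j‖ ≤ 1) ∧ ‖x 1 0‖ ≤ (p : ℝ) ^ (-(e : ℤ))}

/-- The unit group of the standard Eichler order of level `p ^ e`. -/
def eichlerUnits (p : ℕ) [Fact p.Prime] (e : ℕ) : Set (GL (Fin 2) ℚ_[p]) :=
  {k | (k : V p) ∈ eichler p e ∧ ((k⁻¹ : GL (Fin 2) ℚ_[p]) : V p) ∈ eichler p e}

/-- `𝒰_p = H⁰₁(ℚ_p) ∩ (R^× × R^×)/ℤ_p^×`, with `R` the Eichler order of level `p ^ e`. -/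
def calU (p : ℕ) [Fact p.Prime] (e : ℕ) : Set (H01 p) :=
  {h | ∃ r s : GL (Fin 2) ℚ_[p], r ∈ eichlerUnits p e ∧ s ∈ eichlerUnits p e ∧
    (h : H0 p) = QuotientGroup.mk (r, s)}

open Classical in
/-- The characteristic function of `L_p ⊕ L_p`, where `L_p` is the Eichler order of level `p ^ e`
(which is stable under the main involution). -/
def phiStar (p : ℕ) [Fact p.Prime] (e : ℕ) (x : X p) : ℂ :=
  if x.1 ∈ eichler p e ∧ x.2 ∈ eichler p e then 1 else 0

/-! ### Unramified principal series and special representations -/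

/-- `χ` is trivial on `ℤ_p^×`. -/
def IsUnramified (χ : ℚ_[p]ˣ →* ℂˣ) : Prop := ∀ u : ℚ_[p]ˣ, ‖(u : ℚ_[p])‖ = 1 → χ u = 1

variable (p) in
/-- The absolute value, as a character of `ℚ_p^×`. -/
def absChar : ℚ_[p]ˣ →* ℂˣ :=
  Units.map ((Complex.ofRealHom : ℝ →* ℂ).comp (normHom : ℚ_[p] →*₀ ℝ))

variable (p) in
/-- The character `|·|^{1/2}` of `ℚ_p^×`. -/
def sqrtAbsChar : ℚ_[p]ˣ →* ℂˣ where
  toFun a := Units.mk0 (Real.sqrt ‖(a : ℚ_[p])‖ : ℂ) (by simp)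
  map_one' := by ext; simp
  map_mul' a b := by ext; simp [Real.sqrt_mul (norm_nonneg _)]

variable (p) in
/-- The prime `p`, as an element of `ℚ_p^×`. -/
def pUnit : ℚ_[p]ˣ :=
  Units.mk0 (p : ℚ_[p]) (Nat.cast_ne_zero.mpr (Fact.out : p.Prime).ne_zero)

/-- The upper triangular matrix `(a x; 0 d)`. -/
def upper (a d : ℚ_[p]ˣ) (x : ℚ_[p]) : GL (Fin 2) ℚ_[p] :=
  Matrix.GeneralLinearGroup.mkOfDetNeZero !![(a : ℚ_[p]), x; 0, (d : ℚ_[p])] (by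
    simp [Matrix.det_fin_two])

/-- Right translation on functions on `GL₂(ℚ_p)`. -/
def rightTranslation (p : ℕ) [Fact p.Prime] :
    Representation ℂ (GL (Fin 2) ℚ_[p]) (GL (Fin 2) ℚ_[p] → ℂ) where
  toFun h := LinearMap.funLeft ℂ ℂ (fun g => g * h)
  map_one' := by ext f g; simp [LinearMap.funLeft]
  map_mul' h k := by ext f g; simp [LinearMap.funLeft, mul_assoc]

/-- The space of the normalized induction of the characters `μ, ν`: the functions `f` on
`GL₂(ℚ_p)` that are right invariant under some open subgroup and satisfy
`f((a x; 0 d) g) = μ(a) ν(d) |a/d|^{1/2} f(g)`. -/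
def inducedSpace (μ ν : ℚ_[p]ˣ →* ℂˣ) : Submodule ℂ (GL (Fin 2) ℚ_[p] → ℂ) where
  carrier := {f | (∃ U : Subgroup (GL (Fin 2) ℚ_[p]), IsOpen (U : Set (GL (Fin 2) ℚ_[p])) ∧
      ∀ k ∈ U, ∀ g, f (g * k) = f g) ∧
    ∀ (a d : ℚ_[p]ˣ) (x : ℚ_[p]) (g : GL (Fin 2) ℚ_[p]),
      f (upper a d x * g) =
        (μ a : ℂ) * (ν d : ℂ) * (Real.sqrt (‖(a : ℚ_[p])‖ / ‖(d : ℚ_[p])‖) : ℂ) * f g}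
  zero_mem' := ⟨⟨⊤, isOpen_univ, fun _ _ _ => rfl⟩, fun _ _ _ _ => by simp⟩
  add_mem' := by
    rintro f f' ⟨⟨U, hU, hf⟩, hf2⟩ ⟨⟨U', hU', hf'⟩, hf2'⟩
    refine ⟨⟨U ⊓ U', hU.inter hU', fun k hk g => ?_⟩, fun a d x g => ?_⟩
    · simp [hf k hk.1 g, hf' k hk.2 g]
    · simp [hf2, hf2', mul_add]
  smul_mem' := by
    rintro c f ⟨⟨U, hU, hf⟩, hf2⟩
    refine ⟨⟨U, hU, fun k hk g => ?_⟩, fun a d x g => ?_⟩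
    · simp [hf k hk g]
    · simp only [Pi.smul_apply, hf2, smul_eq_mul]; ring

lemma rightTranslation_mem (μ ν : ℚ_[p]ˣ →* ℂˣ) (h : GL (Fin 2) ℚ_[p])
    {f : GL (Fin 2) ℚ_[p] → ℂ} (hf : f ∈ inducedSpace μ ν) :
    rightTranslation p h f ∈ inducedSpace μ ν := by
  obtain ⟨⟨U, hU, hf⟩, hf2⟩ := hf
  refine ⟨⟨U.comap (MulAut.conj h⁻¹).toMonoidHom, ?_, fun k hk g => ?_⟩, fun a d x g => ?_⟩
  · refine hU.preimage (f := fun k => h⁻¹ * k * (h⁻¹)⁻¹) ?_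
    fun_prop
  · change f (g * k * h) = f (g * h)
    rw [← hf _ hk (g * h)]
    congr 1
    simp [mul_assoc]
  · change f (upper a d x * g * h) = _ * f (g * h)
    rw [mul_assoc, hf2]

/-- The induced representation of `μ, ν`: `GL₂(ℚ_p)` acts by right translation. If
`μ ν⁻¹ ≠ |·|^{±1}`, this is the principal series representation `π(μ, ν)`. -/
def inducedRep (μ ν : ℚ_[p]ˣ →* ℂˣ) :
    Representation ℂ (GL (Fin 2) ℚ_[p]) (inducedSpace μ ν) where
  toFun h := (rightTranslation p h).restrict fun _ hf => rightTranslation_mem μ ν h hf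
  map_one' := by ext f : 2; simp
  map_mul' h k := by
    ext f : 2
    simp

/-- The multiples of `χ ∘ det` in the space induced from `χ|·|^{-1/2}, χ|·|^{1/2}`. -/
def detLine (χ : ℚ_[p]ˣ →* ℂˣ) :
    Submodule ℂ (inducedSpace (χ * (sqrtAbsChar p)⁻¹) (χ * sqrtAbsChar p)) where
  carrier := {f | ∃ c : ℂ, ∀ g : GL (Fin 2) ℚ_[p], (f : GL (Fin 2) ℚ_[p] → ℂ) g =
    c * (χ (Matrix.GeneralLinearGroup.det g) : ℂ)}
  zero_mem' := ⟨0, fun _ => by simp⟩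
  add_mem' := by
    rintro f f' ⟨c, hc⟩ ⟨c', hc'⟩
    exact ⟨c + c', fun g => by simp [hc, hc', add_mul]⟩
  smul_mem' := by
    rintro a f ⟨c, hc⟩
    exact ⟨a * c, fun g => by simp [hc, mul_assoc]⟩

/-- The special representation `St ⊗ (χ ∘ det)`: the quotient of the representation induced from
`χ|·|^{-1/2}, χ|·|^{1/2}` by the line spanned by `χ ∘ det`. -/
def specialRep (χ : ℚ_[p]ˣ →* ℂˣ) :
    Representation ℂ (GL (Fin 2) ℚ_[p])
      (inducedSpace (χ * (sqrtAbsChar p)⁻¹) (χ * sqrtAbsChar p) ⧸ detLine χ) :=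
  (inducedRep (χ * (sqrtAbsChar p)⁻¹) (χ * sqrtAbsChar p)).quotient (detLine χ) (by
    rintro h f ⟨c, hc⟩
    refine ⟨c * (χ (Matrix.GeneralLinearGroup.det h) : ℂ), fun g => ?_⟩
    change (f : GL (Fin 2) ℚ_[p] → ℂ) (g * h) = _
    rw [hc, map_mul, map_mul, Units.val_mul]
    ring)

/-- The two kinds of local components that occur at a prime where the level is square-free:
unramified principal series `π(μ, ν)` and unramified special representations `St ⊗ (χ ∘ det)`. -/
inductive LocalType (p : ℕ) [Fact p.Prime]
  | principal (μ ν : ℚ_[p]ˣ →* ℂˣ)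
  | special (χ : ℚ_[p]ˣ →* ℂˣ)

/-- The representation `π` of `PGL₂(ℚ_p)` is isomorphic to the representation of type `τ`. -/
def HasType {W : Type*} [AddCommGroup W] [Module ℂ W]
    (π : Representation ℂ PGL(2, ℚ_[p]) W) : LocalType p → Prop
  | .principal μ ν => IsUnramified μ ∧ IsUnramified ν ∧
      μ * ν⁻¹ ≠ absChar p ∧ μ * ν⁻¹ ≠ (absChar p)⁻¹ ∧
      Nonempty (Representation.Equiv (π.comp Matrix.ProjGenLinGroup.mk) (inducedRep μ ν))
  | .special χ => IsUnramified χ ∧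
      Nonempty (Representation.Equiv (π.comp Matrix.ProjGenLinGroup.mk) (specialRep χ))

/-- The exponent of the conductor, that is of the prime in the level `𝔑⁺`. -/
def LocalType.level : LocalType p → ℕ
  | .principal _ _ => 0
  | .special _ => 1

/-- `f` is a new vector of `π`, when the exponent of the conductor of `π` is `c`. -/
def IsNewVector {W : Type*} [AddCommGroup W] [Module ℂ W]
    (π : Representation ℂ PGL(2, ℚ_[p]) W) (c : ℕ) (f : W) : Prop :=
  f ≠ 0 ∧ ∀ k ∈ eichlerUnits p c, π (Matrix.ProjGenLinGroup.mk k) f = f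

/-! ### Langlands parameters and the Asai `L`-factor -/

/-- Weil–Deligne representations of `ℚ_p` on which the inertia group acts trivially: a geometric
Frobenius `Φ` and a monodromy operator `N` with `Φ N = p⁻¹ N Φ`. -/
structure UnramifiedWD (p : ℕ) (W : Type*) [AddCommGroup W] [Module ℂ W] where
  frob : W →ₗ[ℂ] W
  frob_isUnit : IsUnit frob
  monodromy : W →ₗ[ℂ] W
  rel : frob ∘ₗ monodromy = (p : ℂ)⁻¹ • (monodromy ∘ₗ frob)

namespace UnramifiedWD

variable {W W' : Type*} [AddCommGroup W] [Module ℂ W] [AddCommGroup W'] [Module ℂ W']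

/-- The tensor product of two Weil–Deligne representations. -/
def tensor (ρ : UnramifiedWD p W) (ρ' : UnramifiedWD p W') : UnramifiedWD p (W ⊗[ℂ] W') where
  frob := TensorProduct.map ρ.frob ρ'.frob
  frob_isUnit := by
    obtain ⟨u, hu⟩ := ρ.frob_isUnit
    obtain ⟨v, hv⟩ := ρ'.frob_isUnit
    rw [← hu, ← hv]
    refine ⟨⟨TensorProduct.map (u : W →ₗ[ℂ] W) (v : W' →ₗ[ℂ] W'),
      TensorProduct.map (↑u⁻¹) (↑v⁻¹), ?_, ?_⟩, rfl⟩
    · rw [← TensorProduct.map_mul, Units.mul_inv, Units.mul_inv, TensorProduct.map_one]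
    · rw [← TensorProduct.map_mul, Units.inv_mul, Units.inv_mul, TensorProduct.map_one]
  monodromy := TensorProduct.map ρ.monodromy LinearMap.id +
    TensorProduct.map LinearMap.id ρ'.monodromy
  rel := by
    rw [LinearMap.comp_add, LinearMap.add_comp, ← TensorProduct.map_comp, ← TensorProduct.map_comp,
      ← TensorProduct.map_comp, ← TensorProduct.map_comp, ρ.rel, ρ'.rel,
      TensorProduct.map_smul_left, TensorProduct.map_smul_right, smul_add]
    rfl

lemma frob_mem_ker (ρ : UnramifiedWD p W) (w : W) (hw : w ∈ LinearMap.ker ρ.monodromy) :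
    ρ.frob w ∈ LinearMap.ker ρ.monodromy := by
  have hp : (p : ℂ) ≠ 0 := Nat.cast_ne_zero.mpr (Fact.out : p.Prime).ne_zero
  have h := LinearMap.congr_fun ρ.rel w
  simp only [LinearMap.comp_apply, LinearMap.smul_apply, LinearMap.mem_ker.mp hw, map_zero] at h
  exact (smul_eq_zero.mp h.symm).resolve_left (inv_ne_zero hp)

/-- `L(s, ρ) = det(1 - p^{-s} Φ | ker N)⁻¹`. -/
def LFactor (ρ : UnramifiedWD p W) (s : ℂ) : ℂ :=
  (LinearMap.det (LinearMap.id - (p : ℂ) ^ (-s) • ρ.frob.restrict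
    (p := LinearMap.ker ρ.monodromy) (q := LinearMap.ker ρ.monodromy) fun w hw =>
      ρ.frob_mem_ker w hw))⁻¹

end UnramifiedWD

/-- The Langlands parameter of `π(μ, ν)`: `Φ = diag(μ(p), ν(p))` and `N = 0`. -/
def principalParameter (μ ν : ℚ_[p]ˣ →* ℂˣ) : UnramifiedWD p (Fin 2 → ℂ) where
  frob := Matrix.toLin' !![(μ (pUnit p) : ℂ), 0; 0, (ν (pUnit p) : ℂ)]
  frob_isUnit := by
    rw [LinearMap.isUnit_iff_isUnit_det, LinearMap.det_toLin']
    simp [Matrix.det_fin_two]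
  monodromy := 0
  rel := by simp

/-- The Langlands parameter of `St ⊗ (χ ∘ det)`:
`Φ = χ(p) diag(p^{1/2}, p^{-1/2})`, and `N e₀ = e₁`, `N e₁ = 0`. -/
def specialParameter (χ : ℚ_[p]ˣ →* ℂˣ) : UnramifiedWD p (Fin 2 → ℂ) where
  frob := Matrix.toLin' !![(χ (pUnit p) : ℂ) * (Real.sqrt p : ℂ), 0;
    0, (χ (pUnit p) : ℂ) * (Real.sqrt p : ℂ)⁻¹]
  frob_isUnit := by
    have hp : (0 : ℝ) < p := Nat.cast_pos.mpr (Fact.out : p.Prime).pos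
    have h : (Real.sqrt p : ℂ) ≠ 0 := Complex.ofReal_ne_zero.mpr (Real.sqrt_pos.mpr hp).ne'
    rw [LinearMap.isUnit_iff_isUnit_det, LinearMap.det_toLin']
    simp [Matrix.det_fin_two, h]
  monodromy := Matrix.toLin' !![0, 0; 1, 0]
  rel := by
    have hp : (0 : ℝ) < p := Nat.cast_pos.mpr (Fact.out : p.Prime).pos
    have h : (Real.sqrt p : ℂ) ≠ 0 := Complex.ofReal_ne_zero.mpr (Real.sqrt_pos.mpr hp).ne'
    have h2 : (Real.sqrt p : ℂ) * (Real.sqrt p : ℂ) = p := by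
      rw [← Complex.ofReal_mul, Real.mul_self_sqrt hp.le, Complex.ofReal_natCast]
    rw [← Matrix.toLin'_mul, ← Matrix.toLin'_mul, ← map_smul, ← h2]
    congr 1
    ext i j
    fin_cases i <;> fin_cases j <;> simp
    field_simp

/-- The Langlands parameter attached to a local type. -/
def LocalType.parameter : LocalType p → UnramifiedWD p (Fin 2 → ℂ)
  | .principal μ ν => principalParameter μ ν
  | .special χ => specialParameter χ

/-- `L(s, As⁺(π_p))` for `p` split in `F`: the `L`-factor of the tensor product of the Langlands
parameters of the two components of `π_p`. -/
def asaiLFactor (τ₁ τ₂ : LocalType p) (s : ℂ) : ℂ := (τ₁.parameter.tensor τ₂.parameter).LFactor s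

/-- `ζ_p(s) = (1 - p^{-s})⁻¹`. -/
def zetaFactor (p : ℕ) (s : ℂ) : ℂ := (1 - (p : ℂ) ^ (-s))⁻¹

/-! ### The representation `σ`, its pairing, its test vector, the zeta integral -/

section

variable {W₁ W₂ : Type*} [AddCommGroup W₁] [Module ℂ W₁] [AddCommGroup W₂] [Module ℂ W₂]

/-- The projections of `H⁰(ℚ_p)` to `PGL₂(ℚ_p) × PGL₂(ℚ_p)`. -/
def toPGLProd (p : ℕ) [Fact p.Prime] : H0 p →* PGL(2, ℚ_[p]) × PGL(2, ℚ_[p]) :=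
  QuotientGroup.lift (center2 p)
    (MonoidHom.prodMap Matrix.ProjGenLinGroup.mk Matrix.ProjGenLinGroup.mk) (by
    rintro _ ⟨z, rfl⟩
    exact Prod.ext (Matrix.ProjGenLinGroup.mk_scalar z) (Matrix.ProjGenLinGroup.mk_scalar z))

/-- The representation `σ = π₁ ⊠ π₂` of `H⁰(ℚ_p)`. -/
def sigma (π₁ : Representation ℂ PGL(2, ℚ_[p]) W₁) (π₂ : Representation ℂ PGL(2, ℚ_[p]) W₂) :
    Representation ℂ (H0 p) (W₁ ⊗[ℂ] W₂) :=
  Representation.tprod (π₁.comp ((MonoidHom.fst _ _).comp (toPGLProd p)))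
    (π₂.comp ((MonoidHom.snd _ _).comp (toPGLProd p)))

/-- `B` is a positive definite Hermitian form (linear in the first variable) that is invariant
under `σ`. -/
structure IsInvariantHermitian {W : Type*} [AddCommGroup W] [Module ℂ W]
    (σ : Representation ℂ (H0 p) W) (B : W →ₗ[ℂ] W →ₗ⋆[ℂ] ℂ) : Prop where
  hermitian : ∀ x y, B y x = (starRingEnd ℂ) (B x y)
  pos : ∀ x, x ≠ 0 → 0 < (B x x).re
  invariant : ∀ h x y, B (σ h x) (σ h y) = B x y

/-- The Atkin–Lehner matrix `(0 1; -ϖ 0)`. -/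
def atkinLehner (ϖ : ℚ_[p]ˣ) : GL (Fin 2) ℚ_[p] :=
  Matrix.GeneralLinearGroup.mkOfDetNeZero !![0, 1; -(ϖ : ℚ_[p]), 0] (by
    simp [Matrix.det_fin_two])

open Classical in
/-- The vector `f^†`: it is `f⁰ + ε₂ σ(η)f⁰`, with `η` the Atkin–Lehner element in the first
factor, if the first component is spherical and the second is special; it is `f⁰` otherwise. -/
def fDagger (σ : Representation ℂ (H0 p) (W₁ ⊗[ℂ] W₂)) (c₁ c₂ : ℕ) (ϖ : ℚ_[p]ˣ) (ε₂ : ℂ)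
    (f₀ : W₁ ⊗[ℂ] W₂) : W₁ ⊗[ℂ] W₂ :=
  if c₁ = 0 ∧ c₂ = 1 then
    f₀ + ε₂ • σ (QuotientGroup.mk (atkinLehner ϖ, 1)) f₀
  else f₀

/-- The integrand `ℬ_ω(ω(h)φ, φ) ℬ_σ(σ(h)f, f)` of the local zeta integral. -/
def zetaIntegrand {W : Type*} [AddCommGroup W] [Module ℂ W] (dx : Measure (X p))
    (σ : Representation ℂ (H0 p) W) (B : W →ₗ[ℂ] W →ₗ⋆[ℂ] ℂ) (φ : X p → ℂ) (f : W)
    (h : H01 p) : ℂ :=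
  weilPairing dx (weil h φ) φ * B (σ h f) f

/-- The local zeta integral `𝒵_p(φ, f)`. -/
def localZetaIntegral {W : Type*} [AddCommGroup W] [Module ℂ W] (dx : Measure (X p))
    (dh : Measure (H01 p)) (σ : Representation ℂ (H0 p) W) (B : W →ₗ[ℂ] W →ₗ⋆[ℂ] ℂ)
    (φ : X p → ℂ) (f : W) : ℂ :=
  ∫ h, zetaIntegrand dx σ B φ f h ∂dh

end

end SplitZeta
end

noncomputable section

namespace SplitZeta

variable {p : ℕ} [Fact p.Prime]

/-! The integrand is right invariant under the open compact group $\mathcal U_e$, so the integral is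
$\mathrm{vol}(\mathcal U_e)$ times a sum over cosets. Modulo the diagonal centre, a coset is a pair
of cosets $aK$, $dK$ with $K=R_e^\times$ and $\det a=\det d$ of valuation 0 or 1. Grouping the pairs
by double cosets splits the sum into three ingredients: the Weil coefficient, which depends only on
the two double cosets; the action of the two double coset operators on the test vector; and a
numerical series (`integral_of_cosets`, `CosetReps.zeta_eq`).

The Weil coefficient is the volume of $(R\cap aRd^{-1})^2$. After moving units out, $a$ and $d$ are
monomial and the intersection is a box. As $\mathrm M_2(\mathbf Z_p)$ is its own dual lattice, the
self-dual measure gives $\mathrm M_2(\mathbf Z_p)^2$ volume 1. With $T=p^{-2}$ the coefficient is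
$T^{\max(N,M)}$ at level 0, for elementary divisors of ratio $p^N$, $p^M$, and $T^{1+\max(|n|,|m|)}$
at Iwahori level, for affine Weyl elements of signed lengths $n$, $m$.

Spherical case. Let $x,x'$ be $\sqrt p$ times the Satake parameters, so that $xx'=p$. The double
coset operators act by $h_N-h_{N-2}$, where $h_N$ is the complete homogeneous polynomial in $x,x'$.
Partial sums over $N$ of one parity telescope to $h_N$, so summation over square shells turns the
double sum into $(1-T^2)\sum_N T^N h_N(x,x')h_N(y,y')$. The product of two recurrences of order two
has a rational generating series, with denominator $\prod(1-Tx_iy_j)$ and numerator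
$1-xx'yy'T^2=1-p^{-2}$. This is the asserted quotient of $L$-values.

Iwahori case. The Atkin–Lehner element $\eta$ normalises the Iwahori group and reverses signed
length, and the double coset of length $n\ge0$ acts through $U_p^n\eta^n$. A special new vector has
$U_p=-\varepsilon$ and $\eta=\varepsilon$, so the second factor contributes $\pm(-1)^{|m|}$ and its
alternating sum is explicit (`hasSum_alternating_max`). What remains is the generating series of
$\mathcal B_\sigma(U_p^Ng_1\otimes f_2,g_1\otimes f_2)$: geometric when $\pi_1$ is special, and
given by a recurrence of order two when $\pi_1$ is spherical, since $f_1,\eta f_1$ are stable under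
$U_p$. The two determinant classes give the factor $1+\varepsilon$. When $\pi_1$ is spherical,
$f^\dagger$ makes $g_1$ an $\eta$-eigenvector of eigenvalue $\varepsilon_2$.

Convergence needs $|x|,|x'|<p$. Unitarity makes the Hecke eigenvalue real of size at most $p+1$,
hence $|x|\le p$, with equality only for $x=\pm p$, which $\mu\nu^{-1}\ne|\cdot|^{\pm1}$ excludes
(`exists_real_eigenvalue`, `norm_lt_of_add_real`, `satake_parameters`). -/

/-! ### Norms and residues in $\mathbf Q_p$. -/

lemma prime_cast_ne_zero : (p : ℚ_[p]) ≠ 0 := Nat.cast_ne_zero.mpr (Fact.out : p.Prime).ne_zero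

lemma one_lt_prime_real : (1 : ℝ) < p := Nat.one_lt_cast.mpr (Fact.out : p.Prime).one_lt

lemma prime_real_pos : (0 : ℝ) < p := zero_lt_one.trans one_lt_prime_real

lemma padic_norm_add_le {x y : ℚ_[p]} {r : ℝ} (hx : ‖x‖ ≤ r) (hy : ‖y‖ ≤ r) : ‖x + y‖ ≤ r :=
  (Padic.nonarchimedean x y).trans (max_le hx hy)

lemma padic_norm_sub_le {x y : ℚ_[p]} {r : ℝ} (hx : ‖x‖ ≤ r) (hy : ‖y‖ ≤ r) : ‖x - y‖ ≤ r := by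
  rw [sub_eq_add_neg]; exact padic_norm_add_le hx (by rwa [norm_neg])

lemma padic_norm_mul_le_one {x y : ℚ_[p]} (hx : ‖x‖ ≤ 1) (hy : ‖y‖ ≤ 1) : ‖x * y‖ ≤ 1 := by
  rw [norm_mul]; exact mul_le_one₀ hx (norm_nonneg _) hy

lemma exists_norm_eq_zpow {x : ℚ_[p]} (hx : x ≠ 0) : ∃ n : ℤ, ‖x‖ = (p : ℝ) ^ n :=
  ⟨-x.valuation, Padic.norm_eq_zpow_neg_valuation hx⟩

/-- Norms are powers of $p$, so a strict inequality gains a full factor $p$. This replaces the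
language of valuations in the case distinctions below. -/
lemma prime_mul_norm_le_of_lt {x y : ℚ_[p]} (h : ‖x‖ < ‖y‖) : p * ‖x‖ ≤ ‖y‖ := by
  have hy : y ≠ 0 := fun h0 => by rw [h0, norm_zero] at h; exact absurd h (norm_nonneg _).not_gt
  obtain ⟨n, hn⟩ := exists_norm_eq_zpow hy
  rw [hn] at h ⊢
  have := (Padic.norm_lt_pow_iff_norm_le_pow_sub_one x n).mp h
  calc p * ‖x‖ ≤ p * (p : ℝ) ^ (n - 1) := by gcongr
    _ = _ := by rw [← zpow_one_add₀ prime_real_pos.ne']; congr 1; ring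

/-- An integral element of `ℚ_p` is congruent to a natural number modulo `p ^ N`. -/
lemma exists_nat_approx {t : ℚ_[p]} (ht : ‖t‖ ≤ 1) (N : ℕ) :
    ∃ x < p ^ N, ‖t - (x : ℕ)‖ ≤ (p : ℝ) ^ (-(N : ℤ)) := by
  let u : ℤ_[p] := ⟨t, ht⟩
  refine ⟨u.appr N, PadicInt.appr_lt _ _, ?_⟩
  have := ((u - (u.appr N : ℤ_[p])).norm_le_pow_iff_mem_span_pow N).mpr (PadicInt.appr_spec N _)
  rw [PadicInt.norm_def] at this
  push_cast at this
  exact this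

lemma nat_eq_of_norm_sub_le {N x y : ℕ} (hx : x < p ^ N) (hy : y < p ^ N)
    (h : ‖((x : ℕ) : ℚ_[p]) - (y : ℕ)‖ ≤ (p : ℝ) ^ (-(N : ℤ))) : x = y := by
  have h1 : ‖(((x : ℤ) - y : ℤ) : ℚ_[p])‖ ≤ (p : ℝ) ^ (-(N : ℤ)) := by push_cast; exact h
  rw [Padic.norm_int_le_pow_iff_dvd] at h1
  have h2 := Int.eq_zero_of_abs_lt_dvd h1 (by
    rw [abs_lt]
    constructor <;> zify at hx hy <;> linarith [Int.natCast_nonneg x, Int.natCast_nonneg y])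
  omega

lemma norm_natCast_le_one (x : ℕ) : ‖(x : ℚ_[p])‖ ≤ 1 := by
  simpa using Padic.norm_int_le_one (p := p) (x : ℤ)

/-! ### Matrices -/

lemma det_entries (g : GL (Fin 2) ℚ_[p]) :
    (g : V p).det = (g : V p) 0 0 * (g : V p) 1 1 - (g : V p) 0 1 * (g : V p) 1 0 :=
  Matrix.det_fin_two _

lemma inv_entries (g : GL (Fin 2) ℚ_[p]) :
    ((g⁻¹ : GL (Fin 2) ℚ_[p]) : V p) = ((g : V p).det)⁻¹ •
      !![(g : V p) 1 1, -(g : V p) 0 1; -(g : V p) 1 0, (g : V p) 0 0] := by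
  rw [Matrix.GeneralLinearGroup.coe_inv, Matrix.inv_def, Matrix.adjugate_fin_two,
    Ring.inverse_eq_inv']

lemma norm_det_le {g : V p} {r : ℝ} (h : ∀ i j, ‖g i j‖ ≤ r) : ‖g.det‖ ≤ r ^ 2 := by
  have hr : 0 ≤ r := (norm_nonneg _).trans (h 0 0)
  rw [Matrix.det_fin_two, sq]
  apply padic_norm_sub_le <;> rw [norm_mul] <;> gcongr <;> apply h

/-- The determinants of a unit and its inverse are integral with product 1. Conversely the inverse
is the adjugate divided by the determinant, and the adjugate stays in the order. -/
lemma mem_eichlerUnits_iff {e : ℕ} {k : GL (Fin 2) ℚ_[p]} :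
    k ∈ eichlerUnits p e ↔ (k : V p) ∈ eichler p e ∧ ‖(k : V p).det‖ = 1 := by
  constructor
  · rintro ⟨h1, h2⟩
    refine ⟨h1, ?_⟩
    have e1 := norm_det_le h1.1
    have e2 := norm_det_le h2.1
    have e3 : ‖(k : V p).det‖ * ‖((k⁻¹ : GL (Fin 2) ℚ_[p]) : V p).det‖ = 1 := by
      rw [← norm_mul, ← Matrix.det_mul, ← Units.val_mul, mul_inv_cancel]; simp
    rw [one_pow] at e1 e2
    nlinarith [norm_nonneg (k : V p).det, norm_nonneg ((k⁻¹ : GL (Fin 2) ℚ_[p]) : V p).det]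
  · rintro ⟨h1, h2⟩
    refine ⟨h1, ?_⟩
    rw [inv_entries]
    refine ⟨fun i j => ?_, ?_⟩
    · fin_cases i <;> fin_cases j <;> simp [h2, h1.1]
    · simpa [h2] using h1.2

/-- The unit group of the Eichler order, as a subgroup. -/
def eichlerSubgroup (p : ℕ) [Fact p.Prime] (e : ℕ) : Subgroup (GL (Fin 2) ℚ_[p]) where
  carrier := eichlerUnits p e
  one_mem' := by
    rw [mem_eichlerUnits_iff]
    refine ⟨⟨fun i j => ?_, ?_⟩, by simp⟩
    · fin_cases i <;> fin_cases j <;> simp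
    · simp
  mul_mem' := by
    intro a b ha hb
    rw [mem_eichlerUnits_iff] at *
    refine ⟨⟨fun i j => ?_, ?_⟩, by simp [ha.2, hb.2]⟩
    · rw [Units.val_mul, Matrix.mul_apply, Fin.sum_univ_two]
      exact padic_norm_add_le (padic_norm_mul_le_one (ha.1.1 _ _) (hb.1.1 _ _))
        (padic_norm_mul_le_one (ha.1.1 _ _) (hb.1.1 _ _))
    · rw [Units.val_mul, Matrix.mul_apply, Fin.sum_univ_two]
      apply padic_norm_add_le <;> rw [norm_mul]
      · exact (mul_le_of_le_one_right (norm_nonneg _) (hb.1.1 _ _)).trans ha.1.2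
      · exact (mul_le_of_le_one_left (norm_nonneg _) (ha.1.1 _ _)).trans hb.1.2
  inv_mem' := by
    rintro a ⟨h1, h2⟩
    exact ⟨h2, by rwa [inv_inv]⟩

lemma mem_eichlerSubgroup {e : ℕ} {k : GL (Fin 2) ℚ_[p]} :
    k ∈ eichlerSubgroup p e ↔ (k : V p) ∈ eichler p e ∧ ‖(k : V p).det‖ = 1 :=
  mem_eichlerUnits_iff

lemma mem_eichlerSubgroup_zero {k : GL (Fin 2) ℚ_[p]} :
    k ∈ eichlerSubgroup p 0 ↔ (∀ i j, ‖(k : V p) i j‖ ≤ 1) ∧ ‖(k : V p).det‖ = 1 := by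
  rw [mem_eichlerSubgroup]
  exact and_congr_left fun _ => ⟨fun h => h.1, fun h => ⟨h, by simpa using h 1 0⟩⟩

lemma eichlerSubgroup_one_le : eichlerSubgroup p 1 ≤ eichlerSubgroup p 0 := fun _ hk =>
  mem_eichlerSubgroup_zero.mpr ⟨(mem_eichlerSubgroup.mp hk).1.1, (mem_eichlerSubgroup.mp hk).2⟩

/-! ### Atkin–Lehner, unipotent and Hecke matrices. -/

variable (p) in
/-- The Atkin–Lehner matrix of the uniformizer `p`. -/
abbrev eta : GL (Fin 2) ℚ_[p] := atkinLehner (pUnit p)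

/-- The unipotent matrix `(1 x; 0 1)`. -/
abbrev uni (x : ℚ_[p]) : GL (Fin 2) ℚ_[p] := upper 1 1 x

/-- The matrix `(p ^ N x; 0 1)`. -/
abbrev heckeMat (N : ℕ) (x : ℚ_[p]) : GL (Fin 2) ℚ_[p] := upper (pUnit p ^ N) 1 x

@[simp] lemma coe_upper (a d : ℚ_[p]ˣ) (x : ℚ_[p]) :
    (upper a d x : V p) = !![(a : ℚ_[p]), x; 0, (d : ℚ_[p])] := rfl

@[simp] lemma coe_atkinLehner (ϖ : ℚ_[p]ˣ) :
    (atkinLehner ϖ : V p) = !![0, 1; -(ϖ : ℚ_[p]), 0] := rfl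

@[simp] lemma coe_pUnit : (pUnit p : ℚ_[p]) = p := rfl

lemma coe_scalar_eq (z : ℚ_[p]ˣ) :
    (Matrix.GeneralLinearGroup.scalar (Fin 2) z : V p) = !![(z : ℚ_[p]), 0; 0, (z : ℚ_[p])] := by
  ext i j
  fin_cases i <;> fin_cases j <;> simp [Matrix.GeneralLinearGroup.coe_scalar]

lemma atkinLehner_sq (ϖ : ℚ_[p]ˣ) :
    atkinLehner ϖ * atkinLehner ϖ = Matrix.GeneralLinearGroup.scalar (Fin 2) (-ϖ) := by
  apply Units.ext
  rw [coe_scalar_eq]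
  simp

lemma det_atkinLehner (ϖ : ℚ_[p]ˣ) : (atkinLehner ϖ : V p).det = ϖ := by
  simp [Matrix.det_fin_two]

lemma coe_eta_inv : (((eta p)⁻¹ : GL (Fin 2) ℚ_[p]) : V p) = !![0, -(p : ℚ_[p])⁻¹; 1, 0] := by
  rw [inv_entries, det_atkinLehner]
  ext i j
  fin_cases i <;> fin_cases j <;> simp

lemma coe_eta_conj (g : GL (Fin 2) ℚ_[p]) : (((eta p)⁻¹ * g * eta p : GL (Fin 2) ℚ_[p]) : V p) =
    !![(g : V p) 1 1, -(p : ℚ_[p])⁻¹ * (g : V p) 1 0;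
      -(p : ℚ_[p]) * (g : V p) 0 1, (g : V p) 0 0] := by
  rw [Units.val_mul, Units.val_mul, coe_eta_inv, coe_atkinLehner]
  have := prime_cast_ne_zero (p := p)
  rw [Matrix.eta_fin_two (g : V p), Matrix.mul_fin_two, Matrix.mul_fin_two]
  ext i j
  fin_cases i <;> fin_cases j <;> simp [this, mul_comm]

/-- Conjugation by `eta` swaps the diagonal entries and exchanges the off-diagonal ones up to a
factor $-p^{\pm1}$, which is the asymmetry built into the Iwahori group. -/
lemma eta_conj_mem {k : GL (Fin 2) ℚ_[p]} (hk : k ∈ eichlerSubgroup p 1) :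
    (eta p)⁻¹ * k * eta p ∈ eichlerSubgroup p 1 := by
  rw [mem_eichlerSubgroup] at *
  obtain ⟨⟨h1, h2⟩, h3⟩ := hk
  have hp := prime_real_pos (p := p)
  refine ⟨⟨fun i j => ?_, ?_⟩, ?_⟩
  · rw [coe_eta_conj]
    fin_cases i <;> fin_cases j <;> simp [h1]
    · rw [← le_div_iff₀' hp]; simpa using h2
    · exact mul_le_one₀ (inv_le_one_of_one_le₀ one_lt_prime_real.le) (norm_nonneg _) (h1 _ _)
  · rw [coe_eta_conj]
    simp only [neg_mul, Matrix.of_apply, Matrix.cons_val', Matrix.cons_val_zero,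
      Matrix.cons_val_one, Matrix.cons_val_fin_one, norm_neg, norm_mul, Padic.norm_p]
    simpa using mul_le_of_le_one_right (inv_nonneg.mpr hp.le) (h1 0 1)
  · rw [Units.val_mul, Units.val_mul, Matrix.det_mul, Matrix.det_mul, mul_right_comm,
      ← Matrix.det_mul, ← Units.val_mul]
    simpa using h3

lemma eta_sq_comm (g : GL (Fin 2) ℚ_[p]) : eta p * eta p * g = g * (eta p * eta p) := by
  rw [atkinLehner_sq, Matrix.GeneralLinearGroup.scalar_commute]

lemma eta_conj_mem' {k : GL (Fin 2) ℚ_[p]} (hk : k ∈ eichlerSubgroup p 1) :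
    eta p * k * (eta p)⁻¹ ∈ eichlerSubgroup p 1 := by
  have h : eta p * k * (eta p)⁻¹ = (eta p)⁻¹ * k * eta p := by
    rw [mul_inv_eq_iff_eq_mul, mul_assoc, mul_assoc, ← eta_sq_comm k]
    group
  rw [h]; exact eta_conj_mem hk

lemma uni_mem {x : ℚ_[p]} (hx : ‖x‖ ≤ 1) (e : ℕ) : uni x ∈ eichlerSubgroup p e := by
  rw [mem_eichlerSubgroup]
  refine ⟨⟨fun i j => ?_, ?_⟩, by simp [Matrix.det_fin_two]⟩
  · fin_cases i <;> fin_cases j <;> simp [hx]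
  · simp

/-- The scalar matrix `p ^ s`. -/
abbrev scalarPow (p : ℕ) [Fact p.Prime] (s : ℤ) : GL (Fin 2) ℚ_[p] :=
  Matrix.GeneralLinearGroup.scalar (Fin 2) (pUnit p ^ s)

lemma coe_scalarPow_mul (s : ℤ) (g : GL (Fin 2) ℚ_[p]) (i j : Fin 2) :
    ((scalarPow p s * g : GL (Fin 2) ℚ_[p]) : V p) i j = (p : ℚ_[p]) ^ s * (g : V p) i j := by
  rw [Units.val_mul, coe_scalar_eq, Matrix.eta_fin_two (g : V p), Matrix.mul_fin_two]
  fin_cases i <;> fin_cases j <;> simp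

lemma coe_hecke_inv_mul (s : ℤ) (N : ℕ) (x : ℚ_[p]) (g : GL (Fin 2) ℚ_[p]) (j : Fin 2) :
    (((scalarPow p s * heckeMat N x)⁻¹ * g : GL (Fin 2) ℚ_[p]) : V p) 0 j =
      (p : ℚ_[p]) ^ (-s - N) * ((g : V p) 0 j - x * (g : V p) 1 j) ∧
    (((scalarPow p s * heckeMat N x)⁻¹ * g : GL (Fin 2) ℚ_[p]) : V p) 1 j =
      (p : ℚ_[p]) ^ (-s) * (g : V p) 1 j := by
  have hp := prime_cast_ne_zero (p := p)
  obtain ⟨h, rfl⟩ : ∃ h, g = scalarPow p s * heckeMat N x * h :=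
    ⟨_, (mul_inv_cancel_left _ _).symm⟩
  rw [inv_mul_cancel_left, mul_assoc, coe_scalarPow_mul, coe_scalarPow_mul]
  have h0 : ((heckeMat N x * h : GL (Fin 2) ℚ_[p]) : V p) 0 j =
      (p : ℚ_[p]) ^ N * (h : V p) 0 j + x * (h : V p) 1 j := by
    simp [Matrix.mul_apply, Fin.sum_univ_two]
  have h1 : ((heckeMat N x * h : GL (Fin 2) ℚ_[p]) : V p) 1 j = (h : V p) 1 j := by
    simp [Matrix.mul_apply, Fin.sum_univ_two]
  rw [h0, h1]
  constructor
  · rw [zpow_sub₀ hp, zpow_neg, zpow_natCast]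
    field_simp
    ring
  · rw [zpow_neg]
    field_simp

lemma norm_det_scalarPow_mul_hecke (s : ℤ) (N : ℕ) (x : ℚ_[p]) :
    ((scalarPow p s * heckeMat N x : GL (Fin 2) ℚ_[p]) : V p).det = (p : ℚ_[p]) ^ (2 * s + N) := by
  have hp := prime_cast_ne_zero (p := p)
  rw [Units.val_mul, Matrix.det_mul, coe_scalar_eq]
  simp [Matrix.det_fin_two, zpow_add₀ hp, two_mul]

/-! ### Cosets of the maximal compact subgroup. -/

/-- A matrix whose largest entry lies in its bottom row. -/
lemma exists_hecke_of_bottom {g : GL (Fin 2) ℚ_[p]} {j₀ : Fin 2}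
    (hg : ∀ i j, ‖(g : V p) i j‖ ≤ ‖(g : V p) 1 j₀‖) :
    ∃ (s : ℤ) (N x : ℕ), x < p ^ N ∧
      (scalarPow p s * heckeMat N (x : ℚ_[p]))⁻¹ * g ∈ eichlerSubgroup p 0 := by
  have hp := prime_real_pos (p := p)
  have hdet0 : (g : V p).det ≠ 0 := g.det_ne_zero
  have hy : (g : V p) 1 j₀ ≠ 0 := by
    intro h0
    apply hdet0
    have := norm_det_le hg
    rw [h0, norm_zero] at this
    exact norm_le_zero_iff.mp (by simpa using this)
  obtain ⟨m, hm⟩ := exists_norm_eq_zpow hy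
  obtain ⟨δ, hδ⟩ := exists_norm_eq_zpow hdet0
  have hle : δ ≤ 2 * m := by
    have := norm_det_le hg
    rw [hm, hδ, ← zpow_natCast, ← zpow_mul, zpow_le_zpow_iff_right₀ one_lt_prime_real] at this
    push_cast at this; omega
  obtain ⟨N, hN⟩ : ∃ N : ℕ, (N : ℤ) = 2 * m - δ := ⟨(2 * m - δ).toNat, by omega⟩
  have hratio : ‖(g : V p) 0 j₀ / (g : V p) 1 j₀‖ ≤ 1 := by
    rw [norm_div]; exact div_le_one_of_le₀ (hg _ _) (norm_nonneg _)
  obtain ⟨x, hx, hx'⟩ := exists_nat_approx hratio N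
  refine ⟨-m, N, x, hx, ?_⟩
  have hu₀ : ‖(g : V p) 0 j₀ - x * (g : V p) 1 j₀‖ ≤ (p : ℝ) ^ (m - N) := by
    have : (g : V p) 0 j₀ - x * (g : V p) 1 j₀ =
        ((g : V p) 0 j₀ / (g : V p) 1 j₀ - x) * (g : V p) 1 j₀ := by field_simp
    rw [this, norm_mul, hm, show m - (N : ℤ) = -N + m by ring, zpow_add₀ hp.ne']
    gcongr
  have hu : ∀ j, ‖(g : V p) 0 j - x * (g : V p) 1 j‖ ≤ (p : ℝ) ^ (m - N) := by
    intro j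
    have key : ‖((g : V p) 0 j - x * (g : V p) 1 j) * (g : V p) 1 j₀‖ ≤ (p : ℝ) ^ (2 * m - N) := by
      have hd : ‖(g : V p).det‖ ≤ (p : ℝ) ^ (2 * m - N) := by rw [hδ]; apply le_of_eq; congr 1; omega
      have hmul : ‖((g : V p) 0 j₀ - x * (g : V p) 1 j₀) * (g : V p) 1 j‖ ≤
          (p : ℝ) ^ (2 * m - N) := by
        rw [norm_mul, show (2 * m - N : ℤ) = (m - N) + m by ring, zpow_add₀ hp.ne']
        gcongr
        rw [← hm]; exact hg _ _
      have e := det_entries g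
      have hd' : ‖-(g : V p).det‖ ≤ (p : ℝ) ^ (2 * m - N) := by rwa [norm_neg]
      have hz : ‖(0 : ℚ_[p])‖ ≤ (p : ℝ) ^ (2 * m - N) := by rw [norm_zero]; positivity
      -- This expression is a $2\times2$ minor of the row-reduced matrix with columns $j$ and $j_0$:
      -- it is $\pm\det g$, or 0 if the columns coincide. So the bound obtained in column $j_0$
      -- spreads to the other column.
      have : ((g : V p) 0 j - x * (g : V p) 1 j) * (g : V p) 1 j₀ -
          ((g : V p) 0 j₀ - x * (g : V p) 1 j₀) * (g : V p) 1 j = (g : V p).det ∨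
        ((g : V p) 0 j - x * (g : V p) 1 j) * (g : V p) 1 j₀ -
          ((g : V p) 0 j₀ - x * (g : V p) 1 j₀) * (g : V p) 1 j = -(g : V p).det ∨
        ((g : V p) 0 j - x * (g : V p) 1 j) * (g : V p) 1 j₀ -
          ((g : V p) 0 j₀ - x * (g : V p) 1 j₀) * (g : V p) 1 j = 0 := by
        rw [e]
        fin_cases j <;> fin_cases j₀ <;> simp only [Fin.zero_eta, Fin.mk_one]
        · right; right; ring
        · left; ring
        · right; left; ring
        · right; right; ring
      rcases this with h | h | h <;> rw [sub_eq_iff_eq_add] at h <;> rw [h] <;>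
        exact padic_norm_add_le ‹_› hmul
    rw [norm_mul, hm, show (2 * m - N : ℤ) = (m - N) + m by ring, zpow_add₀ hp.ne'] at key
    exact le_of_mul_le_mul_right key (by positivity)
  rw [mem_eichlerSubgroup_zero]
  constructor
  · intro i j
    have hc := coe_hecke_inv_mul (-m) N (x : ℚ_[p]) g j
    fin_cases i
    · simp only [Fin.zero_eta]
      rw [hc.1, norm_mul, Padic.norm_p_zpow]
      calc (p : ℝ) ^ (-(-(-m) - (N : ℤ))) * _ ≤
          (p : ℝ) ^ (-(-(-m) - (N : ℤ))) * (p : ℝ) ^ (m - N) := by gcongr; exact hu j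
        _ = 1 := by rw [← zpow_add₀ hp.ne']; simp
    · simp only [Fin.mk_one]
      rw [hc.2, norm_mul, Padic.norm_p_zpow]
      calc (p : ℝ) ^ (-(-(-m))) * _ ≤ (p : ℝ) ^ (-(-(-m))) * (p : ℝ) ^ m := by
            gcongr; rw [← hm]; exact hg 1 j
        _ = 1 := by rw [← zpow_add₀ hp.ne']; simp
  · have h1 : ((scalarPow p (-m) * heckeMat N (x : ℚ_[p]) : GL (Fin 2) ℚ_[p]) : V p).det *
        (((scalarPow p (-m) * heckeMat N (x : ℚ_[p]))⁻¹ * g : GL (Fin 2) ℚ_[p]) : V p).det =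
        (g : V p).det := by
      rw [← Matrix.det_mul, ← Units.val_mul, mul_inv_cancel_left]
    have h2 := congrArg norm h1
    rw [norm_mul, norm_det_scalarPow_mul_hecke, Padic.norm_p_zpow, hδ,
      show (-(2 * -m + (N : ℤ))) = δ by omega] at h2
    exact mul_left_cancel₀ (by positivity) (h2.trans (mul_one _).symm)

/-- The number of elements of the second family of representatives. -/
def secondCard (p N : ℕ) : ℕ := if N = 0 then 0 else p ^ (N - 1)

/-- Representatives of the cosets of `GL₂(ℤ_p)` among the matrices with determinant of
valuation `e`, sorted by elementary divisors. -/
def sphericalRep (p : ℕ) [Fact p.Prime] (e : Fin 2) (n : ℕ) :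
    Fin (p ^ (2 * n + (e : ℕ))) ⊕ Fin (secondCard p (2 * n + (e : ℕ))) → GL (Fin 2) ℚ_[p]
  | .inl x => scalarPow p (-n) * heckeMat (2 * n + e) ((x : ℕ) : ℚ_[p])
  | .inr x => eta p * (scalarPow p (-n) * heckeMat (2 * n + e - 1) ((x : ℕ) : ℚ_[p]))

lemma eq_zero_or_one (e : Fin 2) : (e : ℕ) = 0 ∨ (e : ℕ) = 1 := by omega

lemma secondCard_of_fin {N : ℕ} (x : Fin (secondCard p N)) : N ≠ 0 ∧ (x : ℕ) < p ^ (N - 1) := by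
  have h := x.2
  unfold secondCard at h
  split_ifs at h with h0
  · omega
  · exact ⟨h0, h⟩

lemma coe_eta_inv_mul (g : GL (Fin 2) ℚ_[p]) (j : Fin 2) :
    (((eta p)⁻¹ * g : GL (Fin 2) ℚ_[p]) : V p) 0 j = -(p : ℚ_[p])⁻¹ * (g : V p) 1 j ∧
    (((eta p)⁻¹ * g : GL (Fin 2) ℚ_[p]) : V p) 1 j = (g : V p) 0 j := by
  rw [Units.val_mul, coe_eta_inv]
  constructor <;> simp [Matrix.mul_apply, Fin.sum_univ_two]

lemma sphericalRep_det (e : Fin 2) (n : ℕ) (i) :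
    (sphericalRep p e n i : V p).det = (p : ℚ_[p]) ^ (e : ℕ) := by
  have hp := prime_cast_ne_zero (p := p)
  rcases i with x | x
  · rw [sphericalRep, norm_det_scalarPow_mul_hecke]
    push_cast
    rw [show 2 * -(n : ℤ) + (2 * n + (e : ℕ)) = (e : ℕ) by ring, zpow_natCast]
  · obtain ⟨h0, -⟩ := secondCard_of_fin x
    rw [sphericalRep, Units.val_mul, Matrix.det_mul, det_atkinLehner, norm_det_scalarPow_mul_hecke,
      coe_pUnit, ← zpow_one_add₀ hp, ← zpow_natCast]
    congr 1
    omega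

lemma det_of_inv_mul_mem {e : ℕ} {r g : GL (Fin 2) ℚ_[p]} (h : r⁻¹ * g ∈ eichlerSubgroup p e) :
    ‖(r : V p).det‖ = ‖(g : V p).det‖ := by
  have h1 := (mem_eichlerSubgroup.mp h).2
  rw [← mul_inv_cancel_left r g, Units.val_mul, Matrix.det_mul, norm_mul, h1, mul_one]

lemma exists_sphericalRep (e : Fin 2) {g : GL (Fin 2) ℚ_[p]}
    (hg : ‖(g : V p).det‖ = (p : ℝ) ^ (-((e : ℕ) : ℤ))) :
    ∃ i : Σ n, Fin (p ^ (2 * n + (e : ℕ))) ⊕ Fin (secondCard p (2 * n + (e : ℕ))),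
      (sphericalRep p e i.1 i.2)⁻¹ * g ∈ eichlerSubgroup p 0 := by
  have hp := prime_real_pos (p := p)
  obtain ⟨⟨i₀, j₀⟩, hmax⟩ := Finite.exists_max fun q : Fin 2 × Fin 2 => ‖(g : V p) q.1 q.2‖
  have hbot : ∀ j₀ : Fin 2, (∀ i j, ‖(g : V p) i j‖ ≤ ‖(g : V p) 1 j₀‖) →
      ∃ i : Σ n, Fin (p ^ (2 * n + (e : ℕ))) ⊕ Fin (secondCard p (2 * n + (e : ℕ))),
        (sphericalRep p e i.1 i.2)⁻¹ * g ∈ eichlerSubgroup p 0 := by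
    intro j₀ hb
    obtain ⟨s, N, x, hx, hk⟩ := exists_hecke_of_bottom hb
    have hd := det_of_inv_mul_mem hk
    rw [hg, norm_det_scalarPow_mul_hecke, Padic.norm_p_zpow] at hd
    have hd' := zpow_right_injective₀ hp one_lt_prime_real.ne' hd
    have := eq_zero_or_one e
    -- Comparing determinants gives $2s+N=e$ with $N\ge0$ and $e\le1$, which forces $s\le0$.
    obtain ⟨n, rfl⟩ : ∃ n : ℕ, s = -n := ⟨(-s).toNat, by omega⟩
    obtain rfl : N = 2 * n + e := by omega
    exact ⟨⟨n, .inl ⟨x, hx⟩⟩, hk⟩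
  by_cases hcase : ∃ j₁, ‖(g : V p) i₀ j₀‖ ≤ ‖(g : V p) 1 j₁‖
  · obtain ⟨j₁, h₁⟩ := hcase
    exact hbot j₁ fun i j => (hmax (i, j)).trans h₁
  · push Not at hcase
    have hi₀ : i₀ = 0 := by
      by_contra h
      obtain rfl : i₀ = 1 := by omega
      exact lt_irrefl _ (hcase j₀)
    subst hi₀
    -- When the top row strictly dominates, multiplication by $\eta^{-1}$ moves it to the bottom.
    -- The old bottom row gets divided by $p$, and by discreteness of the norm it still does not
    -- exceed the top row.
    obtain ⟨s, N, x, hx, hk⟩ := exists_hecke_of_bottom (g := (eta p)⁻¹ * g) (j₀ := j₀) (by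
      intro i j
      rw [(coe_eta_inv_mul g j₀).2]
      fin_cases i
      · simp only [Fin.zero_eta]
        rw [(coe_eta_inv_mul g j).1, norm_mul, norm_neg, norm_inv, Padic.norm_p, inv_inv]
        exact prime_mul_norm_le_of_lt (hcase j)
      · simp only [Fin.mk_one]
        rw [(coe_eta_inv_mul g j).2]
        exact hmax (0, j))
    rw [← mul_assoc, ← mul_inv_rev] at hk
    have hd := det_of_inv_mul_mem hk
    rw [hg, Units.val_mul, Matrix.det_mul, det_atkinLehner, norm_mul, norm_det_scalarPow_mul_hecke,
      Padic.norm_p_zpow, coe_pUnit, Padic.norm_p, ← zpow_neg_one, ← zpow_add₀ hp.ne'] at hd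
    have hd' := zpow_right_injective₀ hp one_lt_prime_real.ne' hd
    have := eq_zero_or_one e
    obtain ⟨n, rfl⟩ : ∃ n : ℕ, s = -n := ⟨(-s).toNat, by omega⟩
    obtain rfl : N = 2 * n + e - 1 := by omega
    have hx' : x < secondCard p (2 * n + (e : ℕ)) := by
      rw [secondCard, if_neg (by omega)]; exact hx
    exact ⟨⟨n, .inr ⟨x, hx'⟩⟩, hk⟩

/-- Each row norm can only decrease under right multiplication by $\mathrm{GL}_2(\mathbf Z_p)$,
hence is an invariant of the coset. These invariants separate the representatives. -/
lemma row_mul_le {r k : GL (Fin 2) ℚ_[p]} {C : ℝ} {i : Fin 2} (hr : ∀ j, ‖(r : V p) i j‖ ≤ C)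
    (hk : k ∈ eichlerSubgroup p 0) (j : Fin 2) :
    ‖((r * k : GL (Fin 2) ℚ_[p]) : V p) i j‖ ≤ C := by
  rw [Units.val_mul, Matrix.mul_apply, Fin.sum_univ_two]
  have h := (mem_eichlerSubgroup_zero.mp hk).1
  apply padic_norm_add_le <;> rw [norm_mul]
  · exact (mul_le_of_le_one_right (norm_nonneg _) (h _ _)).trans (hr _)
  · exact (mul_le_of_le_one_right (norm_nonneg _) (h _ _)).trans (hr _)

lemma norm_scalarPow_mul_hecke (n N x : ℕ) (i j : Fin 2) :
    ‖((scalarPow p (-n) * heckeMat N (x : ℚ_[p]) : GL (Fin 2) ℚ_[p]) : V p) i j‖ ≤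
      (p : ℝ) ^ (n : ℤ) := by
  have hp := prime_real_pos (p := p)
  rw [coe_scalarPow_mul, norm_mul, Padic.norm_p_zpow, neg_neg]
  refine mul_le_of_le_one_right (by positivity) ?_
  fin_cases i <;> fin_cases j <;> simp [norm_natCast_le_one]
  exact inv_le_one_of_one_le₀ (one_le_pow₀ one_lt_prime_real.le)

lemma coe_eta_mul (g : GL (Fin 2) ℚ_[p]) (j : Fin 2) :
    ((eta p * g : GL (Fin 2) ℚ_[p]) : V p) 0 j = (g : V p) 1 j ∧
    ((eta p * g : GL (Fin 2) ℚ_[p]) : V p) 1 j = -(p : ℚ_[p]) * (g : V p) 0 j := by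
  rw [Units.val_mul, coe_atkinLehner]
  constructor <;> simp [Matrix.mul_apply, Fin.sum_univ_two]

lemma sphericalRep_norm_le (e : Fin 2) (n : ℕ) (x) (i j : Fin 2) :
    ‖(sphericalRep p e n x : V p) i j‖ ≤ (p : ℝ) ^ (n : ℤ) := by
  rcases x with x | x
  · exact norm_scalarPow_mul_hecke _ _ _ _ _
  · rw [sphericalRep]
    fin_cases i
    · simp only [Fin.zero_eta]
      rw [(coe_eta_mul _ _).1]
      exact norm_scalarPow_mul_hecke _ _ _ _ _
    · simp only [Fin.mk_one]
      rw [(coe_eta_mul _ _).2, norm_mul, norm_neg, Padic.norm_p]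
      exact (mul_le_of_le_one_left (norm_nonneg _)
        (inv_le_one_of_one_le₀ one_lt_prime_real.le)).trans (norm_scalarPow_mul_hecke _ _ _ _ _)

/-- Together with `sphericalRep_norm_le` this makes $p^n$ the largest entry norm, so that $n$ can be
read off the coset. -/
lemma exists_sphericalRep_norm (e : Fin 2) (n : ℕ) (x) :
    ∃ i, ‖(sphericalRep p e n x : V p) i 1‖ = (p : ℝ) ^ (n : ℤ) := by
  rcases x with x | x
  · refine ⟨1, ?_⟩
    rw [sphericalRep, coe_scalarPow_mul]
    simp
  · refine ⟨0, ?_⟩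
    rw [sphericalRep, (coe_eta_mul _ _).1, coe_scalarPow_mul]
    simp

lemma hecke_inv_mul_hecke {s : ℤ} {N x y : ℕ} (hx : x < p ^ N) (hy : y < p ^ N)
    (h : (scalarPow p s * heckeMat N (x : ℚ_[p]))⁻¹ * (scalarPow p s * heckeMat N (y : ℚ_[p])) ∈
      eichlerSubgroup p 0) : x = y := by
  have hp := prime_cast_ne_zero (p := p)
  have h1 := (mem_eichlerSubgroup_zero.mp h).1 0 1
  rw [(coe_hecke_inv_mul _ _ _ _ _).1, coe_scalarPow_mul, coe_scalarPow_mul] at h1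
  have e1 : (p : ℚ_[p]) ^ (-s - (N : ℤ)) * ((p : ℚ_[p]) ^ s * (heckeMat N (y : ℚ_[p]) : V p) 0 1 -
      x * ((p : ℚ_[p]) ^ s * (heckeMat N (y : ℚ_[p]) : V p) 1 1)) =
      (p : ℚ_[p]) ^ (-(N : ℤ)) * ((y : ℚ_[p]) - x) := by
    simp only [coe_upper, Matrix.of_apply, Matrix.cons_val', Matrix.cons_val_one,
      Matrix.cons_val_fin_one, Matrix.cons_val_zero, Units.val_one, mul_one]
    rw [sub_eq_add_neg, zpow_add₀ hp, zpow_neg]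
    field_simp
  rw [e1, norm_mul, Padic.norm_p_zpow, neg_neg] at h1
  refine (nat_eq_of_norm_sub_le hy hx ?_).symm
  rw [zpow_neg, ← one_div, le_div_iff₀' (zpow_pos prime_real_pos _)]
  exact h1

/-- The largest entry recovers $n$. The bottom row separates the two families: it has norm $p^n$ in
the first and at most $p^{n-1}$ in the second. Within a family, the upper right entry recovers the
residue. -/
lemma sphericalRep_unique (e : Fin 2)
    (i j : Σ n, Fin (p ^ (2 * n + (e : ℕ))) ⊕ Fin (secondCard p (2 * n + (e : ℕ))))
    (h : (sphericalRep p e i.1 i.2)⁻¹ * sphericalRep p e j.1 j.2 ∈ eichlerSubgroup p 0) :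
    i = j := by
  have hp := prime_real_pos (p := p)
  have hle : ∀ i j : Σ n, Fin (p ^ (2 * n + (e : ℕ))) ⊕ Fin (secondCard p (2 * n + (e : ℕ))),
      (sphericalRep p e i.1 i.2)⁻¹ * sphericalRep p e j.1 j.2 ∈ eichlerSubgroup p 0 →
      j.1 ≤ i.1 := by
    intro i j h
    obtain ⟨k, hk⟩ := exists_sphericalRep_norm e j.1 j.2
    have := row_mul_le (i := k) (fun l => sphericalRep_norm_le e i.1 i.2 k l) h 1
    rw [mul_inv_cancel_left, hk, zpow_le_zpow_iff_right₀ one_lt_prime_real] at this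
    exact_mod_cast this
  have hcross : ∀ (n : ℕ) x y, (sphericalRep p e n (.inr x))⁻¹ * sphericalRep p e n (.inl y) ∉
      eichlerSubgroup p 0 := by
    intro n x y h
    have := row_mul_le (r := sphericalRep p e n (.inr x)) (i := 1)
      (C := (p : ℝ)⁻¹ * (p : ℝ) ^ (n : ℤ)) (fun l => by
      rw [sphericalRep, (coe_eta_mul _ _).2, norm_mul, norm_neg, Padic.norm_p]
      gcongr
      exact norm_scalarPow_mul_hecke _ _ _ _ _) h 1
    rw [mul_inv_cancel_left] at this
    change ‖((scalarPow p (-n) * heckeMat (2 * n + e) ((y : ℕ) : ℚ_[p]) : GL (Fin 2) ℚ_[p]) :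
      V p) 1 1‖ ≤ _ at this
    rw [coe_scalarPow_mul, norm_mul, Padic.norm_p_zpow] at this
    simp only [neg_neg, coe_upper, Units.val_one, Matrix.of_apply, Matrix.cons_val_one,
      Matrix.cons_val', Matrix.cons_val_fin_one, norm_one, mul_one] at this
    have h2 : (p : ℝ)⁻¹ < 1 := inv_lt_one_of_one_lt₀ one_lt_prime_real
    exact absurd this (not_le.mpr (mul_lt_of_lt_one_left (by positivity) h2))
  have hsymm : ∀ r s : GL (Fin 2) ℚ_[p], r⁻¹ * s ∈ eichlerSubgroup p 0 →
      s⁻¹ * r ∈ eichlerSubgroup p 0 := fun r s h => by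
    have := inv_mem h
    rwa [mul_inv_rev, inv_inv] at this
  obtain ⟨n, x⟩ := i
  obtain ⟨m, y⟩ := j
  obtain rfl : n = m := le_antisymm (hle _ _ (hsymm _ _ h)) (hle _ _ h)
  rcases x with x | x <;> rcases y with y | y
  · exact congrArg (Sigma.mk n) (congrArg Sum.inl (Fin.ext (hecke_inv_mul_hecke x.2 y.2 h)))
  · exact absurd (hsymm _ _ h) (hcross n y x)
  · exact absurd h (hcross n x y)
  · have h' : (scalarPow p (-n) * heckeMat (2 * n + e - 1) ((x : ℕ) : ℚ_[p]))⁻¹ *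
        (scalarPow p (-n) * heckeMat (2 * n + e - 1) ((y : ℕ) : ℚ_[p])) ∈ eichlerSubgroup p 0 := by
      have h2 : (eta p * (scalarPow p (-n) * heckeMat (2 * n + e - 1) ((x : ℕ) : ℚ_[p])))⁻¹ *
        (eta p * (scalarPow p (-n) * heckeMat (2 * n + e - 1) ((y : ℕ) : ℚ_[p]))) ∈
          eichlerSubgroup p 0 := h
      rwa [mul_inv_rev, mul_assoc, inv_mul_cancel_left] at h2
    exact congrArg (Sigma.mk n) (congrArg Sum.inr (Fin.ext
      (hecke_inv_mul_hecke (secondCard_of_fin x).2 (secondCard_of_fin y).2 h')))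

/-! ### Cosets of the Iwahori subgroup. -/

variable (p) in
/-- Representatives of determinant one of the affine Weyl group, indexed by signed length. -/
def weyl (n : ℤ) : GL (Fin 2) ℚ_[p] :=
  if Even n then upper (pUnit p ^ (n / 2)) (pUnit p ^ (-(n / 2))) 0
  else Matrix.GeneralLinearGroup.mkOfDetNeZero
    !![0, (p : ℚ_[p]) ^ (n / 2); -(p : ℚ_[p]) ^ (-(n / 2)), 0] (by
      simp [Matrix.det_fin_two, zpow_ne_zero _ (prime_cast_ne_zero (p := p))])

lemma coe_weyl_even (k : ℤ) :
    (weyl p (2 * k) : V p) = !![(p : ℚ_[p]) ^ k, 0; 0, (p : ℚ_[p]) ^ (-k)] := by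
  rw [weyl, if_pos (even_two_mul k), coe_upper, Int.mul_ediv_cancel_left _ two_ne_zero]
  simp

lemma coe_weyl_odd (k : ℤ) :
    (weyl p (2 * k + 1) : V p) = !![0, (p : ℚ_[p]) ^ k; -(p : ℚ_[p]) ^ (-k), 0] := by
  have h : (2 * k + 1) / 2 = k := by omega
  rw [weyl, if_neg (by simp)]
  change !![0, (p : ℚ_[p]) ^ ((2 * k + 1) / 2); -(p : ℚ_[p]) ^ (-((2 * k + 1) / 2)), 0] = _
  rw [h]

lemma det_weyl (n : ℤ) : (weyl p n : V p).det = 1 := by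
  have hp := prime_cast_ne_zero (p := p)
  obtain ⟨k, rfl | rfl⟩ := Int.even_or_odd' n
  · rw [coe_weyl_even]; simp [Matrix.det_fin_two, zpow_ne_zero _ hp]
  · rw [coe_weyl_odd]; simp [Matrix.det_fin_two, zpow_ne_zero _ hp]

lemma coe_weyl_even_inv (k : ℤ) :
    (((weyl p (2 * k))⁻¹ : GL (Fin 2) ℚ_[p]) : V p) =
      !![(p : ℚ_[p]) ^ (-k), 0; 0, (p : ℚ_[p]) ^ k] := by
  rw [inv_entries, det_weyl, coe_weyl_even]; simp

lemma coe_weyl_odd_inv (k : ℤ) :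
    (((weyl p (2 * k + 1))⁻¹ : GL (Fin 2) ℚ_[p]) : V p) =
      !![0, -(p : ℚ_[p]) ^ k; (p : ℚ_[p]) ^ (-k), 0] := by
  rw [inv_entries, det_weyl, coe_weyl_odd]; simp

lemma weyl_zero : weyl p 0 = 1 := by
  apply Units.ext
  have := coe_weyl_even (p := p) 0
  rw [mul_zero] at this
  rw [this]
  ext i j; fin_cases i <;> fin_cases j <;> simp

/-- The Atkin–Lehner element swaps the two simple reflections, of signed lengths $1$ and $-1$, so it
reverses signed length. This allows everything to be done for $n\ge0$ only. -/
lemma eta_weyl_conj (n : ℤ) : (eta p)⁻¹ * weyl p n * eta p = weyl p (-n) := by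
  apply Units.ext
  rw [coe_eta_conj]
  have hp := prime_cast_ne_zero (p := p)
  obtain ⟨k, rfl | rfl⟩ := Int.even_or_odd' n
  · rw [← mul_neg, coe_weyl_even, coe_weyl_even]
    simp
  · rw [show -(2 * k + 1) = 2 * (-k - 1) + 1 by ring, coe_weyl_odd, coe_weyl_odd]
    ext i j
    fin_cases i <;> fin_cases j <;> simp
    · rw [sub_eq_add_neg, zpow_add₀ hp, zpow_neg, zpow_neg_one]; field_simp
    · rw [zpow_add₀ hp]; field_simp

lemma eta_weyl_conj' (n : ℤ) : eta p * weyl p n * (eta p)⁻¹ = weyl p (-n) := by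
  rw [mul_inv_eq_iff_eq_mul, ← eta_weyl_conj n]
  rw [mul_assoc, ← eta_sq_comm]
  group

lemma norm_diag_of_mem {u : GL (Fin 2) ℚ_[p]} (hu : u ∈ eichlerSubgroup p 1) :
    ‖(u : V p) 0 0‖ = 1 ∧ ‖(u : V p) 1 1‖ = 1 := by
  obtain ⟨⟨h1, h2⟩, h3⟩ := mem_eichlerSubgroup.mp hu
  have hlt : ‖(u : V p) 0 1 * (u : V p) 1 0‖ < 1 := by
    rw [norm_mul]
    refine (mul_le_of_le_one_left (norm_nonneg _) (h1 0 1)).trans_lt (h2.trans_lt ?_)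
    simpa using inv_lt_one_of_one_lt₀ one_lt_prime_real
  have : ‖(u : V p) 0 0 * (u : V p) 1 1‖ = 1 := by
    by_contra hne
    have h4 : ‖(u : V p) 0 0 * (u : V p) 1 1‖ < 1 :=
      lt_of_le_of_ne (padic_norm_mul_le_one (h1 _ _) (h1 _ _)) hne
    have h5 : ‖(u : V p).det‖ < 1 := by
      rw [det_entries, sub_eq_add_neg]
      exact (Padic.nonarchimedean _ _).trans_lt (max_lt h4 (by rwa [norm_neg]))
    rw [h3] at h5
    exact lt_irrefl _ h5
  rw [norm_mul] at this
  have a1 := h1 0 0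
  have a2 := h1 1 1
  constructor <;> nlinarith [norm_nonneg ((u : V p) 0 0), norm_nonneg ((u : V p) 1 1)]

/-- Disjointness in the Iwahori–Bruhat decomposition. For equal parities a diagonal entry must be a
unit, which fixes the length. For different parities the two off-diagonal bounds contradict each
other, the lower left one being strict. -/
lemma weyl_double_coset {n m : ℤ} {u : GL (Fin 2) ℚ_[p]} (hu : u ∈ eichlerSubgroup p 1)
    (h : (weyl p n)⁻¹ * u * weyl p m ∈ eichlerSubgroup p 1) : n = m := by
  have hp := prime_real_pos (p := p)
  obtain ⟨ha, hd⟩ := norm_diag_of_mem hu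
  obtain ⟨ha', hd'⟩ := norm_diag_of_mem h
  obtain ⟨⟨h1, h2⟩, -⟩ := mem_eichlerSubgroup.mp h
  have h01 := h1 0 1
  have aux : ∀ {a b : ℤ}, (p : ℝ) ^ a * (p : ℝ) ^ b = 1 → a + b = 0 := fun {a b} e => by
    rw [← zpow_add₀ hp.ne'] at e
    exact zpow_right_injective₀ hp one_lt_prime_real.ne' (e.trans (zpow_zero _).symm)
  rw [Units.val_mul, Units.val_mul, Matrix.eta_fin_two (u : V p)] at ha' h01 h2
  obtain ⟨k, rfl | rfl⟩ := Int.even_or_odd' n <;> obtain ⟨l, rfl | rfl⟩ := Int.even_or_odd' m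
  · rw [coe_weyl_even_inv, coe_weyl_even, Matrix.mul_fin_two, Matrix.mul_fin_two] at ha'
    simp [ha, -zpow_neg] at ha'
    have := aux ha'
    omega
  · exfalso
    rw [coe_weyl_even_inv, coe_weyl_odd, Matrix.mul_fin_two, Matrix.mul_fin_two] at h01 h2
    simp [ha, hd, -zpow_natCast, -zpow_neg] at h01 h2
    rw [← zpow_add₀ hp.ne', ← zpow_zero (p : ℝ), zpow_le_zpow_iff_right₀ one_lt_prime_real] at h01
    rw [← zpow_add₀ hp.ne', zpow_le_zpow_iff_right₀ one_lt_prime_real] at h2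
    omega
  · exfalso
    rw [coe_weyl_odd_inv, coe_weyl_even, Matrix.mul_fin_two, Matrix.mul_fin_two] at h01 h2
    simp [ha, hd, -zpow_natCast, -zpow_neg] at h01 h2
    rw [← zpow_add₀ hp.ne', ← zpow_zero (p : ℝ), zpow_le_zpow_iff_right₀ one_lt_prime_real] at h01
    rw [← zpow_add₀ hp.ne', zpow_le_zpow_iff_right₀ one_lt_prime_real] at h2
    omega
  · rw [coe_weyl_odd_inv, coe_weyl_odd, Matrix.mul_fin_two, Matrix.mul_fin_two] at ha'
    simp [hd, -zpow_neg] at ha'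
    have := aux ha'
    omega

/-- The translates of $w_nI$ by $1,\dots,p^n$-th residues in the upper unipotent group are distinct,
because $w_nIw_n^{-1}$ contains only the upper unipotents with entry in $p^n\mathbf Z_p$. -/
lemma weyl_conj_uni {n : ℕ} {t : ℚ_[p]}
    (h : (weyl p n)⁻¹ * uni t * weyl p n ∈ eichlerSubgroup p 1) : ‖t‖ ≤ (p : ℝ) ^ (-(n : ℤ)) := by
  have hp := prime_real_pos (p := p)
  obtain ⟨⟨h1, h2⟩, -⟩ := mem_eichlerSubgroup.mp h
  have h01 := h1 0 1
  rw [Units.val_mul, Units.val_mul, coe_upper] at h01 h2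
  obtain ⟨k, hk | hk⟩ := Int.even_or_odd' (n : ℤ) <;> rw [hk] at h01 h2 ⊢
  · rw [coe_weyl_even_inv, coe_weyl_even, Matrix.mul_fin_two, Matrix.mul_fin_two] at h01
    simp only [Matrix.of_apply, Matrix.cons_val', Matrix.cons_val_zero, Matrix.cons_val_one,
      Matrix.cons_val_fin_one, mul_zero, zero_mul, add_zero, zero_add, norm_mul,
      Padic.norm_p_zpow, neg_neg] at h01
    rw [mul_right_comm, ← zpow_add₀ hp.ne'] at h01
    rw [zpow_neg, ← one_div, le_div_iff₀' (by positivity), two_mul]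
    exact h01
  · rw [coe_weyl_odd_inv, coe_weyl_odd, Matrix.mul_fin_two, Matrix.mul_fin_two] at h2
    simp only [Matrix.of_apply, Matrix.cons_val', Matrix.cons_val_zero, Matrix.cons_val_one,
      Matrix.cons_val_fin_one, mul_zero, zero_mul, add_zero, zero_add, norm_mul, norm_neg,
      Padic.norm_p_zpow, neg_neg, mul_neg, Nat.cast_one] at h2
    rw [mul_right_comm, ← zpow_add₀ hp.ne', ← le_div_iff₀' (by positivity), ← zpow_sub₀ hp.ne']
      at h2
    exact h2.trans_eq (by congr 1; ring)

/-- Representatives of the cosets of the Iwahori subgroup among the matrices with determinant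
of valuation `e`, sorted by Iwahori double cosets. -/
def iwahoriRep (p : ℕ) [Fact p.Prime] (e : Fin 2) (n : ℤ) (x : Fin (p ^ n.natAbs)) :
    GL (Fin 2) ℚ_[p] :=
  (if 0 ≤ n then uni ((x : ℕ) : ℚ_[p]) * weyl p n
    else eta p * (uni ((x : ℕ) : ℚ_[p]) * weyl p (-n)) * (eta p)⁻¹) * eta p ^ (e : ℕ)

/-- Every representative is, up to the Iwahori subgroup on the left, monomial. -/
lemma iwahoriRep_eq (e : Fin 2) (n : ℤ) (x : Fin (p ^ n.natAbs)) :
    ∃ u ∈ eichlerSubgroup p 1, iwahoriRep p e n x = u * weyl p n * eta p ^ (e : ℕ) := by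
  have hx := uni_mem (p := p) (norm_natCast_le_one (x : ℕ)) 1
  by_cases hn : 0 ≤ n
  · exact ⟨_, hx, by rw [iwahoriRep, if_pos hn]⟩
  · refine ⟨_, eta_conj_mem' hx, ?_⟩
    have := eta_weyl_conj' (p := p) (-n)
    rw [neg_neg] at this
    rw [iwahoriRep, if_neg hn, ← this]
    group

lemma iwahoriRep_det (e : Fin 2) (n : ℤ) (x) :
    (iwahoriRep p e n x : V p).det = (p : ℚ_[p]) ^ (e : ℕ) := by
  have h : ((eta p ^ (e : ℕ) : GL (Fin 2) ℚ_[p]) : V p).det = (p : ℚ_[p]) ^ (e : ℕ) := by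
    rw [Units.val_pow_eq_pow_val, Matrix.det_pow, det_atkinLehner, coe_pUnit]
  have hu : (uni ((x : ℕ) : ℚ_[p]) : V p).det = 1 := by simp [Matrix.det_fin_two]
  rw [iwahoriRep, Units.val_mul, Matrix.det_mul, h]
  refine mul_eq_right₀ (pow_ne_zero _ prime_cast_ne_zero) |>.mpr ?_
  split_ifs with hn
  · rw [Units.val_mul, Matrix.det_mul, det_weyl, hu, one_mul]
  · rw [Units.val_mul, Matrix.det_mul, Units.val_mul, Matrix.det_mul, mul_right_comm,
      ← Matrix.det_mul, ← Units.val_mul, mul_inv_cancel, Units.val_mul, Matrix.det_mul, det_weyl, hu]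
    simp

lemma eta_pow_conj_mem (e : Fin 2) {k : GL (Fin 2) ℚ_[p]} :
    (eta p ^ (e : ℕ))⁻¹ * k * eta p ^ (e : ℕ) ∈ eichlerSubgroup p 1 ↔ k ∈ eichlerSubgroup p 1 := by
  rcases eq_zero_or_one e with h | h <;> rw [h]
  · simp
  · rw [pow_one]
    refine ⟨fun hk => ?_, eta_conj_mem⟩
    simpa [mul_assoc] using eta_conj_mem' hk

/-- A matrix of determinant of norm one whose bottom row dominates. -/
lemma exists_weyl_of_bottom {g : GL (Fin 2) ℚ_[p]} (hdet : ‖(g : V p).det‖ = 1)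
    (hg : (‖(g : V p) 0 0‖ ≤ ‖(g : V p) 1 1‖ ∧ ‖(g : V p) 0 1‖ ≤ ‖(g : V p) 1 1‖ ∧
        p * ‖(g : V p) 1 0‖ ≤ ‖(g : V p) 1 1‖) ∨
      (‖(g : V p) 0 0‖ ≤ ‖(g : V p) 1 0‖ ∧ ‖(g : V p) 1 1‖ ≤ ‖(g : V p) 1 0‖ ∧
        ‖(g : V p) 0 1‖ ≤ p * ‖(g : V p) 1 0‖)) :
    ∃ n x : ℕ, x < p ^ n ∧ (uni (x : ℚ_[p]) * weyl p n)⁻¹ * g ∈ eichlerSubgroup p 1 := by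
  have hp := prime_real_pos (p := p)
  have hu : ∀ x : ℚ_[p], (((uni x)⁻¹ : GL (Fin 2) ℚ_[p]) : V p) = !![1, -x; 0, 1] := fun x => by
    rw [inv_entries]; simp [Matrix.det_fin_two]
  have hdet' : ∀ (n : ℤ) (x : ℚ_[p]),
      ‖(((uni x * weyl p n)⁻¹ * g : GL (Fin 2) ℚ_[p]) : V p).det‖ = 1 := fun n x => by
    have h1 : ((uni x * weyl p n : GL (Fin 2) ℚ_[p]) : V p).det *
        (((uni x * weyl p n)⁻¹ * g : GL (Fin 2) ℚ_[p]) : V p).det = (g : V p).det := by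
      rw [← Matrix.det_mul, ← Units.val_mul, mul_inv_cancel_left]
    rw [Units.val_mul, Matrix.det_mul, det_weyl, coe_upper, Matrix.det_fin_two] at h1
    simp only [Units.val_one, Matrix.of_apply, Matrix.cons_val', Matrix.cons_val_zero,
      Matrix.cons_val_one, Matrix.cons_val_fin_one, mul_one, mul_zero, sub_zero, one_mul] at h1
    rw [h1, hdet]
  -- The dominant bottom entry has norm $p^k$. If it lies on the diagonal the Weyl element is
  -- diagonal, of length $2k$; otherwise it is antidiagonal, of length $2k+1$.
  rcases hg with ⟨h1, h2, h3⟩ | ⟨h1, h2, h3⟩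
  · have hd0 : (g : V p) 1 1 ≠ 0 := by
      intro h0
      rw [h0, norm_zero] at h1 h2
      rw [det_entries, norm_le_zero_iff.mp h1, norm_le_zero_iff.mp h2] at hdet
      simp at hdet
    obtain ⟨k, hk⟩ := exists_norm_eq_zpow hd0
    have hc : ‖(g : V p) 1 0‖ ≤ (p : ℝ) ^ (k - 1) := by
      rw [zpow_sub₀ hp.ne', zpow_one, le_div_iff₀' hp, ← hk]; exact h3
    have hk0 : 0 ≤ k := by
      have hall : ∀ i j, ‖(g : V p) i j‖ ≤ (p : ℝ) ^ k := by
        intro i j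
        have := hc.trans (zpow_le_zpow_right₀ one_lt_prime_real.le (show k - 1 ≤ k by omega))
        fin_cases i <;> fin_cases j <;> simp <;> first | assumption | (rw [← hk]; try assumption)
      have := norm_det_le hall
      rw [hdet, ← zpow_natCast, ← zpow_mul, ← zpow_zero (p : ℝ),
        zpow_le_zpow_iff_right₀ one_lt_prime_real] at this
      push_cast at this; omega
    obtain ⟨n, hn⟩ : ∃ n : ℕ, (n : ℤ) = 2 * k := ⟨(2 * k).toNat, by omega⟩
    have hratio : ‖(g : V p) 0 1 / (g : V p) 1 1‖ ≤ 1 := by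
      rw [norm_div]; exact div_le_one_of_le₀ h2 (norm_nonneg _)
    obtain ⟨x, hx, hx'⟩ := exists_nat_approx hratio n
    refine ⟨n, x, hx, ?_⟩
    have hM := hdet' n x
    set M := (uni (x : ℚ_[p]) * weyl p n)⁻¹ * g with hMdef
    have hMe : (M : V p) = !![(p : ℚ_[p]) ^ (-k) * ((g : V p) 0 0 - x * (g : V p) 1 0),
        (p : ℚ_[p]) ^ (-k) * ((g : V p) 0 1 - x * (g : V p) 1 1);
        (p : ℚ_[p]) ^ k * (g : V p) 1 0, (p : ℚ_[p]) ^ k * (g : V p) 1 1] := by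
      rw [hMdef, mul_inv_rev, hn, Units.val_mul, Units.val_mul, coe_weyl_even_inv, hu,
        Matrix.eta_fin_two (g : V p), Matrix.mul_fin_two, Matrix.mul_fin_two]
      ext i j
      fin_cases i <;> fin_cases j <;> simp <;> ring
    have m11 : ‖(M : V p) 1 1‖ = 1 := by
      rw [hMe]; simp only [Matrix.of_apply, Matrix.cons_val', Matrix.cons_val_one,
        Matrix.cons_val_fin_one, norm_mul, Padic.norm_p_zpow, hk]
      rw [← zpow_add₀ hp.ne']; simp
    have m10 : ‖(M : V p) 1 0‖ ≤ (p : ℝ) ^ (-1 : ℤ) := by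
      rw [hMe]; simp only [Matrix.of_apply, Matrix.cons_val', Matrix.cons_val_one,
        Matrix.cons_val_fin_one, norm_mul, Padic.norm_p_zpow, Matrix.cons_val_zero]
      calc (p : ℝ) ^ (-k) * _ ≤ (p : ℝ) ^ (-k) * (p : ℝ) ^ (k - 1) := by gcongr
        _ = _ := by rw [← zpow_add₀ hp.ne']; congr 1; ring
    have m01 : ‖(M : V p) 0 1‖ ≤ 1 := by
      have e1 : (g : V p) 0 1 - x * (g : V p) 1 1 =
        ((g : V p) 0 1 / (g : V p) 1 1 - x) * (g : V p) 1 1 := by field_simp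
      rw [hMe]; simp only [Matrix.of_apply, Matrix.cons_val', Matrix.cons_val_one,
        Matrix.cons_val_fin_one, norm_mul, Padic.norm_p_zpow, Matrix.cons_val_zero, e1, hk]
      calc (p : ℝ) ^ (-(-k)) * (_ * (p : ℝ) ^ k) ≤
          (p : ℝ) ^ (-(-k)) * ((p : ℝ) ^ (-(n : ℤ)) * (p : ℝ) ^ k) := by gcongr
        _ = 1 := by rw [← zpow_add₀ hp.ne', ← zpow_add₀ hp.ne', hn]; simp; ring_nf; simp
    have m10' : ‖(M : V p) 1 0‖ ≤ 1 := m10.trans (by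
      rw [zpow_neg_one]; exact inv_le_one_of_one_le₀ one_lt_prime_real.le)
    -- The opposite diagonal entry is a unit, so the determinant equation bounds this last entry.
    have m00 : ‖(M : V p) 0 0‖ ≤ 1 := by
      have e1 : (M : V p) 0 0 * (M : V p) 1 1 = (M : V p).det + (M : V p) 0 1 * (M : V p) 1 0 := by
        rw [det_entries]; ring
      have e2 := congrArg norm e1
      rw [norm_mul, m11, mul_one] at e2
      rw [e2]
      exact padic_norm_add_le hM.le (padic_norm_mul_le_one m01 m10')
    rw [mem_eichlerSubgroup]
    refine ⟨⟨fun i j => ?_, by simpa using m10⟩, hM⟩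
    fin_cases i <;> fin_cases j
    exacts [m00, m01, m10', m11.le]
  · have hc0 : (g : V p) 1 0 ≠ 0 := by
      intro h0
      rw [h0, norm_zero] at h1 h2
      rw [det_entries, norm_le_zero_iff.mp h1, h0] at hdet
      simp at hdet
    obtain ⟨k, hk⟩ := exists_norm_eq_zpow hc0
    -- The weaker bound on the upper right entry gives only $1\le p^{2k+1}$, but that suffices
    -- because $k$ is an integer.
    have hk0 : 0 ≤ k := by
      have : ‖(g : V p).det‖ ≤ (p : ℝ) ^ (2 * k + 1) := by
        have e : (p : ℝ) ^ (2 * k + 1) = p * ((p : ℝ) ^ k * (p : ℝ) ^ k) := by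
          rw [zpow_add₀ hp.ne', two_mul, zpow_add₀ hp.ne', zpow_one]; ring
        rw [det_entries, e]
        rw [hk] at h1 h2 h3
        apply padic_norm_sub_le <;> rw [norm_mul]
        · calc _ ≤ (p : ℝ) ^ k * (p : ℝ) ^ k := by gcongr
            _ ≤ _ := le_mul_of_one_le_left (by positivity) one_lt_prime_real.le
        · rw [hk, ← mul_assoc]; gcongr
      rw [hdet, ← zpow_zero (p : ℝ), zpow_le_zpow_iff_right₀ one_lt_prime_real] at this
      omega
    obtain ⟨n, hn⟩ : ∃ n : ℕ, (n : ℤ) = 2 * k + 1 := ⟨(2 * k + 1).toNat, by omega⟩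
    have hratio : ‖(g : V p) 0 0 / (g : V p) 1 0‖ ≤ 1 := by
      rw [norm_div]; exact div_le_one_of_le₀ h1 (norm_nonneg _)
    obtain ⟨x, hx, hx'⟩ := exists_nat_approx hratio n
    refine ⟨n, x, hx, ?_⟩
    have hM := hdet' n x
    set M := (uni (x : ℚ_[p]) * weyl p n)⁻¹ * g with hMdef
    have hMe : (M : V p) = !![-(p : ℚ_[p]) ^ k * (g : V p) 1 0, -(p : ℚ_[p]) ^ k * (g : V p) 1 1;
        (p : ℚ_[p]) ^ (-k) * ((g : V p) 0 0 - x * (g : V p) 1 0),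
        (p : ℚ_[p]) ^ (-k) * ((g : V p) 0 1 - x * (g : V p) 1 1)] := by
      rw [hMdef, mul_inv_rev, hn, Units.val_mul, Units.val_mul, coe_weyl_odd_inv, hu,
        Matrix.eta_fin_two (g : V p), Matrix.mul_fin_two, Matrix.mul_fin_two]
      ext i j
      fin_cases i <;> fin_cases j <;> simp <;> ring
    have m00 : ‖(M : V p) 0 0‖ = 1 := by
      rw [hMe]; simp only [Matrix.of_apply, Matrix.cons_val', Matrix.cons_val_zero,
        Matrix.cons_val_fin_one, norm_mul, norm_neg, Padic.norm_p_zpow, hk]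
      rw [← zpow_add₀ hp.ne']; simp
    have m01 : ‖(M : V p) 0 1‖ ≤ 1 := by
      rw [hk] at h2
      rw [hMe]; simp only [Matrix.of_apply, Matrix.cons_val', Matrix.cons_val_one,
        Matrix.cons_val_fin_one, norm_mul, norm_neg, Padic.norm_p_zpow, Matrix.cons_val_zero]
      calc (p : ℝ) ^ (-k) * _ ≤ (p : ℝ) ^ (-k) * (p : ℝ) ^ k := by gcongr
        _ = _ := by rw [← zpow_add₀ hp.ne']; simp
    have m10 : ‖(M : V p) 1 0‖ ≤ (p : ℝ) ^ (-1 : ℤ) := by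
      have e1 : (g : V p) 0 0 - x * (g : V p) 1 0 =
        ((g : V p) 0 0 / (g : V p) 1 0 - x) * (g : V p) 1 0 := by field_simp
      rw [hMe]; simp only [Matrix.of_apply, Matrix.cons_val', Matrix.cons_val_one,
        Matrix.cons_val_fin_one, norm_mul, Padic.norm_p_zpow, Matrix.cons_val_zero, e1, hk]
      calc (p : ℝ) ^ (-(-k)) * (_ * (p : ℝ) ^ k) ≤
          (p : ℝ) ^ (-(-k)) * ((p : ℝ) ^ (-(n : ℤ)) * (p : ℝ) ^ k) := by gcongr
        _ = _ := by rw [← zpow_add₀ hp.ne', ← zpow_add₀ hp.ne', hn]; congr 1; ring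
    have m10' : ‖(M : V p) 1 0‖ ≤ 1 := m10.trans (by
      rw [zpow_neg_one]; exact inv_le_one_of_one_le₀ one_lt_prime_real.le)
    have m11 : ‖(M : V p) 1 1‖ ≤ 1 := by
      have e1 : (M : V p) 0 0 * (M : V p) 1 1 = (M : V p).det + (M : V p) 0 1 * (M : V p) 1 0 := by
        rw [det_entries]; ring
      have e2 := congrArg norm e1
      rw [norm_mul, m00, one_mul] at e2
      rw [e2]
      exact padic_norm_add_le hM.le (padic_norm_mul_le_one m01 m10')
    rw [mem_eichlerSubgroup]
    refine ⟨⟨fun i j => ?_, by simpa using m10⟩, hM⟩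
    fin_cases i <;> fin_cases j
    exacts [m00.le, m01, m10', m11]

lemma exists_iwahoriRep (e : Fin 2) {g : GL (Fin 2) ℚ_[p]}
    (hg : ‖(g : V p).det‖ = (p : ℝ) ^ (-((e : ℕ) : ℤ))) :
    ∃ i : Σ n : ℤ, Fin (p ^ n.natAbs), (iwahoriRep p e i.1 i.2)⁻¹ * g ∈ eichlerSubgroup p 1 := by
  have hp := prime_real_pos (p := p)
  obtain ⟨g, rfl⟩ : ∃ g', g = g' * eta p ^ (e : ℕ) := ⟨_, (inv_mul_cancel_right g _).symm⟩
  have hg' : ‖(g : V p).det‖ = 1 := by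
    rw [Units.val_mul, Matrix.det_mul, norm_mul, Units.val_pow_eq_pow_val, Matrix.det_pow,
      det_atkinLehner, norm_pow, coe_pUnit, Padic.norm_p, zpow_neg, zpow_natCast, inv_pow] at hg
    exact (mul_eq_right₀ (by positivity)).mp hg
  have hred : ∀ (n : ℤ) (x : Fin (p ^ n.natAbs)), (if 0 ≤ n then uni ((x : ℕ) : ℚ_[p]) * weyl p n
      else eta p * (uni ((x : ℕ) : ℚ_[p]) * weyl p (-n)) * (eta p)⁻¹)⁻¹ * g ∈ eichlerSubgroup p 1 →
      ∃ i : Σ n : ℤ, Fin (p ^ n.natAbs),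
        (iwahoriRep p e i.1 i.2)⁻¹ * (g * eta p ^ (e : ℕ)) ∈ eichlerSubgroup p 1 := by
    intro n x h
    refine ⟨⟨n, x⟩, ?_⟩
    rw [iwahoriRep, mul_inv_rev, mul_assoc, ← mul_assoc _ g, ← mul_assoc]
    exact (eta_pow_conj_mem e).mpr h
  by_cases hA : (‖(g : V p) 0 0‖ ≤ ‖(g : V p) 1 1‖ ∧ ‖(g : V p) 0 1‖ ≤ ‖(g : V p) 1 1‖ ∧
        p * ‖(g : V p) 1 0‖ ≤ ‖(g : V p) 1 1‖) ∨
      (‖(g : V p) 0 0‖ ≤ ‖(g : V p) 1 0‖ ∧ ‖(g : V p) 1 1‖ ≤ ‖(g : V p) 1 0‖ ∧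
        ‖(g : V p) 0 1‖ ≤ p * ‖(g : V p) 1 0‖)
  · obtain ⟨n, x, hx, h⟩ := exists_weyl_of_bottom hg' hA
    refine hred n ⟨x, by simpa using hx⟩ ?_
    rw [if_pos (Int.natCast_nonneg n)]
    exact h
  -- If neither alternative holds for $g$, one of them holds for $\eta^{-1}g\eta$, and the resulting
  -- coset has negative length. The verification compares entry norms, using that a strict
  -- inequality costs a factor $p$.
  · obtain ⟨n, x, hx, h⟩ := exists_weyl_of_bottom (g := (eta p)⁻¹ * g * eta p) (by
      rw [Units.val_mul, Units.val_mul, Matrix.det_mul, Matrix.det_mul, mul_right_comm,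
        ← Matrix.det_mul, ← Units.val_mul]
      simpa using hg') (by
      have a1 : p * ‖(g : V p) 1 0‖ ≤ ‖(g : V p) 1 1‖ ∨ ‖(g : V p) 1 1‖ ≤ ‖(g : V p) 1 0‖ :=
        (lt_or_ge _ _).imp_left prime_mul_norm_le_of_lt
      have a2 : p * ‖(g : V p) 0 0‖ ≤ ‖(g : V p) 0 1‖ ∨ ‖(g : V p) 0 1‖ ≤ ‖(g : V p) 0 0‖ :=
        (lt_or_ge _ _).imp_left prime_mul_norm_le_of_lt
      have a3 : p * ‖(g : V p) 1 0‖ ≤ ‖(g : V p) 0 0‖ ∨ ‖(g : V p) 0 0‖ ≤ ‖(g : V p) 1 0‖ :=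
        (lt_or_ge _ _).imp_left prime_mul_norm_le_of_lt
      have a4 : p * ‖(g : V p) 1 1‖ ≤ ‖(g : V p) 0 1‖ ∨ ‖(g : V p) 0 1‖ ≤ ‖(g : V p) 1 1‖ :=
        (lt_or_ge _ _).imp_left prime_mul_norm_le_of_lt
      have a5 : ‖(g : V p) 0 0‖ ≤ ‖(g : V p) 1 1‖ ∨ ‖(g : V p) 1 1‖ ≤ ‖(g : V p) 0 0‖ :=
        le_total _ _
      have a6 : ‖(g : V p) 0 1‖ ≤ p * ‖(g : V p) 1 0‖ ∨ p * ‖(g : V p) 1 0‖ ≤ ‖(g : V p) 0 1‖ :=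
        le_total _ _
      have hp1 : ∀ r : ℝ, 0 ≤ r → r ≤ p * r := fun r hr =>
        le_mul_of_one_le_left hr one_lt_prime_real.le
      have b1 := hp1 _ (norm_nonneg ((g : V p) 0 0))
      have b2 := hp1 _ (norm_nonneg ((g : V p) 1 1))
      have b3 := hp1 _ (norm_nonneg ((g : V p) 1 0))
      rw [coe_eta_conj]
      simp only [Matrix.of_apply, Matrix.cons_val', Matrix.cons_val_zero, Matrix.cons_val_one,
        Matrix.cons_val_fin_one, norm_mul, norm_neg, norm_inv, Padic.norm_p, inv_inv,
        mul_inv_cancel_left₀ hp.ne', le_inv_mul_iff₀ hp]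
      by_contra hB
      push Not at hA hB
      obtain ⟨hA1, hA2⟩ := hA
      obtain ⟨hB1, hB2⟩ := hB
      rcases a5 with c | c <;> rcases a6 with d | d <;> rcases a1 with e1 | e1 <;>
        rcases a2 with e2 | e2 <;> rcases a3 with e3 | e3 <;> rcases a4 with e4 | e4 <;>
        first
        | (have := hA1 (by linarith) (by linarith); linarith)
        | (have := hA2 (by linarith) (by linarith); linarith)
        | (have := hB1 (by linarith) (by linarith); linarith)
        | (have := hB2 (by linarith) (by linarith); linarith))
    -- Length 0 belongs to the nonnegative family: there the conjugated representative is the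
    -- identity, so it serves $g$ itself.
    rcases Nat.eq_zero_or_pos n with rfl | hn
    · refine hred 0 ⟨0, by simp⟩ ?_
      obtain rfl : x = 0 := by simpa using hx
      rw [if_pos le_rfl]
      have hu : uni ((0 : ℕ) : ℚ_[p]) * weyl p ((0 : ℕ) : ℤ) = 1 := by
        rw [Nat.cast_zero, Nat.cast_zero, weyl_zero, mul_one]
        apply Units.ext
        ext i j; fin_cases i <;> fin_cases j <;> simp
      rw [hu, inv_one, one_mul] at h
      have hu' : (uni ((0 : ℕ) : ℚ_[p]) * weyl p 0)⁻¹ * g = g := by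
        rw [show weyl p 0 = weyl p ((0 : ℕ) : ℤ) from rfl, hu, inv_one, one_mul]
      refine (congrArg (· ∈ eichlerSubgroup p 1) hu').mpr ?_
      simpa [mul_assoc] using eta_conj_mem' h
    · refine hred (-n) ⟨x, by simpa using hx⟩ ?_
      rw [if_neg (by omega), neg_neg]
      have := eta_conj_mem' h
      rw [mul_inv_rev, mul_inv_rev, inv_inv]
      convert this using 1
      group

/-- The double coset recovers $n$. For equal $n$ the quotient of two representatives is, after
removing $\eta$, a unipotent conjugated by `weyl`, and `weyl_conj_uni` recovers the residue. -/
lemma iwahoriRep_unique (e : Fin 2) (i j : Σ n : ℤ, Fin (p ^ n.natAbs))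
    (h : (iwahoriRep p e i.1 i.2)⁻¹ * iwahoriRep p e j.1 j.2 ∈ eichlerSubgroup p 1) : i = j := by
  obtain ⟨n, x⟩ := i
  obtain ⟨m, y⟩ := j
  have hnm : n = m := by
    obtain ⟨u, hu, hu'⟩ := iwahoriRep_eq e n x
    obtain ⟨v, hv, hv'⟩ := iwahoriRep_eq e m y
    refine weyl_double_coset (mul_mem (inv_mem hu) hv) ((eta_pow_conj_mem e).mp ?_)
    rw [hu', hv'] at h
    convert h using 1
    group
  subst hnm
  congr 1
  have key : ∀ N : ℕ, N = n.natAbs → (weyl p N)⁻¹ * uni (((y : ℕ) : ℚ_[p]) - ((x : ℕ) : ℚ_[p])) * weyl p N ∈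
      eichlerSubgroup p 1 → x = y := fun N hN hmem =>
    Fin.ext (nat_eq_of_norm_sub_le y.2 x.2
      ((weyl_conj_uni hmem).trans_eq (by rw [hN]))).symm
  have huni : uni (((y : ℕ) : ℚ_[p]) - ((x : ℕ) : ℚ_[p])) = (uni ((x : ℕ) : ℚ_[p]))⁻¹ * uni ((y : ℕ) : ℚ_[p]) := by
    rw [eq_inv_mul_iff_mul_eq]
    apply Units.ext
    simp
  refine key n.natAbs rfl ?_
  rw [huni]
  by_cases hn : 0 ≤ n
  · rw [show ((n.natAbs : ℕ) : ℤ) = n by omega]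
    refine (eta_pow_conj_mem e).mp ?_
    rw [iwahoriRep, iwahoriRep, if_pos hn, if_pos hn] at h
    convert h using 1
    group
  · rw [show ((n.natAbs : ℕ) : ℤ) = -n by omega]
    rw [iwahoriRep, iwahoriRep, if_neg hn, if_neg hn] at h
    have h2 := eta_conj_mem ((eta_pow_conj_mem e (k := eta p * ((weyl p (-n))⁻¹ *
      ((uni ((x : ℕ) : ℚ_[p]))⁻¹ * uni ((y : ℕ) : ℚ_[p])) * weyl p (-n)) * (eta p)⁻¹)).mp (by
        convert h using 1
        group))
    convert h2 using 1
    group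

/-! ### Integration over a group by cosets of an open compact subgroup -/

/-- The space is the countable disjoint union of the open cosets $r_iU$. Each has the volume of $U$
by left invariance, and the function is constant on it. -/
lemma integral_of_cosets {Γ ι : Type*} [Group Γ] [TopologicalSpace Γ] [IsTopologicalGroup Γ]
    [MeasurableSpace Γ] [BorelSpace Γ] (μ : Measure Γ) [μ.IsHaarMeasure] [Countable ι]
    (U : Subgroup Γ) (hUo : IsOpen (U : Set Γ)) (hUc : IsCompact (U : Set Γ)) (r : ι → Γ)
    (hex : ∀ h, ∃ i, (r i)⁻¹ * h ∈ U) (huniq : ∀ i j, (r i)⁻¹ * r j ∈ U → i = j)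
    (F : Γ → ℂ) (hF : ∀ h, ∀ u ∈ U, F (h * u) = F h) (hs : Summable fun i => ‖F (r i)‖) :
    Integrable F μ ∧ HasSum (fun i => (μ.real U : ℂ) * F (r i)) (∫ h, F h ∂μ) := by
  set s : ι → Set Γ := fun i => (fun h => (r i)⁻¹ * h) ⁻¹' U with hsdef
  have hso : ∀ i, IsOpen (s i) := fun i => hUo.preimage (by fun_prop)
  have hsm : ∀ i, MeasurableSet (s i) := fun i => (hso i).measurableSet
  have hμ : ∀ i, μ (s i) = μ U := fun i => measure_preimage_mul μ _ _
  have hfin : μ U ≠ ⊤ := hUc.measure_lt_top.ne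
  have hdisj : Pairwise (Function.onFun Disjoint s) := by
    intro i j hij
    refine Set.disjoint_left.mpr fun h hi hj => hij (huniq i j ?_)
    have := U.mul_mem hi (U.inv_mem hj)
    simpa [mul_assoc] using this
  have huniv : (⋃ i, s i) = Set.univ := Set.eq_univ_of_forall fun h =>
    Set.mem_iUnion.mpr (hex h)
  have hconst : ∀ i, ∀ h ∈ s i, F h = F (r i) := fun i h hh => by
    have := hF (r i) _ hh
    rwa [mul_inv_cancel_left] at this
  have hint : ∀ i, IntegrableOn F (s i) μ := fun i =>
    (integrableOn_const (C := F (r i)) (by rw [hμ]; exact hfin)).congr_fun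
      (fun h hh => (hconst i h hh).symm) (hsm i)
  have hInt : IntegrableOn F (⋃ i, s i) μ := by
    refine integrableOn_iUnion_of_summable_integral_norm hint ?_
    have : ∀ i, ∫ h in s i, ‖F h‖ ∂μ = μ.real U * ‖F (r i)‖ := fun i => by
      rw [setIntegral_congr_fun (hsm i) (g := fun _ => ‖F (r i)‖)
        (fun h hh => by simp only; rw [hconst i h hh]), setIntegral_const, measureReal_def, hμ]
      rfl
    simp_rw [this]
    exact hs.mul_left _
  refine ⟨by rwa [huniv, integrableOn_univ] at hInt, ?_⟩
  have := hasSum_integral_iUnion hsm hdisj hInt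
  rw [huniv, Measure.restrict_univ] at this
  have he : ∀ i, ∫ h in s i, F h ∂μ = (μ.real U : ℂ) * F (r i) := fun i => by
    rw [setIntegral_congr_fun (hsm i) (g := fun _ => F (r i)) (fun h hh => hconst i h hh),
      setIntegral_const, measureReal_def, hμ]
    simp [measureReal_def]
  simpa only [he] using this

/-! ### The group `H⁰₁` -/

/-- The element of `H⁰₁` given by two matrices with the same determinant. -/
def mkH01 (a d : GL (Fin 2) ℚ_[p]) (h : (a : V p).det = (d : V p).det) : H01 p :=
  ⟨QuotientGroup.mk (a, d), by
    change Matrix.GeneralLinearGroup.det a / Matrix.GeneralLinearGroup.det d = 1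
    rw [div_eq_one]
    exact Units.ext h⟩

lemma exists_mkH01 (h : H01 p) : ∃ a d : GL (Fin 2) ℚ_[p], ∃ had : (a : V p).det = (d : V p).det, h = mkH01 a d had := by
  obtain ⟨h, hh⟩ := h
  obtain ⟨⟨a, d⟩, rfl⟩ := QuotientGroup.mk_surjective h
  have hh' : Matrix.GeneralLinearGroup.det a / Matrix.GeneralLinearGroup.det d = 1 := hh
  rw [div_eq_one] at hh'
  exact ⟨a, d, congrArg Units.val hh', rfl⟩

lemma mkH01_eq_iff {a d a' d' : GL (Fin 2) ℚ_[p]} {h : (a : V p).det = (d : V p).det}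
    {h' : (a' : V p).det = (d' : V p).det} : mkH01 a d h = mkH01 a' d' h' ↔
    ∃ z : ℚ_[p]ˣ, a' = a * Matrix.GeneralLinearGroup.scalar (Fin 2) z ∧
      d' = d * Matrix.GeneralLinearGroup.scalar (Fin 2) z := by
  rw [Subtype.ext_iff]
  change (QuotientGroup.mk (a, d) : H0 p) = QuotientGroup.mk (a', d') ↔ _
  rw [QuotientGroup.eq]
  constructor
  · rintro ⟨z, hz⟩
    refine ⟨z, ?_, ?_⟩
    · exact (mul_inv_cancel_left a a').symm.trans (congrArg (a * ·) (congrArg Prod.fst hz).symm)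
    · exact (mul_inv_cancel_left d d').symm.trans (congrArg (d * ·) (congrArg Prod.snd hz).symm)
  · rintro ⟨z, rfl, rfl⟩
    exact ⟨z, Prod.ext (inv_mul_cancel_left _ _).symm (inv_mul_cancel_left _ _).symm⟩

/-- `𝒰_p` as a subgroup. -/
def calUSubgroup (p : ℕ) [Fact p.Prime] (c : ℕ) : Subgroup (H01 p) :=
  (((eichlerSubgroup p c).prod (eichlerSubgroup p c)).map (QuotientGroup.mk' (center2 p))).comap
    (nu p).ker.subtype

lemma coe_calUSubgroup (c : ℕ) : (calUSubgroup p c : Set (H01 p)) = calU p c := by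
  ext h
  constructor
  · rintro ⟨⟨r, s⟩, ⟨hr, hs⟩, h'⟩
    exact ⟨r, s, hr, hs, h'.symm⟩
  · rintro ⟨r, s, hr, hs, h'⟩
    exact ⟨⟨r, s⟩, ⟨hr, hs⟩, h'.symm⟩

lemma mkH01_inv_mul {a d a' d' : GL (Fin 2) ℚ_[p]} (h : (a : V p).det = (d : V p).det)
    (h' : (a' : V p).det = (d' : V p).det) (h'' : ((a⁻¹ * a' : GL (Fin 2) ℚ_[p]) : V p).det =
      ((d⁻¹ * d' : GL (Fin 2) ℚ_[p]) : V p).det) :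
    (mkH01 a d h)⁻¹ * mkH01 a' d' h' = mkH01 (a⁻¹ * a') (d⁻¹ * d') h'' := rfl

lemma det_inv_mul {a d a' d' : GL (Fin 2) ℚ_[p]} (h : (a : V p).det = (d : V p).det)
    (h' : (a' : V p).det = (d' : V p).det) : ((a⁻¹ * a' : GL (Fin 2) ℚ_[p]) : V p).det =
      ((d⁻¹ * d' : GL (Fin 2) ℚ_[p]) : V p).det := by
  have h1 := Matrix.det_mul (a : V p) ((a⁻¹ * a' : GL (Fin 2) ℚ_[p]) : V p)
  have h2 := Matrix.det_mul (d : V p) ((d⁻¹ * d' : GL (Fin 2) ℚ_[p]) : V p)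
  rw [← Units.val_mul, mul_inv_cancel_left] at h1 h2
  rw [h1, h2, h] at h'
  exact mul_left_cancel₀ d.det_ne_zero h'

lemma mkH01_mem_calU {c : ℕ} {a d : GL (Fin 2) ℚ_[p]} {h : (a : V p).det = (d : V p).det} :
    mkH01 a d h ∈ calUSubgroup p c ↔ ∃ z : ℚ_[p]ˣ,
      a * Matrix.GeneralLinearGroup.scalar (Fin 2) z ∈ eichlerSubgroup p c ∧
      d * Matrix.GeneralLinearGroup.scalar (Fin 2) z ∈ eichlerSubgroup p c := by
  constructor
  · rintro ⟨⟨r, s⟩, ⟨hr, hs⟩, h'⟩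
    obtain ⟨z, hz⟩ := QuotientGroup.eq.mp h'
    refine ⟨z⁻¹, ?_, ?_⟩
    · have e : Matrix.GeneralLinearGroup.scalar (Fin 2) z = r⁻¹ * a := congrArg Prod.fst hz
      rw [map_inv, e]
      simpa using hr
    · have e : Matrix.GeneralLinearGroup.scalar (Fin 2) z = s⁻¹ * d := congrArg Prod.snd hz
      rw [map_inv, e]
      simpa using hs
  · rintro ⟨z, h1, h2⟩
    refine ⟨⟨_, _⟩, ⟨h1, h2⟩, ?_⟩
    refine QuotientGroup.eq.mpr ⟨z⁻¹, Prod.ext ?_ ?_⟩ <;>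
    · change Matrix.GeneralLinearGroup.scalar (Fin 2) z⁻¹ = (_)⁻¹ * _
      rw [map_inv, mul_inv_rev, inv_mul_cancel_right]

lemma norm_det_mul_scalar (a : GL (Fin 2) ℚ_[p]) (z : ℚ_[p]ˣ) :
    ‖((a * Matrix.GeneralLinearGroup.scalar (Fin 2) z : GL (Fin 2) ℚ_[p]) : V p).det‖ =
      ‖(a : V p).det‖ * ‖(z : ℚ_[p])‖ ^ 2 := by
  rw [Units.val_mul, Matrix.det_mul, coe_scalar_eq, norm_mul]
  simp [Matrix.det_fin_two, sq]

lemma scalar_mem_of_norm {z : ℚ_[p]ˣ} (hz : ‖(z : ℚ_[p])‖ = 1) (c : ℕ) :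
    Matrix.GeneralLinearGroup.scalar (Fin 2) z ∈ eichlerSubgroup p c := by
  rw [mem_eichlerSubgroup, coe_scalar_eq]
  refine ⟨⟨fun i j => ?_, by simp⟩, by simp [Matrix.det_fin_two, hz]⟩
  fin_cases i <;> fin_cases j <;> simp [hz]

/-! ### Representatives -/

/-- Families of representatives of the cosets of an Eichler unit group among the matrices with
determinant of valuation zero or one. -/
structure CosetReps (p : ℕ) [Fact p.Prime] (c : ℕ) (A : Type) where
  Fam : Fin 2 → A → Type
  fintype : ∀ e n, Fintype (Fam e n)
  rep : ∀ e n, Fam e n → GL (Fin 2) ℚ_[p]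
  det_rep : ∀ e n x, (rep e n x : V p).det = (p : ℚ_[p]) ^ (e : ℕ)
  exists_rep : ∀ (e : Fin 2) (g : GL (Fin 2) ℚ_[p]),
    ‖(g : V p).det‖ = (p : ℝ) ^ (-((e : ℕ) : ℤ)) →
    ∃ i : Σ n, Fam e n, (rep e i.1 i.2)⁻¹ * g ∈ eichlerSubgroup p c
  unique_rep : ∀ (e : Fin 2) (i j : Σ n, Fam e n),
    (rep e i.1 i.2)⁻¹ * rep e j.1 j.2 ∈ eichlerSubgroup p c → i = j

attribute [instance] CosetReps.fintype

/-- Representatives of the cosets of the maximal compact subgroup. -/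
def sphericalReps (p : ℕ) [Fact p.Prime] : CosetReps p 0 ℕ where
  Fam e n := Fin (p ^ (2 * n + (e : ℕ))) ⊕ Fin (secondCard p (2 * n + (e : ℕ)))
  fintype _ _ := inferInstance
  rep e n x := sphericalRep p e n x
  det_rep := sphericalRep_det
  exists_rep e _ hg := exists_sphericalRep e hg
  unique_rep := sphericalRep_unique

/-- Representatives of the cosets of the Iwahori subgroup. -/
def iwahoriReps (p : ℕ) [Fact p.Prime] : CosetReps p 1 ℤ where
  Fam _ n := Fin (p ^ n.natAbs)
  fintype _ _ := inferInstance
  rep e n x := iwahoriRep p e n x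
  det_rep := iwahoriRep_det
  exists_rep e _ hg := exists_iwahoriRep e hg
  unique_rep := iwahoriRep_unique

namespace CosetReps

variable {c : ℕ} {A : Type} (R : CosetReps p c A)

/-- The representatives of the cosets of `𝒰_p` in `H⁰₁`. -/
def pairRep (q : Fin 2 × A × A) (x : R.Fam q.1 q.2.1 × R.Fam q.1 q.2.2) : H01 p :=
  mkH01 (R.rep q.1 q.2.1 x.1) (R.rep q.1 q.2.2 x.2) ((R.det_rep _ _ _).trans (R.det_rep _ _ _).symm)

/-- A common scalar $p^s$ changes both determinants by $p^{2s}$, so it brings their valuation to 0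
or 1. Then the two components are decomposed independently. -/
lemma exists_pairRep (h : H01 p) :
    ∃ i : Σ q : Fin 2 × A × A, R.Fam q.1 q.2.1 × R.Fam q.1 q.2.2,
      (R.pairRep i.1 i.2)⁻¹ * h ∈ calUSubgroup p c := by
  have hp := prime_real_pos (p := p)
  obtain ⟨a, d, had, rfl⟩ := exists_mkH01 h
  obtain ⟨δ, hδ⟩ := exists_norm_eq_zpow a.det_ne_zero
  obtain ⟨e, s, hs⟩ : ∃ (e : Fin 2) (s : ℤ), δ - 2 * s = -((e : ℕ) : ℤ) := by
    obtain ⟨k, hk | hk⟩ := Int.even_or_odd' δ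
    · exact ⟨0, k, by simp [hk]⟩
    · exact ⟨1, k + 1, by rw [hk]; simp; ring⟩
  set Z := Matrix.GeneralLinearGroup.scalar (Fin 2) (pUnit p ^ s) with hZ
  have hZn : ‖((pUnit p ^ s : ℚ_[p]ˣ) : ℚ_[p])‖ ^ 2 = (p : ℝ) ^ (-(2 * s)) := by
    rw [Units.val_zpow_eq_zpow_val, coe_pUnit, Padic.norm_p_zpow, ← zpow_natCast, ← zpow_mul]
    congr 1; push_cast; ring
  have hae : ‖((a * Z : GL (Fin 2) ℚ_[p]) : V p).det‖ = (p : ℝ) ^ (-((e : ℕ) : ℤ)) := by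
    rw [norm_det_mul_scalar, hZn, hδ, ← zpow_add₀ hp.ne', ← hs]; rfl
  have hde : ‖((d * Z : GL (Fin 2) ℚ_[p]) : V p).det‖ = (p : ℝ) ^ (-((e : ℕ) : ℤ)) := by
    rw [norm_det_mul_scalar, ← had, hZn, hδ, ← zpow_add₀ hp.ne', ← hs]; rfl
  obtain ⟨i, hi⟩ := R.exists_rep e _ hae
  obtain ⟨j, hj⟩ := R.exists_rep e _ hde
  refine ⟨⟨(e, i.1, j.1), (i.2, j.2)⟩, ?_⟩
  rw [pairRep, mkH01_inv_mul _ _ (det_inv_mul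
    ((R.det_rep _ _ _).trans (R.det_rep _ _ _).symm) had), mkH01_mem_calU]
  exact ⟨pUnit p ^ s, by rwa [mul_assoc], by rwa [mul_assoc]⟩

/-- The scalar relating two representatives changes the determinant norm by an even power of $p$. As
the valuations are 0 or 1, they agree and the scalar is a unit, which the Eichler unit group
absorbs. -/
lemma pairRep_unique (i j : Σ q : Fin 2 × A × A, R.Fam q.1 q.2.1 × R.Fam q.1 q.2.2)
    (h : (R.pairRep i.1 i.2)⁻¹ * R.pairRep j.1 j.2 ∈ calUSubgroup p c) : i = j := by
  have hp := prime_real_pos (p := p)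
  obtain ⟨⟨e, n, m⟩, ⟨x, y⟩⟩ := i
  obtain ⟨⟨e', n', m'⟩, ⟨x', y'⟩⟩ := j
  rw [pairRep, pairRep, mkH01_inv_mul _ _ (det_inv_mul
    ((R.det_rep _ _ _).trans (R.det_rep _ _ _).symm)
    ((R.det_rep _ _ _).trans (R.det_rep _ _ _).symm)), mkH01_mem_calU] at h
  obtain ⟨z, h1, h2⟩ := h
  simp only at h1 h2
  rw [mul_assoc] at h1 h2
  have hd := det_of_inv_mul_mem h1
  rw [norm_det_mul_scalar, R.det_rep, R.det_rep, norm_pow, norm_pow, Padic.norm_p] at hd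
  obtain ⟨k, hk⟩ := exists_norm_eq_zpow z.ne_zero
  have hek : (e : ℕ) = e' ∧ k = 0 := by
    rw [hk, inv_pow, inv_pow, ← zpow_natCast, ← zpow_natCast, ← zpow_natCast, ← zpow_neg, ← zpow_neg,
      ← zpow_mul, ← zpow_add₀ hp.ne'] at hd
    have := zpow_right_injective₀ hp one_lt_prime_real.ne' hd
    push_cast at this
    omega
  obtain ⟨he, rfl⟩ := hek
  obtain rfl : e = e' := Fin.ext he
  have hz := inv_mem (scalar_mem_of_norm (p := p) (by simpa using hk) c)
  have h1' := mul_mem h1 hz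
  have h2' := mul_mem h2 hz
  rw [← mul_assoc, mul_inv_cancel_right] at h1' h2'
  have e1 := R.unique_rep e ⟨n, x⟩ ⟨n', x'⟩ h1'
  have e2 := R.unique_rep e ⟨m, y⟩ ⟨m', y'⟩ h2'
  cases e1
  cases e2
  rfl

end CosetReps

/-! ### Topology -/

lemma continuous_entry (i j : Fin 2) : Continuous fun x : V p => x i j :=
  continuous_id.matrix_elem i j

lemma isClosed_eichler (c : ℕ) : IsClosed (eichler p c) := by
  have h1 : eichler p c = (⋂ i, ⋂ j, {x : V p | ‖x i j‖ ≤ 1}) ∩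
      {x : V p | ‖x 1 0‖ ≤ (p : ℝ) ^ (-(c : ℤ))} := by
    ext x; simp [eichler]
  rw [h1]
  refine (isClosed_iInter fun i => isClosed_iInter fun j => ?_).inter ?_
  · exact isClosed_le (continuous_entry i j).norm continuous_const
  · exact isClosed_le (continuous_entry 1 0).norm continuous_const

lemma isOpen_setOf_norm_le {n : ℤ} (i j : Fin 2) : IsOpen {x : V p | ‖x i j‖ ≤ (p : ℝ) ^ n} := by
  have : {x : V p | ‖x i j‖ ≤ (p : ℝ) ^ n} = {x : V p | ‖x i j‖ < (p : ℝ) ^ (n + 1)} := by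
    ext x; exact Padic.norm_le_pow_iff_norm_lt_pow_add_one _ _
  rw [this]
  exact isOpen_lt (continuous_entry i j).norm continuous_const

lemma isOpen_eichler (c : ℕ) : IsOpen (eichler p c) := by
  have h1 : eichler p c = (⋂ i, ⋂ j, {x : V p | ‖x i j‖ ≤ (p : ℝ) ^ (0 : ℤ)}) ∩
      {x : V p | ‖x 1 0‖ ≤ (p : ℝ) ^ (-(c : ℤ))} := by
    ext x; simp [eichler]
  rw [h1]
  exact (isOpen_iInter_of_finite fun i => isOpen_iInter_of_finite fun j =>
    isOpen_setOf_norm_le i j).inter (isOpen_setOf_norm_le 1 0)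

lemma isCompact_eichler (c : ℕ) : IsCompact (eichler p c) := by
  have h : IsCompact (Set.univ.pi fun _ : Fin 2 => Set.univ.pi fun _ : Fin 2 =>
      Metric.closedBall (0 : ℚ_[p]) 1) :=
    isCompact_univ_pi fun _ => isCompact_univ_pi fun _ => isCompact_closedBall _ _
  refine IsCompact.of_isClosed_subset (h : IsCompact (X := V p) _) (isClosed_eichler c) ?_
  intro x hx
  exact fun i _ j _ => mem_closedBall_zero_iff.mpr (hx.1 i j)

lemma isOpen_eichlerSubgroup (c : ℕ) : IsOpen (eichlerSubgroup p c : Set (GL (Fin 2) ℚ_[p])) :=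
  ((isOpen_eichler c).preimage Units.continuous_val).inter
    ((isOpen_eichler c).preimage (Units.continuous_val.comp continuous_inv))

lemma isCompact_eichlerSubgroup (c : ℕ) :
    IsCompact (eichlerSubgroup p c : Set (GL (Fin 2) ℚ_[p])) := by
  have h := Units.isClosedEmbedding_embedProduct (α := V p)
  have h2 : IsCompact ((eichler p c) ×ˢ (MulOpposite.op '' (eichler p c))) :=
    (isCompact_eichler c).prod ((isCompact_eichler c).image MulOpposite.continuous_op)
  convert h.isCompact_preimage h2 using 1
  ext k
  constructor
  · rintro ⟨h1, h2⟩
    exact ⟨h1, _, h2, rfl⟩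
  · rintro ⟨h1, y, hy, h2⟩
    exact ⟨h1, (MulOpposite.op_injective h2 : y = ((k⁻¹ : GL (Fin 2) ℚ_[p]) : V p)) ▸ hy⟩

lemma isOpen_calU (c : ℕ) : IsOpen (calUSubgroup p c : Set (H01 p)) := by
  have h : IsOpen ((QuotientGroup.mk : _ → H0 p) ''
      ((eichlerSubgroup p c : Set (GL (Fin 2) ℚ_[p])) ×ˢ
        (eichlerSubgroup p c : Set (GL (Fin 2) ℚ_[p])))) :=
    QuotientGroup.isOpenMap_coe _ ((isOpen_eichlerSubgroup c).prod (isOpen_eichlerSubgroup c))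
  exact h.preimage continuous_subtype_val

lemma continuous_nu : Continuous (nu p) := by
  refine continuous_quot_lift _ ?_
  have h : Continuous fun g : GL (Fin 2) ℚ_[p] => Matrix.GeneralLinearGroup.det g := by
    refine Units.continuous_iff.mpr ⟨?_, ?_⟩
    · exact (Continuous.matrix_det Units.continuous_val)
    · have : (fun g : GL (Fin 2) ℚ_[p] => ((Matrix.GeneralLinearGroup.det g)⁻¹ : ℚ_[p]ˣ).val) =
        fun g => ((g⁻¹ : GL (Fin 2) ℚ_[p]) : V p).det := by
        ext g; rw [← map_inv]; rfl
      rw [this]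
      exact (Units.continuous_val.comp continuous_inv).matrix_det
  exact (h.comp continuous_fst).div' (h.comp continuous_snd)

lemma isCompact_calU (c : ℕ) : IsCompact (calUSubgroup p c : Set (H01 p)) := by
  have hcl : IsClosed ((nu p).ker : Set (H0 p)) := isClosed_singleton.preimage continuous_nu
  have h : IsCompact ((QuotientGroup.mk : _ → H0 p) ''
      ((eichlerSubgroup p c : Set (GL (Fin 2) ℚ_[p])) ×ˢ
        (eichlerSubgroup p c : Set (GL (Fin 2) ℚ_[p])))) :=
    ((isCompact_eichlerSubgroup c).prod (isCompact_eichlerSubgroup c)).image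
      QuotientGroup.continuous_mk
  exact hcl.isClosedEmbedding_subtypeVal.isCompact_preimage h

/-- Cosets are grouped by the index `q`; each group is finite, so only the outer family raises a
question of convergence. -/
lemma CosetReps.integral_eq {c : ℕ} {A : Type} [Countable A] (R : CosetReps p c A)
    (dh : Measure (H01 p)) [dh.IsHaarMeasure] (F : H01 p → ℂ)
    (hF : ∀ h, ∀ u ∈ calUSubgroup p c, F (h * u) = F h)
    (hs : Summable fun q => ∑ x, ‖F (R.pairRep q x)‖) {S : ℂ}
    (hS : HasSum (fun q => ∑ x, F (R.pairRep q x)) S) :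
    Integrable F dh ∧ ∫ h, F h ∂dh = (dh.real (calU p c) : ℂ) * S := by
  have hsum : Summable fun i : Σ q : Fin 2 × A × A, R.Fam q.1 q.2.1 × R.Fam q.1 q.2.2 =>
      ‖F (R.pairRep i.1 i.2)‖ := by
    rw [summable_sigma_of_nonneg fun _ => norm_nonneg _]
    refine ⟨fun q => Summable.of_finite, ?_⟩
    simpa [tsum_fintype] using hs
  obtain ⟨h1, h2⟩ := integral_of_cosets dh (calUSubgroup p c) (isOpen_calU c) (isCompact_calU c)
    (fun i : Σ q : Fin 2 × A × A, R.Fam q.1 q.2.1 × R.Fam q.1 q.2.2 => R.pairRep i.1 i.2)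
    R.exists_pairRep R.pairRep_unique F hF hsum
  refine ⟨h1, ?_⟩
  rw [coe_calUSubgroup] at h2
  have h3 := h2.sigma fun q => hasSum_fintype _
  refine h3.unique ?_
  simp_rw [← Finset.mul_sum]
  exact hS.mul_left _

/-! ### Volumes of boxes in `𝐗_p` -/

instance : LocallyCompactSpace (V p) :=
  inferInstanceAs (LocallyCompactSpace (Fin 2 → Fin 2 → ℚ_[p]))

instance : SecondCountableTopology (V p) :=
  inferInstanceAs (SecondCountableTopology (Fin 2 → Fin 2 → ℚ_[p]))

/-- The lattice of matrices with `‖x i j‖ ≤ p ^ (- E i j)`. -/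
def box (p : ℕ) [Fact p.Prime] (E : Matrix (Fin 2) (Fin 2) ℤ) : Set (V p) :=
  {x | ∀ i j, ‖x i j‖ ≤ (p : ℝ) ^ (-E i j)}

lemma eichler_eq_box (c : ℕ) : eichler p c = box p !![0, 0; (c : ℤ), 0] := by
  ext x
  simp only [eichler, box, Set.mem_ofPred_eq, Fin.forall_fin_two]
  simp only [Matrix.of_apply, Matrix.cons_val', Matrix.cons_val_zero, Matrix.cons_val_one,
    Matrix.cons_val_fin_one, neg_zero, zpow_zero]
  constructor
  · rintro ⟨⟨h1, h2⟩, h3⟩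
    exact ⟨h1, h3, h2.2⟩
  · rintro ⟨h1, h3, h2⟩
    refine ⟨⟨h1, h3.trans ?_, h2⟩, h3⟩
    rw [zpow_neg, zpow_natCast]
    exact inv_le_one_of_one_le₀ (one_le_pow₀ one_lt_prime_real.le)

lemma isClosed_box (E : Matrix (Fin 2) (Fin 2) ℤ) : IsClosed (box p E) := by
  have : box p E = ⋂ i, ⋂ j, {x : V p | ‖x i j‖ ≤ (p : ℝ) ^ (-E i j)} := by ext x; simp [box]
  rw [this]
  exact isClosed_iInter fun i => isClosed_iInter fun j =>
    isClosed_le (continuous_entry i j).norm continuous_const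

lemma box_shift (E : Matrix (Fin 2) (Fin 2) ℤ) (i j : Fin 2) (x : V p) (hx : x ∈ box p E) :
    ∃ t : Fin p, x - Matrix.single i j ((p : ℚ_[p]) ^ E i j * ((t : ℕ) : ℚ_[p])) ∈
      box p (E + Matrix.single i j 1) := by
  have hp := prime_real_pos (p := p)
  have hr : ‖(p : ℚ_[p]) ^ (-E i j) * x i j‖ ≤ 1 := by
    rw [norm_mul, Padic.norm_p_zpow, neg_neg]
    calc _ ≤ (p : ℝ) ^ (E i j) * (p : ℝ) ^ (-E i j) := by gcongr; exact hx i j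
      _ = 1 := by rw [← zpow_add₀ hp.ne']; simp
  obtain ⟨t, ht, ht'⟩ := exists_nat_approx hr 1
  rw [pow_one] at ht
  refine ⟨⟨t, ht⟩, fun k l => ?_⟩
  by_cases hkl : i = k ∧ j = l
  · obtain ⟨rfl, rfl⟩ := hkl
    have e : (x - Matrix.single i j ((p : ℚ_[p]) ^ E i j * (t : ℚ_[p]))) i j =
        (p : ℚ_[p]) ^ E i j * ((p : ℚ_[p]) ^ (-E i j) * x i j - t) := by
      rw [mul_sub, ← mul_assoc, ← zpow_add₀ prime_cast_ne_zero]
      simp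
    rw [e, norm_mul, Padic.norm_p_zpow, Matrix.add_apply, Matrix.single_apply_same, neg_add,
      zpow_add₀ hp.ne']
    gcongr
    exact_mod_cast ht'
  · rw [Matrix.add_apply, Matrix.sub_apply, Matrix.single_apply_of_ne _ _ _ _ _ hkl,
      Matrix.single_apply_of_ne _ _ _ _ _ hkl, sub_zero, add_zero]
    exact hx k l

lemma box_add_single_subset (E : Matrix (Fin 2) (Fin 2) ℤ) (i j : Fin 2) :
    box p (E + Matrix.single i j 1) ⊆ box p E := by
  intro x hx k l
  refine (hx k l).trans (zpow_le_zpow_right₀ one_lt_prime_real.le ?_)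
  rw [Matrix.add_apply, Matrix.single_apply]
  split_ifs <;> omega

lemma add_mem_box {E : Matrix (Fin 2) (Fin 2) ℤ} {x y : V p} (hx : x ∈ box p E)
    (hy : y ∈ box p E) : x + y ∈ box p E := fun i j => padic_norm_add_le (hx i j) (hy i j)

lemma sub_mem_box {E : Matrix (Fin 2) (Fin 2) ℤ} {x y : V p} (hx : x ∈ box p E)
    (hy : y ∈ box p E) : x - y ∈ box p E := fun i j => padic_norm_sub_le (hx i j) (hy i j)

lemma single_mem_box (E : Matrix (Fin 2) (Fin 2) ℤ) (i j : Fin 2) (t : ℕ) :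
    Matrix.single i j ((p : ℚ_[p]) ^ E i j * (t : ℚ_[p])) ∈ box p E := by
  intro k l
  rw [Matrix.single_apply]
  split_ifs with h
  · obtain ⟨rfl, rfl⟩ := h
    rw [norm_mul, Padic.norm_p_zpow]
    exact mul_le_of_le_one_right (by have := prime_real_pos (p := p); positivity)
      (norm_natCast_le_one t)
  · rw [norm_zero]; have := prime_real_pos (p := p); positivity

lemma box_shift_unique (E : Matrix (Fin 2) (Fin 2) ℤ) (i j : Fin 2) {x : V p} {s t : Fin p}
    (hs : x - Matrix.single i j ((p : ℚ_[p]) ^ E i j * ((s : ℕ) : ℚ_[p])) ∈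
      box p (E + Matrix.single i j 1))
    (ht : x - Matrix.single i j ((p : ℚ_[p]) ^ E i j * ((t : ℕ) : ℚ_[p])) ∈
      box p (E + Matrix.single i j 1)) : s = t := by
  have hp := prime_real_pos (p := p)
  have h := sub_mem_box ht hs i j
  rw [sub_sub_sub_cancel_left, Matrix.sub_apply, Matrix.single_apply_same,
    Matrix.single_apply_same, ← mul_sub, norm_mul, Padic.norm_p_zpow, Matrix.add_apply,
    Matrix.single_apply_same, neg_add, zpow_add₀ hp.ne'] at h
  refine Fin.ext (nat_eq_of_norm_sub_le (N := 1) (by rw [pow_one]; exact s.2)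
    (by rw [pow_one]; exact t.2) (le_of_mul_le_mul_left ?_ (zpow_pos hp (-E i j))))
  exact_mod_cast h

/-- Sharpening one entry by a factor $p$ splits the box into $p$ translates in each of the two
copies of $V_p$, whence $p^2$. -/
lemma measure_box_step (dx : Measure (X p)) [dx.IsAddHaarMeasure]
    (E : Matrix (Fin 2) (Fin 2) ℤ) (i j : Fin 2) :
    dx.real (box p E ×ˢ box p E) = (p : ℝ) ^ 2 *
      dx.real (box p (E + Matrix.single i j 1) ×ˢ box p (E + Matrix.single i j 1)) := by
  set E' := E + Matrix.single i j 1
  set a : Fin p → V p := fun t => Matrix.single i j ((p : ℚ_[p]) ^ E i j * ((t : ℕ) : ℚ_[p]))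
  set S : Fin p × Fin p → Set (X p) := fun t =>
    (fun x => ((-a t.1, -a t.2) : X p) + x) ⁻¹' (box p E' ×ˢ box p E')
  have hS : ∀ t x, x ∈ S t ↔ x.1 - a t.1 ∈ box p E' ∧ x.2 - a t.2 ∈ box p E' := by
    intro t x
    simp only [S, Set.mem_preimage, Set.mem_prod, Prod.fst_add, Prod.snd_add, neg_add_eq_sub]
  have hU : box p E ×ˢ box p E = ⋃ t, S t := by
    ext x
    rw [Set.mem_iUnion]
    constructor
    · rintro ⟨h1, h2⟩
      obtain ⟨s, hs⟩ := box_shift E i j x.1 h1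
      obtain ⟨t, ht⟩ := box_shift E i j x.2 h2
      exact ⟨(s, t), (hS _ _).mpr ⟨hs, ht⟩⟩
    · rintro ⟨t, ht⟩
      obtain ⟨h1, h2⟩ := (hS _ _).mp ht
      have h1' := add_mem_box (box_add_single_subset E i j h1) (single_mem_box E i j t.1)
      have h2' := add_mem_box (box_add_single_subset E i j h2) (single_mem_box E i j t.2)
      rw [sub_add_cancel] at h1' h2'
      exact ⟨h1', h2'⟩
  have hd : Pairwise (Function.onFun Disjoint S) := by
    intro s t hst
    refine Set.disjoint_left.mpr fun x hs ht => hst ?_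
    rw [hS] at hs ht
    exact Prod.ext (box_shift_unique E i j hs.1 ht.1) (box_shift_unique E i j hs.2 ht.2)
  have hm : ∀ t, MeasurableSet (S t) := fun t =>
    (((isClosed_box E').prod (isClosed_box E')).preimage
      (by fun_prop : Continuous fun x : X p => ((-a t.1, -a t.2) : X p) + x)).measurableSet
  rw [measureReal_def, hU, measure_iUnion hd hm, tsum_fintype]
  have : ∀ t, dx (S t) = dx (box p E' ×ˢ box p E') := fun t => measure_preimage_add dx _ _
  simp_rw [this]
  rw [Finset.sum_const, Finset.card_univ, Fintype.card_prod, Fintype.card_fin, nsmul_eq_mul,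
    ENNReal.toReal_mul, measureReal_def]
  congr 1
  simp [sq]

lemma measure_box_shift (dx : Measure (X p)) [dx.IsAddHaarMeasure]
    (E : Matrix (Fin 2) (Fin 2) ℤ) (i j : Fin 2) (k : ℤ) :
    dx.real (box p (E + Matrix.single i j k) ×ˢ box p (E + Matrix.single i j k)) =
      (p : ℝ) ^ (-2 * k) * dx.real (box p E ×ˢ box p E) := by
  have hp := prime_real_pos (p := p)
  induction k using Int.induction_on with
  | zero => simp
  | succ n ih =>
    have h := measure_box_step dx (E + Matrix.single i j (n : ℤ)) i j
    rw [ih, add_assoc, ← Matrix.single_add] at h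
    rw [show -2 * ((n : ℤ) + 1) = -2 + -2 * n by ring, zpow_add₀ hp.ne', mul_assoc, h]
    rw [zpow_neg]
    field_simp
  | pred n ih =>
    have h := measure_box_step dx (E + Matrix.single i j (-(n : ℤ) - 1)) i j
    rw [add_assoc, ← Matrix.single_add, sub_add_cancel, ih] at h
    rw [h, show -2 * (-(n : ℤ) - 1) = 2 + -2 * -(n : ℤ) by ring, zpow_add₀ hp.ne', mul_assoc]
    rfl

lemma measure_box (dx : Measure (X p)) [dx.IsAddHaarMeasure] (a b c d : ℤ) :
    dx.real (box p !![a, b; c, d] ×ˢ box p !![a, b; c, d]) =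
      (p : ℝ) ^ (-2 * (a + b + c + d)) * dx.real (box p 0 ×ˢ box p 0) := by
  have hp := prime_real_pos (p := p)
  have : !![a, b; c, d] = 0 + Matrix.single 0 0 a + Matrix.single 0 1 b + Matrix.single 1 0 c +
      Matrix.single 1 1 d := by
    ext i j; fin_cases i <;> fin_cases j <;> simp
  rw [this, measure_box_shift, measure_box_shift, measure_box_shift, measure_box_shift,
    show -2 * (a + b + c + d) = -2 * d + (-2 * c + (-2 * b + -2 * a)) by ring, zpow_add₀ hp.ne',
    zpow_add₀ hp.ne', zpow_add₀ hp.ne']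
  ring

/-! ### The self-dual measure -/

lemma phiStar_eq_indicator (c : ℕ) :
    phiStar p c = Set.indicator (eichler p c ×ˢ eichler p c) 1 := by
  classical
  funext x
  by_cases h : x.1 ∈ eichler p c ∧ x.2 ∈ eichler p c
  · rw [phiStar, if_pos h, Set.indicator_of_mem (by exact h)]; rfl
  · rw [phiStar, if_neg h, Set.indicator_of_notMem (by exact h)]

lemma integral_indicator_one_complex {Y : Type*} [MeasurableSpace Y] (μ : Measure Y) {S : Set Y}
    (hS : MeasurableSet S) : ∫ x, S.indicator (1 : Y → ℂ) x ∂μ = (μ.real S : ℂ) := by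
  rw [integral_indicator hS]
  simp

lemma isClopen_eichler_prod (c : ℕ) : IsClopen (eichler p c ×ˢ eichler p c) :=
  ⟨(isClosed_eichler c).prod (isClosed_eichler c), (isOpen_eichler c).prod (isOpen_eichler c)⟩

lemma isBruhatSchwartz_phiStar (c : ℕ) : IsBruhatSchwartz (phiStar p c) := by
  rw [phiStar_eq_indicator]
  refine ⟨?_, HasCompactSupport.intro ((isCompact_eichler c).prod (isCompact_eichler c))
    fun x hx => Set.indicator_of_notMem hx _⟩
  exact (LocallyConstant.charFn ℂ (isClopen_eichler_prod c)).isLocallyConstant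

lemma norm_bilin_le {x y : V p} (hx : x ∈ eichler p 0) (hy : y ∈ eichler p 0) :
    ‖bilin x y‖ ≤ 1 := by
  have h : ∀ z ∈ eichler p 0, ‖z.det‖ ≤ 1 := fun z hz => by
    simpa using norm_det_le hz.1
  have hxy : x + y ∈ eichler p 0 := by
    rw [eichler_eq_box] at *; exact add_mem_box hx hy
  exact padic_norm_sub_le (padic_norm_sub_le (h _ hxy) (h _ hx)) (h _ hy)

lemma bilin_eq (x y : V p) :
    bilin x y = x 0 0 * y 1 1 + x 1 1 * y 0 0 - x 0 1 * y 1 0 - x 1 0 * y 0 1 := by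
  simp only [bilin, Matrix.det_fin_two, Matrix.add_apply]
  ring

lemma bilin_add_left (x x' y : V p) : bilin (x + x') y = bilin x y + bilin x' y := by
  simp only [bilin_eq, Matrix.add_apply]; ring

/-- The form pairs entry $(0,0)$ with $(1,1)$ and $(0,1)$ with $(1,0)$. A matrix supported in the
entry dual to a non-integral $y_{ij}$ can therefore produce the prescribed value $t$ on which $\psi$
is non-trivial. -/
lemma exists_bilin_ne {ψ : AddChar ℚ_[p] Circle} (hψ : HasConductorZp ψ) {y : V p}
    (hy : y ∉ eichler p 0) : ∃ x ∈ eichler p 0, ψ (bilin x y) ≠ 1 := by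
  obtain ⟨-, t, ht, ht'⟩ := hψ
  obtain ⟨i, j, hij⟩ : ∃ i j, 1 < ‖y i j‖ := by
    by_contra h
    push Not at h
    exact hy ⟨h, by simpa using h 1 0⟩
  have hp := prime_real_pos (p := p)
  have hple : (p : ℝ) ≤ ‖y i j‖ := by
    have := prime_mul_norm_le_of_lt (p := p) (x := 1) (y := y i j) (by simpa using hij)
    simpa using this
  have hy0 : y i j ≠ 0 := by
    intro h
    rw [h, norm_zero] at hij
    linarith
  have hs : ‖t / y i j‖ ≤ 1 := by
    rw [norm_div]; exact div_le_one_of_le₀ (ht.trans hple) (norm_nonneg _)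
  have hmem : ∀ k l : Fin 2, ∀ u : ℚ_[p], ‖u‖ ≤ 1 → Matrix.single k l u ∈ eichler p 0 := by
    intro k l u hu
    have : ∀ a b, ‖(Matrix.single k l u : V p) a b‖ ≤ 1 := by
      intro a b
      rw [Matrix.single_apply]
      split_ifs
      · exact hu
      · simp
    exact ⟨this, by simpa using this 1 0⟩
  have hs' : ‖-(t / y i j)‖ ≤ 1 := by rwa [norm_neg]
  fin_cases i <;> fin_cases j
  · refine ⟨_, hmem 1 1 _ hs, ?_⟩
    rw [bilin_eq]
    simp only [Fin.zero_eta, Fin.mk_one] at hy0 ⊢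
    simpa [div_mul_cancel₀ _ hy0] using ht'
  · refine ⟨_, hmem 1 0 _ hs', ?_⟩
    rw [bilin_eq]
    simp only [Fin.zero_eta, Fin.mk_one] at hy0 ⊢
    simpa [div_mul_cancel₀ _ hy0] using ht'
  · refine ⟨_, hmem 0 1 _ hs', ?_⟩
    rw [bilin_eq]
    simp only [Fin.zero_eta, Fin.mk_one] at hy0 ⊢
    simpa [div_mul_cancel₀ _ hy0] using ht'
  · refine ⟨_, hmem 0 0 _ hs, ?_⟩
    rw [bilin_eq]
    simp only [Fin.zero_eta, Fin.mk_one] at hy0 ⊢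
    simpa [div_mul_cancel₀ _ hy0] using ht'

/-- $\mathrm M_2(\mathbf Z_p)$ equals its dual lattice. Off the lattice, translating the variable by
an $x_0$ with $\psi(x_0,y)\ne1$ multiplies the transform by a number other than 1, so it vanishes.
-/
lemma fourier_phiStar {ψ : AddChar ℚ_[p] Circle} (hψ : HasConductorZp ψ) (dx : Measure (X p))
    [dx.IsAddHaarMeasure] :
    fourier ψ dx (phiStar p 0) =
      fun y => (dx.real (eichler p 0 ×ˢ eichler p 0) : ℂ) * phiStar p 0 y := by
  classical
  have hms : MeasurableSet (eichler p 0 ×ˢ eichler p 0 : Set (X p)) :=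
    (isClopen_eichler_prod 0).1.measurableSet
  funext y
  by_cases hy : y.1 ∈ eichler p 0 ∧ y.2 ∈ eichler p 0
  · have h1 : ∀ x, phiStar p 0 x * (ψ (bilinX x y) : ℂ) = phiStar p 0 x := by
      intro x
      by_cases hx : x.1 ∈ eichler p 0 ∧ x.2 ∈ eichler p 0
      · have h2 : ψ (bilinX x y) = 1 :=
          hψ.1 _ (padic_norm_add_le (norm_bilin_le hx.1 hy.1) (norm_bilin_le hx.2 hy.2))
        rw [h2, Circle.coe_one, mul_one]
      · rw [phiStar, if_neg hx, zero_mul]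
    rw [fourier]
    simp_rw [h1]
    rw [phiStar, if_pos hy, mul_one, phiStar_eq_indicator, integral_indicator_one_complex dx hms]
  · have h0 : phiStar p 0 y = 0 := if_neg hy
    rw [h0, mul_zero]
    obtain ⟨x₀, hx₀, hne⟩ : ∃ x₀ : X p, (x₀.1 ∈ eichler p 0 ∧ x₀.2 ∈ eichler p 0) ∧
        ψ (bilinX x₀ y) ≠ 1 := by
      have hz : (0 : V p) ∈ eichler p 0 := ⟨by simp, by simp⟩
      have hb : ∀ y : V p, bilin 0 y = 0 := fun y => by simp [bilin_eq]
      by_cases h1 : y.1 ∈ eichler p 0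
      · obtain ⟨x, hx, hx'⟩ := exists_bilin_ne hψ fun h2 => hy ⟨h1, h2⟩
        exact ⟨(0, x), ⟨hz, hx⟩, by rwa [bilinX, hb, zero_add]⟩
      · obtain ⟨x, hx, hx'⟩ := exists_bilin_ne hψ h1
        exact ⟨(x, 0), ⟨hx, hz⟩, by rwa [bilinX, hb, add_zero]⟩
    have key : fourier ψ dx (phiStar p 0) y =
        (ψ (bilinX x₀ y) : ℂ) * fourier ψ dx (phiStar p 0) y := by
      conv_lhs => rw [fourier, ← integral_add_left_eq_self _ x₀]
      rw [fourier, ← integral_const_mul]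
      congr 1
      funext x
      have e1 : phiStar p 0 (x₀ + x) = phiStar p 0 x := by
        have hadd : ∀ a b : V p, a ∈ eichler p 0 → (a + b ∈ eichler p 0 ↔ b ∈ eichler p 0) := by
          intro a b ha
          rw [eichler_eq_box] at *
          exact ⟨fun h => by simpa using sub_mem_box h ha, add_mem_box ha⟩
        rw [phiStar, phiStar, Prod.fst_add, Prod.snd_add, hadd _ _ hx₀.1, hadd _ _ hx₀.2]
      have e2 : bilinX (x₀ + x) y = bilinX x₀ y + bilinX x y := by
        simp only [bilinX, Prod.fst_add, Prod.snd_add, bilin_add_left]; ring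
      rw [e1, e2, AddChar.map_add_eq_mul, Circle.coe_mul]
      ring
    have h2 : (1 - (ψ (bilinX x₀ y) : ℂ)) * fourier ψ dx (phiStar p 0) y = 0 := by
      rw [sub_mul, one_mul, ← key, sub_self]
    refine (mul_eq_zero.mp h2).resolve_left fun h3 => hne ?_
    exact Circle.ext (sub_eq_zero.mp h3).symm

/-- Applying the Fourier transform twice to the characteristic function multiplies it by the square
of the volume. -/
lemma IsSelfDual.volume_eq_one {ψ : AddChar ℚ_[p] Circle} (hψ : HasConductorZp ψ)
    {dx : Measure (X p)} (hdx : IsSelfDual ψ dx) :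
    dx.real (box p 0 ×ˢ box p 0) = 1 := by
  have := hdx.1
  have hbox : box p 0 = eichler p 0 := by
    rw [eichler_eq_box]; congr 1; ext i j; fin_cases i <;> fin_cases j <;> simp
  rw [hbox]
  have h := hdx.2 _ (isBruhatSchwartz_phiStar 0) 0
  rw [fourier_phiStar hψ] at h
  have h2 : fourier ψ dx (fun y => (dx.real (eichler p 0 ×ˢ eichler p 0) : ℂ) * phiStar p 0 y) 0 =
      (dx.real (eichler p 0 ×ˢ eichler p 0) : ℂ) * fourier ψ dx (phiStar p 0) 0 := by
    rw [fourier, fourier, ← integral_const_mul]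
    simp only [mul_assoc]
  have h3 : phiStar p 0 (0 : X p) = 1 := if_pos ⟨⟨by simp, by simp⟩, ⟨by simp, by simp⟩⟩
  rw [h2, fourier_phiStar hψ, neg_zero, h3] at h
  beta_reduce at h
  rw [h3, mul_one] at h
  have h4 : dx.real (eichler p 0 ×ˢ eichler p 0) * dx.real (eichler p 0 ×ˢ eichler p 0) = 1 := by
    exact_mod_cast h
  nlinarith [measureReal_nonneg (μ := dx) (s := eichler p 0 ×ˢ eichler p 0)]

/-! ### The pairing of the Weil representation -/

lemma mul_mem_eichler {c : ℕ} {x y : V p} (hx : x ∈ eichler p c) (hy : y ∈ eichler p c) :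
    x * y ∈ eichler p c := by
  refine ⟨fun i j => ?_, ?_⟩
  · rw [Matrix.mul_apply, Fin.sum_univ_two]
    exact padic_norm_add_le (padic_norm_mul_le_one (hx.1 _ _) (hy.1 _ _))
      (padic_norm_mul_le_one (hx.1 _ _) (hy.1 _ _))
  · rw [Matrix.mul_apply, Fin.sum_univ_two]
    apply padic_norm_add_le <;> rw [norm_mul]
    · exact (mul_le_of_le_one_right (norm_nonneg _) (hy.1 _ _)).trans hx.2
    · exact (mul_le_of_le_one_left (norm_nonneg _) (hx.1 _ _)).trans hy.2

lemma unit_mul_mem_eichler {c : ℕ} {k k' : GL (Fin 2) ℚ_[p]} (hk : k ∈ eichlerSubgroup p c)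
    (hk' : k' ∈ eichlerSubgroup p c) (x : V p) :
    (k : V p) * x * (k' : V p) ∈ eichler p c ↔ x ∈ eichler p c := by
  constructor
  · intro h
    have := mul_mem_eichler (mul_mem_eichler hk.2 h) hk'.2
    rwa [← mul_assoc, ← mul_assoc, Units.inv_mul, one_mul, mul_assoc, Units.mul_inv, mul_one] at this
  · intro h
    exact mul_mem_eichler (mul_mem_eichler hk.1 h) hk'.1

/-- The intersection of the Eichler order `R` with `a R d⁻¹`. -/
def orderInter (p : ℕ) [Fact p.Prime] (c : ℕ) (a d : GL (Fin 2) ℚ_[p]) : Set (V p) :=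
  {x | ((a⁻¹ : GL (Fin 2) ℚ_[p]) : V p) * x * (d : V p) ∈ eichler p c ∧ x ∈ eichler p c}

lemma isClosed_orderInter (c : ℕ) (a d : GL (Fin 2) ℚ_[p]) : IsClosed (orderInter p c a d) :=
  ((isClosed_eichler c).preimage (by fun_prop :
    Continuous fun x : V p => ((a⁻¹ : GL (Fin 2) ℚ_[p]) : V p) * x * (d : V p))).inter
    (isClosed_eichler c)

lemma rho_mk (a d : GL (Fin 2) ℚ_[p]) (x : V p) :
    rho p (QuotientGroup.mk (a, d)) x = (a : V p) * x * ((d⁻¹ : GL (Fin 2) ℚ_[p]) : V p) := by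
  rw [mul_assoc]; rfl

lemma weil_mkH01 (a d : GL (Fin 2) ℚ_[p]) (h : (a : V p).det = (d : V p).det) (φ : X p → ℂ)
    (x : X p) : weil (mkH01 a d h) φ x =
      φ (((a⁻¹ : GL (Fin 2) ℚ_[p]) : V p) * x.1 * (d : V p),
        ((a⁻¹ : GL (Fin 2) ℚ_[p]) : V p) * x.2 * (d : V p)) := by
  have h1 : ((mkH01 a d h : H01 p) : H0 p)⁻¹ = QuotientGroup.mk (a⁻¹, d⁻¹) := rfl
  rw [weil, h1, rho_mk, rho_mk, inv_inv]

lemma weil_mul (h k : H01 p) (φ : X p → ℂ) : weil (h * k) φ = weil h (weil k φ) := by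
  funext x
  simp only [weil]
  rw [Subgroup.coe_mul, mul_inv_rev, map_mul]
  rfl

lemma weil_phiStar {c : ℕ} {u : H01 p} (hu : u ∈ calUSubgroup p c) :
    weil u (phiStar p c) = phiStar p c := by
  classical
  obtain ⟨a, d, had, rfl⟩ := exists_mkH01 u
  obtain ⟨z, h1, h2⟩ := mkH01_mem_calU.mp hu
  have e : mkH01 a d had = mkH01 (a * Matrix.GeneralLinearGroup.scalar (Fin 2) z)
      (d * Matrix.GeneralLinearGroup.scalar (Fin 2) z) (by
      rw [Units.val_mul, Units.val_mul, Matrix.det_mul, Matrix.det_mul, had]) :=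
    mkH01_eq_iff.mpr ⟨z, rfl, rfl⟩
  funext x
  rw [e, weil_mkH01, phiStar, phiStar]
  simp only [unit_mul_mem_eichler (inv_mem h1) h2]

/-- The product of the two characteristic functions is that of $(R\cap aRd^{-1})^2$. -/
lemma weilPairing_mkH01 (dx : Measure (X p)) (c : ℕ) (a d : GL (Fin 2) ℚ_[p])
    (h : (a : V p).det = (d : V p).det) :
    weilPairing dx (weil (mkH01 a d h) (phiStar p c)) (phiStar p c) =
      (dx.real (orderInter p c a d ×ˢ orderInter p c a d) : ℂ) := by
  classical
  rw [← integral_indicator_one_complex dx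
    ((isClosed_orderInter c a d).prod (isClosed_orderInter c a d)).measurableSet, weilPairing]
  congr 1
  funext x
  rw [weil_mkH01, phiStar, phiStar, Set.indicator_apply]
  have hiff : x ∈ orderInter p c a d ×ˢ orderInter p c a d ↔
      (((a⁻¹ : GL (Fin 2) ℚ_[p]) : V p) * x.1 * (d : V p) ∈ eichler p c ∧
        ((a⁻¹ : GL (Fin 2) ℚ_[p]) : V p) * x.2 * (d : V p) ∈ eichler p c) ∧
      (x.1 ∈ eichler p c ∧ x.2 ∈ eichler p c) :=
    ⟨fun h => ⟨⟨h.1.1, h.2.1⟩, ⟨h.1.2, h.2.2⟩⟩, fun h => ⟨⟨h.1.1, h.2.1⟩, ⟨h.1.2, h.2.2⟩⟩⟩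
  by_cases h1 : ((a⁻¹ : GL (Fin 2) ℚ_[p]) : V p) * x.1 * (d : V p) ∈ eichler p c ∧
        ((a⁻¹ : GL (Fin 2) ℚ_[p]) : V p) * x.2 * (d : V p) ∈ eichler p c <;>
    by_cases h2 : x.1 ∈ eichler p c ∧ x.2 ∈ eichler p c <;>
    simp [hiff, h2, *]

/-- An additive automorphism that preserves an open compact set preserves Haar measure. -/
lemma measure_preimage_of_preserves (dx : Measure (X p)) [dx.IsAddHaarMeasure] (φ : X p ≃ₜ+ X p)
    {T : Set (X p)} (hT : φ ⁻¹' T = T) (hTo : IsOpen T) (hTc : IsCompact T) (hne : T.Nonempty)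
    {S : Set (X p)} (hS : MeasurableSet S) : dx.real (φ ⁻¹' S) = dx.real S := by
  have h := addEquivAddHaarChar_smul_map dx φ
  have hmeas : Measurable φ := φ.continuous_toFun.measurable
  have h1 : ∀ S : Set (X p), MeasurableSet S →
      (addEquivAddHaarChar φ : ℝ) * dx.real (φ ⁻¹' S) = dx.real S := by
    intro S hS
    conv_rhs => rw [measureReal_def, ← h]
    rw [Measure.smul_apply, Measure.map_apply hmeas hS, measureReal_def]
    simp
  have hT' := h1 T hTo.measurableSet
  have hpos : 0 < dx.real T :=
    ENNReal.toReal_pos (hTo.measure_pos dx hne).ne' hTc.measure_lt_top.ne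
  rw [hT] at hT'
  have := h1 S hS
  rwa [(mul_eq_right₀ hpos.ne').mp hT', one_mul] at this

/-- The automorphism `x ↦ g x h` of `𝐗_p`. -/
def mulLeftRight (g h : GL (Fin 2) ℚ_[p]) : X p ≃ₜ+ X p where
  toFun x := ((g : V p) * x.1 * (h : V p), (g : V p) * x.2 * (h : V p))
  invFun x := (((g⁻¹ : GL (Fin 2) ℚ_[p]) : V p) * x.1 * ((h⁻¹ : GL (Fin 2) ℚ_[p]) : V p),
    ((g⁻¹ : GL (Fin 2) ℚ_[p]) : V p) * x.2 * ((h⁻¹ : GL (Fin 2) ℚ_[p]) : V p))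
  left_inv x := by
    ext1 <;> simp only [← mul_assoc, Units.inv_mul, one_mul] <;>
      rw [mul_assoc, Units.mul_inv, mul_one]
  right_inv x := by
    ext1 <;> simp only [← mul_assoc, Units.mul_inv, one_mul] <;>
      rw [mul_assoc, Units.inv_mul, mul_one]
  map_add' x y := by ext1 <;> simp [mul_add, add_mul]
  continuous_toFun := by fun_prop
  continuous_invFun := by fun_prop

/-- The map $x\mapsto k^{-1}xk'$ preserves $R\oplus R$, hence Haar measure, and carries one
intersection to the other. So only the double cosets of $a$ and $d$ matter. -/
lemma measure_orderInter_unit_mul (dx : Measure (X p)) [dx.IsAddHaarMeasure] {c : ℕ}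
    {k k' : GL (Fin 2) ℚ_[p]} (hk : k ∈ eichlerSubgroup p c) (hk' : k' ∈ eichlerSubgroup p c)
    (a d : GL (Fin 2) ℚ_[p]) :
    dx.real (orderInter p c (k * a) (k' * d) ×ˢ orderInter p c (k * a) (k' * d)) =
      dx.real (orderInter p c a d ×ˢ orderInter p c a d) := by
  have hR := unit_mul_mem_eichler (inv_mem hk) hk'
  have hT : mulLeftRight k⁻¹ k' ⁻¹' (eichler p c ×ˢ eichler p c) = eichler p c ×ˢ eichler p c := by
    ext x
    exact and_congr (hR x.1) (hR x.2)
  rw [← measure_preimage_of_preserves dx (mulLeftRight k⁻¹ k') hT (isClopen_eichler_prod c).2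
    ((isCompact_eichler c).prod (isCompact_eichler c))
    ⟨0, ⟨by simp, by simp⟩, ⟨by simp, by simp⟩⟩
    ((isClosed_orderInter c a d).prod (isClosed_orderInter c a d)).measurableSet]
  congr 1
  have : ∀ x : V p, x ∈ orderInter p c (k * a) (k' * d) ↔
      ((k⁻¹ : GL (Fin 2) ℚ_[p]) : V p) * x * (k' : V p) ∈ orderInter p c a d := by
    intro x
    refine and_congr ?_ (hR x).symm
    rw [mul_inv_rev, Units.val_mul, Units.val_mul]
    simp only [mul_assoc]
  ext x
  exact and_congr (this x.1) (this x.2)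

/-- Volumes of intersections that are boxes. -/
lemma measure_orderInter_of_box {ψ : AddChar ℚ_[p] Circle} (hψ : HasConductorZp ψ)
    {dx : Measure (X p)} (hdx : IsSelfDual ψ dx) {c : ℕ} {a d : GL (Fin 2) ℚ_[p]}
    (α β γ δ : ℤ) (h : orderInter p c a d = box p !![α, β; γ, δ]) :
    dx.real (orderInter p c a d ×ˢ orderInter p c a d) =
      (p : ℝ) ^ (-2 * (α + β + γ + δ)) := by
  have := hdx.1
  rw [h, measure_box, hdx.volume_eq_one hψ, mul_one]

/-- Both families lie in the double coset of one diagonal matrix. For the second family the left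
factor is the integral matrix $\begin{pmatrix}0&1\\-1&-px\end{pmatrix}$. -/
lemma sphericalRep_eq (e : Fin 2) (n : ℕ) (x) :
    ∃ k ∈ eichlerSubgroup p 0, sphericalRep p e n x =
      k * (scalarPow p (-n) * heckeMat (2 * n + e) 0) := by
  rcases x with x | x
  · refine ⟨_, uni_mem (norm_natCast_le_one (x : ℕ)) 0, ?_⟩
    rw [sphericalRep, ← mul_assoc, ← Matrix.GeneralLinearGroup.scalar_commute, mul_assoc]
    congr 1
    apply Units.ext
    rw [Units.val_mul]
    ext i j; fin_cases i <;> fin_cases j <;> simp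
  · obtain ⟨h0, -⟩ := secondCard_of_fin x
    let k : GL (Fin 2) ℚ_[p] := Matrix.GeneralLinearGroup.mkOfDetNeZero
      !![0, 1; -1, -(p : ℚ_[p]) * ((x : ℕ) : ℚ_[p])] (by simp [Matrix.det_fin_two])
    have hk : (k : V p) = !![0, 1; -1, -(p : ℚ_[p]) * ((x : ℕ) : ℚ_[p])] := rfl
    refine ⟨k, ?_, ?_⟩
    · rw [mem_eichlerSubgroup_zero, hk]
      refine ⟨fun i j => ?_, by simp [Matrix.det_fin_two]⟩
      fin_cases i <;> fin_cases j <;> simp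
      exact mul_le_one₀ (inv_le_one_of_one_le₀ one_lt_prime_real.le) (norm_nonneg _)
        (norm_natCast_le_one _)
    · rw [sphericalRep, ← mul_assoc, ← mul_assoc, ← Matrix.GeneralLinearGroup.scalar_commute,
        ← Matrix.GeneralLinearGroup.scalar_commute, mul_assoc, mul_assoc]
      congr 1
      apply Units.ext
      rw [Units.val_mul, Units.val_mul, hk]
      obtain ⟨N, hN⟩ : ∃ N, 2 * n + (e : ℕ) = N + 1 := ⟨2 * n + e - 1, by omega⟩
      generalize (x : ℕ) = t
      rw [hN, Nat.add_sub_cancel]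
      ext i j; fin_cases i <;> fin_cases j <;> simp [pow_succ, mul_comm]

lemma norm_pow_mul_le_iff {s t : ℤ} {x : ℚ_[p]} :
    ‖(p : ℚ_[p]) ^ s * x‖ ≤ (p : ℝ) ^ t ↔ ‖x‖ ≤ (p : ℝ) ^ (s + t) := by
  have hp := prime_real_pos (p := p)
  rw [norm_mul, Padic.norm_p_zpow, zpow_neg, inv_mul_le_iff₀ (zpow_pos hp _), zpow_add₀ hp.ne']

lemma norm_le_and_iff {s t : ℤ} {r : ℝ} :
    r ≤ (p : ℝ) ^ s ∧ r ≤ (p : ℝ) ^ t ↔ r ≤ (p : ℝ) ^ (min s t) := by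
  rw [← le_inf_iff]
  rw [(zpow_right_strictMono₀ (one_lt_prime_real (p := p))).monotone.map_min]

lemma mem_orderInter_iff {c : ℕ} {a d : GL (Fin 2) ℚ_[p]} {x : V p} {y : V p}
    (hy : ((a⁻¹ : GL (Fin 2) ℚ_[p]) : V p) * x * (d : V p) = y) :
    x ∈ orderInter p c a d ↔
      (‖y 0 0‖ ≤ (p : ℝ) ^ (0 : ℤ) ∧ ‖y 0 1‖ ≤ (p : ℝ) ^ (0 : ℤ) ∧
        ‖y 1 0‖ ≤ (p : ℝ) ^ (-(c : ℤ)) ∧ ‖y 1 1‖ ≤ (p : ℝ) ^ (0 : ℤ)) ∧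
      (‖x 0 0‖ ≤ (p : ℝ) ^ (0 : ℤ) ∧ ‖x 0 1‖ ≤ (p : ℝ) ^ (0 : ℤ) ∧
        ‖x 1 0‖ ≤ (p : ℝ) ^ (-(c : ℤ)) ∧ ‖x 1 1‖ ≤ (p : ℝ) ^ (0 : ℤ)) := by
  have h : ∀ z : V p, z ∈ eichler p c ↔ (‖z 0 0‖ ≤ (p : ℝ) ^ (0 : ℤ) ∧
      ‖z 0 1‖ ≤ (p : ℝ) ^ (0 : ℤ) ∧ ‖z 1 0‖ ≤ (p : ℝ) ^ (-(c : ℤ)) ∧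
      ‖z 1 1‖ ≤ (p : ℝ) ^ (0 : ℤ)) := fun z => by
    rw [eichler_eq_box]
    simp [box, Fin.forall_fin_two, and_assoc]
  rw [← h x, ← h y, ← hy]
  rfl

lemma mem_box_iff {α β γ δ : ℤ} {x : V p} : x ∈ box p !![α, β; γ, δ] ↔
    ‖x 0 0‖ ≤ (p : ℝ) ^ (-α) ∧ ‖x 0 1‖ ≤ (p : ℝ) ^ (-β) ∧ ‖x 1 0‖ ≤ (p : ℝ) ^ (-γ) ∧
      ‖x 1 1‖ ≤ (p : ℝ) ^ (-δ) := by
  simp [box, Fin.forall_fin_two, and_assoc]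

lemma weilPairing_sphericalRep {ψ : AddChar ℚ_[p] Circle} (hψ : HasConductorZp ψ)
    {dx : Measure (X p)} (hdx : IsSelfDual ψ dx) (e : Fin 2) (n m : ℕ) (x y)
    (h : (sphericalRep p e n x : V p).det = (sphericalRep p e m y : V p).det) :
    weilPairing dx (weil (mkH01 (sphericalRep p e n x) (sphericalRep p e m y) h) (phiStar p 0))
      (phiStar p 0) = (((p : ℝ) ^ (-2 * ((max (2 * n + e) (2 * m + e) : ℕ) : ℤ)) : ℝ) : ℂ) := by
  have := hdx.1
  have hp := prime_cast_ne_zero (p := p)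
  rw [weilPairing_mkH01]
  obtain ⟨k, hk, hk'⟩ := sphericalRep_eq e n x
  obtain ⟨l, hl, hl'⟩ := sphericalRep_eq e m y
  rw [hk', hl', measure_orderInter_unit_mul dx hk hl]
  -- The entries of $a^{-1}zd$ are those of $z$ scaled by $p^{m-n}$, $p^{-n-m-e}$, $p^{n+m+e}$,
  -- $p^{n-m}$. The box exponents add up to $|n-m|+n+m+e=\max(2n+e,2m+e)$.
  rw [measure_orderInter_of_box hψ hdx (max 0 ((n : ℤ) - m)) (max 0 ((n : ℤ) + m + e))
    (max 0 (-(n : ℤ) - m - e)) (max 0 ((m : ℤ) - n))]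
  · congr 3
    push_cast
    omega
  · ext z
    set A := scalarPow p (-n) * heckeMat (p := p) (2 * n + e) 0 with hA
    set D := scalarPow p (-m) * heckeMat (p := p) (2 * m + e) 0 with hD
    have hAi : ((A⁻¹ : GL (Fin 2) ℚ_[p]) : V p) =
        !![(p : ℚ_[p]) ^ (-(n : ℤ) - e), 0; 0, (p : ℚ_[p]) ^ (n : ℤ)] := by
      ext i j
      have h1 := coe_hecke_inv_mul (-n) (2 * n + e) (0 : ℚ_[p]) 1 j
      rw [mul_one] at h1
      fin_cases i
      · refine h1.1.trans ?_
        fin_cases j <;> simp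
        congr 1; ring
      · refine h1.2.trans ?_
        fin_cases j <;> simp
    have hDe : (D : V p) = !![(p : ℚ_[p]) ^ ((m : ℤ) + e), 0; 0, (p : ℚ_[p]) ^ (-(m : ℤ))] := by
      ext i j
      rw [hD, coe_scalarPow_mul]
      fin_cases i <;> fin_cases j <;> simp
      rw [← zpow_natCast, ← zpow_natCast, ← zpow_neg, ← zpow_add₀ hp]
      congr 1; push_cast; ring
    have hy : ((A⁻¹ : GL (Fin 2) ℚ_[p]) : V p) * z * (D : V p) =
        !![(p : ℚ_[p]) ^ ((m : ℤ) - n) * z 0 0, (p : ℚ_[p]) ^ (-(n : ℤ) - m - e) * z 0 1;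
          (p : ℚ_[p]) ^ ((n : ℤ) + m + e) * z 1 0, (p : ℚ_[p]) ^ ((n : ℤ) - m) * z 1 1] := by
      rw [hAi, hDe, Matrix.eta_fin_two z, Matrix.mul_fin_two, Matrix.mul_fin_two]
      ext i j
      fin_cases i <;> fin_cases j <;> simp only [Fin.zero_eta, Fin.mk_one, Matrix.of_apply,
        Matrix.cons_val', Matrix.cons_val_zero, Matrix.cons_val_one, Matrix.cons_val_fin_one,
        zero_mul, mul_zero, add_zero, zero_add] <;> rw [mul_right_comm, ← zpow_add₀ hp] <;>
        congr 2 <;> ring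
    rw [mem_orderInter_iff hy, mem_box_iff]
    simp only [Matrix.of_apply, Matrix.cons_val', Matrix.cons_val_zero, Matrix.cons_val_one,
      Matrix.cons_val_fin_one, norm_pow_mul_le_iff]
    rw [show -max 0 ((n : ℤ) - m) = min ((m : ℤ) - n + 0) 0 by omega,
      show -max 0 ((n : ℤ) + m + e) = min (-(n : ℤ) - m - e + 0) 0 by omega,
      show -max 0 (-(n : ℤ) - m - e) = min ((n : ℤ) + m + e + -((0 : ℕ) : ℤ)) (-((0 : ℕ) : ℤ)) by omega,
      show -max 0 ((m : ℤ) - n) = min ((n : ℤ) - m + 0) 0 by omega]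
    simp only [← norm_le_and_iff]
    tauto

lemma eichler_eta_conj (e : ℕ) (x : V p) :
    (((eta p ^ e)⁻¹ : GL (Fin 2) ℚ_[p]) : V p) * x * ((eta p ^ e : GL (Fin 2) ℚ_[p]) : V p) ∈
      eichler p 1 ↔ x ∈ eichler p 1 := by
  have hp := prime_cast_ne_zero (p := p)
  have h2 : ∀ x : V p, (((eta p)⁻¹ : GL (Fin 2) ℚ_[p]) : V p) * x * (eta p : V p) ∈ eichler p 1 ↔
      x ∈ eichler p 1 := by
    intro x
    have h1 : (((eta p)⁻¹ : GL (Fin 2) ℚ_[p]) : V p) * x * (eta p : V p) =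
        !![x 1 1, -(p : ℚ_[p])⁻¹ * x 1 0; -(p : ℚ_[p]) * x 0 1, x 0 0] := by
      rw [coe_eta_inv, coe_atkinLehner, Matrix.eta_fin_two x, Matrix.mul_fin_two,
        Matrix.mul_fin_two]
      ext i j
      fin_cases i <;> fin_cases j <;> simp [hp, mul_comm]
    rw [h1, eichler_eq_box, mem_box_iff, mem_box_iff]
    have e1 : ∀ t : ℚ_[p], ‖-(p : ℚ_[p])⁻¹ * t‖ ≤ (p : ℝ) ^ (-(0 : ℤ)) ↔
        ‖t‖ ≤ (p : ℝ) ^ (-((1 : ℕ) : ℤ)) := fun t => by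
      rw [← zpow_neg_one, neg_mul, norm_neg, norm_pow_mul_le_iff]; simp
    have e2 : ∀ t : ℚ_[p], ‖-(p : ℚ_[p]) * t‖ ≤ (p : ℝ) ^ (-((1 : ℕ) : ℤ)) ↔
        ‖t‖ ≤ (p : ℝ) ^ (-(0 : ℤ)) := fun t => by
      rw [neg_mul, norm_neg]
      nth_rw 1 [← zpow_one (p : ℚ_[p])]
      rw [norm_pow_mul_le_iff]; simp
    simp only [Matrix.of_apply, Matrix.cons_val', Matrix.cons_val_zero, Matrix.cons_val_one,
      Matrix.cons_val_fin_one, e1, e2]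
    tauto
  induction e generalizing x with
  | zero => simp
  | succ e ih =>
    refine Iff.trans ?_ ((h2 _).trans (ih x))
    rw [pow_succ, mul_inv_rev, Units.val_mul, Units.val_mul]
    simp only [mul_assoc]

/-- Multiplication by monomial matrices permutes and rescales entries, so the intersection is a box
for each combination of parities. The summand 1 is the exponent of the Eichler order itself. -/
lemma orderInter_weyl (n m : ℤ) : ∃ α β γ δ : ℤ,
    orderInter p 1 (weyl p n) (weyl p m) = box p !![α, β; γ, δ] ∧
      α + β + γ + δ = 1 + (max n.natAbs m.natAbs : ℕ) := by
  have hp := prime_cast_ne_zero (p := p)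
  have hmul : ∀ s t u : ℤ, ∀ z : ℚ_[p], s + t = u →
      (p : ℚ_[p]) ^ s * z * (p : ℚ_[p]) ^ t = (p : ℚ_[p]) ^ u * z := fun s t u z h => by
    rw [mul_right_comm, ← zpow_add₀ hp, h]
  obtain ⟨k, rfl | rfl⟩ := Int.even_or_odd' n <;> obtain ⟨l, rfl | rfl⟩ := Int.even_or_odd' m
  · refine ⟨max 0 (k - l), max 0 (k + l), max 1 (1 - k - l), max 0 (l - k), ?_, by omega⟩
    ext z
    have hy : (((weyl p (2 * k))⁻¹ : GL (Fin 2) ℚ_[p]) : V p) * z * (weyl p (2 * l) : V p) =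
        !![(p : ℚ_[p]) ^ (l - k) * z 0 0, (p : ℚ_[p]) ^ (-k - l) * z 0 1;
          (p : ℚ_[p]) ^ (k + l) * z 1 0, (p : ℚ_[p]) ^ (k - l) * z 1 1] := by
      rw [coe_weyl_even_inv, coe_weyl_even, Matrix.eta_fin_two z, Matrix.mul_fin_two,
        Matrix.mul_fin_two]
      ext i j
      fin_cases i <;> fin_cases j <;> simp only [Fin.zero_eta, Fin.mk_one, Matrix.of_apply,
        Matrix.cons_val', Matrix.cons_val_zero, Matrix.cons_val_one, Matrix.cons_val_fin_one,
        zero_mul, mul_zero, add_zero, zero_add] <;> exact hmul _ _ _ _ (by ring)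
    rw [mem_orderInter_iff hy, mem_box_iff]
    simp only [Matrix.of_apply, Matrix.cons_val', Matrix.cons_val_zero, Matrix.cons_val_one,
      Matrix.cons_val_fin_one, norm_pow_mul_le_iff]
    rw [show -max 0 (k - l) = min (l - k + 0) 0 by omega,
      show -max 0 (k + l) = min (-k - l + 0) 0 by omega,
      show -max 1 (1 - k - l) = min (k + l + -((1 : ℕ) : ℤ)) (-((1 : ℕ) : ℤ)) by omega,
      show -max 0 (l - k) = min (k - l + 0) 0 by omega]
    simp only [← norm_le_and_iff]
    tauto
  · refine ⟨max 0 (k - l), max 0 (k + l), max 1 (-k - l), max 0 (l - k + 1), ?_,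
      by omega⟩
    ext z
    have hy : (((weyl p (2 * k))⁻¹ : GL (Fin 2) ℚ_[p]) : V p) * z * (weyl p (2 * l + 1) : V p) =
        !![-((p : ℚ_[p]) ^ (-k - l) * z 0 1), (p : ℚ_[p]) ^ (l - k) * z 0 0;
          -((p : ℚ_[p]) ^ (k - l) * z 1 1), (p : ℚ_[p]) ^ (k + l) * z 1 0] := by
      rw [coe_weyl_even_inv, coe_weyl_odd, Matrix.eta_fin_two z, Matrix.mul_fin_two,
        Matrix.mul_fin_two]
      ext i j
      fin_cases i <;> fin_cases j <;> simp only [Fin.zero_eta, Fin.mk_one, Matrix.of_apply,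
        Matrix.cons_val', Matrix.cons_val_zero, Matrix.cons_val_one, Matrix.cons_val_fin_one,
        zero_mul, mul_zero, add_zero, zero_add, mul_neg, neg_inj] <;>
        exact hmul _ _ _ _ (by ring)
    rw [mem_orderInter_iff hy, mem_box_iff]
    simp only [Matrix.of_apply, Matrix.cons_val', Matrix.cons_val_zero, Matrix.cons_val_one,
      Matrix.cons_val_fin_one, norm_pow_mul_le_iff, norm_neg]
    rw [show -max 0 (k - l) = min (l - k + 0) 0 by omega,
      show -max 0 (k + l) = min (-k - l + 0) 0 by omega,
      show -max 1 (-k - l) = min (k + l + 0) (-((1 : ℕ) : ℤ)) by omega,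
      show -max 0 (l - k + 1) = min (k - l + -((1 : ℕ) : ℤ)) 0 by omega]
    simp only [← norm_le_and_iff]
    tauto
  · refine ⟨max 0 (k - l + 1), max 0 (k + l), max 1 (-k - l), max 0 (l - k), ?_,
      by omega⟩
    ext z
    have hy : (((weyl p (2 * k + 1))⁻¹ : GL (Fin 2) ℚ_[p]) : V p) * z * (weyl p (2 * l) : V p) =
        !![-((p : ℚ_[p]) ^ (k + l) * z 1 0), -((p : ℚ_[p]) ^ (k - l) * z 1 1);
          (p : ℚ_[p]) ^ (l - k) * z 0 0, (p : ℚ_[p]) ^ (-k - l) * z 0 1] := by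
      rw [coe_weyl_odd_inv, coe_weyl_even, Matrix.eta_fin_two z, Matrix.mul_fin_two,
        Matrix.mul_fin_two]
      ext i j
      fin_cases i <;> fin_cases j <;> simp only [Fin.zero_eta, Fin.mk_one, Matrix.of_apply,
        Matrix.cons_val', Matrix.cons_val_zero, Matrix.cons_val_one, Matrix.cons_val_fin_one,
        zero_mul, mul_zero, add_zero, zero_add, neg_mul, neg_inj] <;>
        exact hmul _ _ _ _ (by ring)
    rw [mem_orderInter_iff hy, mem_box_iff]
    simp only [Matrix.of_apply, Matrix.cons_val', Matrix.cons_val_zero, Matrix.cons_val_one,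
      Matrix.cons_val_fin_one, norm_pow_mul_le_iff, norm_neg]
    rw [show -max 0 (k - l + 1) = min (l - k + -((1 : ℕ) : ℤ)) 0 by omega,
      show -max 0 (k + l) = min (-k - l + 0) 0 by omega,
      show -max 1 (-k - l) = min (k + l + 0) (-((1 : ℕ) : ℤ)) by omega,
      show -max 0 (l - k) = min (k - l + 0) 0 by omega]
    simp only [← norm_le_and_iff]
    tauto
  · refine ⟨max 0 (k - l), max 0 (k + l + 1), max 1 (-k - l), max 0 (l - k), ?_,
      by omega⟩
    ext z
    have hy : (((weyl p (2 * k + 1))⁻¹ : GL (Fin 2) ℚ_[p]) : V p) * z * (weyl p (2 * l + 1) : V p) =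
        !![(p : ℚ_[p]) ^ (k - l) * z 1 1, -((p : ℚ_[p]) ^ (k + l) * z 1 0);
          -((p : ℚ_[p]) ^ (-k - l) * z 0 1), (p : ℚ_[p]) ^ (l - k) * z 0 0] := by
      rw [coe_weyl_odd_inv, coe_weyl_odd, Matrix.eta_fin_two z, Matrix.mul_fin_two,
        Matrix.mul_fin_two]
      ext i j
      fin_cases i <;> fin_cases j <;> simp only [Fin.zero_eta, Fin.mk_one, Matrix.of_apply,
        Matrix.cons_val', Matrix.cons_val_zero, Matrix.cons_val_one, Matrix.cons_val_fin_one,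
        zero_mul, mul_zero, add_zero, zero_add, neg_mul, mul_neg, neg_neg, neg_inj] <;>
        exact hmul _ _ _ _ (by ring)
    rw [mem_orderInter_iff hy, mem_box_iff]
    simp only [Matrix.of_apply, Matrix.cons_val', Matrix.cons_val_zero, Matrix.cons_val_one,
      Matrix.cons_val_fin_one, norm_pow_mul_le_iff, norm_neg]
    rw [show -max 0 (k - l) = min (l - k + 0) 0 by omega,
      show -max 0 (k + l + 1) = min (-k - l + -((1 : ℕ) : ℤ)) 0 by omega,
      show -max 1 (-k - l) = min (k + l + 0) (-((1 : ℕ) : ℤ)) by omega,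
      show -max 0 (l - k) = min (k - l + 0) 0 by omega]
    simp only [← norm_le_and_iff]
    tauto

/-- The power of $\eta$ in the representatives plays no role, since $\eta$ normalises the Eichler
order of level $p$. -/
lemma weilPairing_iwahoriRep {ψ : AddChar ℚ_[p] Circle} (hψ : HasConductorZp ψ)
    {dx : Measure (X p)} (hdx : IsSelfDual ψ dx) (e : Fin 2) (n m : ℤ) (x y)
    (h : (iwahoriRep p e n x : V p).det = (iwahoriRep p e m y : V p).det) :
    weilPairing dx (weil (mkH01 (iwahoriRep p e n x) (iwahoriRep p e m y) h) (phiStar p 1))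
      (phiStar p 1) =
      (((p : ℝ) ^ (-2 * (1 + (max n.natAbs m.natAbs : ℕ) : ℤ)) : ℝ) : ℂ) := by
  have := hdx.1
  rw [weilPairing_mkH01]
  obtain ⟨k, hk, hk'⟩ := iwahoriRep_eq e n x
  obtain ⟨l, hl, hl'⟩ := iwahoriRep_eq e m y
  obtain ⟨α, β, γ, δ, hE, hsum⟩ := orderInter_weyl (p := p) n m
  rw [hk', hl', mul_assoc, mul_assoc, measure_orderInter_unit_mul dx hk hl]
  have hW : orderInter p 1 (weyl p n * eta p ^ (e : ℕ)) (weyl p m * eta p ^ (e : ℕ)) =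
      orderInter p 1 (weyl p n) (weyl p m) := by
    ext z
    refine and_congr_left fun _ => ?_
    rw [← eichler_eta_conj (e : ℕ)
      ((((weyl p n)⁻¹ : GL (Fin 2) ℚ_[p]) : V p) * z * (weyl p m : V p)), mul_inv_rev, Units.val_mul, Units.val_mul]
    simp only [mul_assoc]
  rw [hW, measure_orderInter_of_box hψ hdx α β γ δ hE, hsum]

/-! ### Matrix coefficients and the sum over double cosets. -/

section Representations

variable {W W₁ W₂ : Type*} [AddCommGroup W] [Module ℂ W] [AddCommGroup W₁] [Module ℂ W₁]
  [AddCommGroup W₂] [Module ℂ W₂]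
  {π₁ : Representation ℂ PGL(2, ℚ_[p]) W₁} {π₂ : Representation ℂ PGL(2, ℚ_[p]) W₂}

/-- A representation of `PGL₂(ℚ_p)`, as a representation of `GL₂(ℚ_p)`. -/
abbrev glRep (π : Representation ℂ PGL(2, ℚ_[p]) W) : Representation ℂ (GL (Fin 2) ℚ_[p]) W :=
  π.comp Matrix.ProjGenLinGroup.mk

/-- The centre acts trivially. -/
def CentreTrivial (ρ : Representation ℂ (GL (Fin 2) ℚ_[p]) W) : Prop :=
  ∀ z, ρ (Matrix.GeneralLinearGroup.scalar (Fin 2) z) = 1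

lemma centreTrivial_glRep (π : Representation ℂ PGL(2, ℚ_[p]) W) : CentreTrivial (glRep π) :=
  fun z => by
    change π (Matrix.ProjGenLinGroup.mk (Matrix.GeneralLinearGroup.scalar (Fin 2) z)) = 1
    rw [Matrix.ProjGenLinGroup.mk_scalar, map_one]

lemma sigma_mk (a d : GL (Fin 2) ℚ_[p]) (v : W₁) (w : W₂) :
    sigma π₁ π₂ (QuotientGroup.mk (a, d)) (v ⊗ₜ[ℂ] w) = glRep π₁ a v ⊗ₜ[ℂ] glRep π₂ d w := rfl

/-- Right invariance of the integrand. -/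
lemma zetaIntegrand_mul {c : ℕ} (dx : Measure (X p)) (B : W₁ ⊗[ℂ] W₂ →ₗ[ℂ] W₁ ⊗[ℂ] W₂ →ₗ⋆[ℂ] ℂ)
    {g₁ : W₁} {g₂ : W₂} (h1 : ∀ k ∈ eichlerSubgroup p c, glRep π₁ k g₁ = g₁)
    (h2 : ∀ k ∈ eichlerSubgroup p c, glRep π₂ k g₂ = g₂) (h : H01 p) {u : H01 p}
    (hu : u ∈ calUSubgroup p c) :
    zetaIntegrand dx (sigma π₁ π₂) B (phiStar p c) (g₁ ⊗ₜ[ℂ] g₂) (h * u) =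
      zetaIntegrand dx (sigma π₁ π₂) B (phiStar p c) (g₁ ⊗ₜ[ℂ] g₂) h := by
  obtain ⟨r, s, hr, hs, hrs⟩ : u ∈ calU p c := (coe_calUSubgroup (p := p) c) ▸ hu
  rw [zetaIntegrand, zetaIntegrand, weil_mul, weil_phiStar hu, Subgroup.coe_mul, map_mul, hrs,
    Module.End.mul_apply, sigma_mk, h1 r hr, h2 s hs]

/-- The zeta integral of an invariant pure tensor, as a sum over double cosets. -/
theorem CosetReps.zeta_eq {c : ℕ} {A : Type} [Countable A] (R : CosetReps p c A)
    (hR : ∀ e n, ∃ m, ∀ x, ∃ k ∈ eichlerSubgroup p c, R.rep e n x = k * m)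
    {dx : Measure (X p)} (w : Fin 2 × A × A → ℂ)
    (hw : ∀ q x, weilPairing dx (weil (R.pairRep q x) (phiStar p c)) (phiStar p c) = w q)
    {B : W₁ ⊗[ℂ] W₂ →ₗ[ℂ] W₁ ⊗[ℂ] W₂ →ₗ⋆[ℂ] ℂ} (hB : IsInvariantHermitian (sigma π₁ π₂) B)
    {g₁ : W₁} {g₂ : W₂} (h1 : ∀ k ∈ eichlerSubgroup p c, glRep π₁ k g₁ = g₁)
    (h2 : ∀ k ∈ eichlerSubgroup p c, glRep π₂ k g₂ = g₂)
    (dh : Measure (H01 p)) [dh.IsHaarMeasure] {S : ℂ}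
    (hS : HasSum (fun q : Fin 2 × A × A => w q *
      B ((∑ x, glRep π₁ (R.rep q.1 q.2.1 x) g₁) ⊗ₜ[ℂ] (∑ y, glRep π₂ (R.rep q.1 q.2.2 y) g₂))
        (g₁ ⊗ₜ[ℂ] g₂)) S) :
    Integrable (zetaIntegrand dx (sigma π₁ π₂) B (phiStar p c) (g₁ ⊗ₜ[ℂ] g₂)) dh ∧
      localZetaIntegral dx dh (sigma π₁ π₂) B (phiStar p c) (g₁ ⊗ₜ[ℂ] g₂) =
        (dh.real (calU p c) : ℂ) * S := by
  have hval : ∀ q x, zetaIntegrand dx (sigma π₁ π₂) B (phiStar p c) (g₁ ⊗ₜ[ℂ] g₂) (R.pairRep q x) =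
      w q * B (glRep π₁ (R.rep q.1 q.2.1 x.1) g₁ ⊗ₜ[ℂ] glRep π₂ (R.rep q.1 q.2.2 x.2) g₂)
        (g₁ ⊗ₜ[ℂ] g₂) := fun q x => by
    rw [zetaIntegrand, hw]
    rfl
  have hsum : ∀ q, ∑ x, zetaIntegrand dx (sigma π₁ π₂) B (phiStar p c) (g₁ ⊗ₜ[ℂ] g₂)
      (R.pairRep q x) = w q *
      B ((∑ x, glRep π₁ (R.rep q.1 q.2.1 x) g₁) ⊗ₜ[ℂ] (∑ y, glRep π₂ (R.rep q.1 q.2.2 y) g₂))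
        (g₁ ⊗ₜ[ℂ] g₂) := fun q => by
    simp_rw [hval, ← Finset.mul_sum, Fintype.sum_prod_type, TensorProduct.sum_tmul,
      TensorProduct.tmul_sum, map_sum, LinearMap.sum_apply]
  -- All representatives of one double coset differ by a left unit. Moving the unit to the other
  -- argument of the invariant form, where the test vector absorbs it, shows that the integrand is
  -- constant on the group.
  have hconst : ∀ q, ∃ C : ℂ, ∀ x, zetaIntegrand dx (sigma π₁ π₂) B (phiStar p c) (g₁ ⊗ₜ[ℂ] g₂)
      (R.pairRep q x) = C := fun q => by
    obtain ⟨a, ha⟩ := hR q.1 q.2.1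
    obtain ⟨d, hd⟩ := hR q.1 q.2.2
    refine ⟨w q * B (glRep π₁ a g₁ ⊗ₜ[ℂ] glRep π₂ d g₂) (g₁ ⊗ₜ[ℂ] g₂), fun x => ?_⟩
    obtain ⟨k, hk, hk'⟩ := ha x.1
    obtain ⟨l, hl, hl'⟩ := hd x.2
    rw [hval, hk', hl', map_mul, map_mul, Module.End.mul_apply, Module.End.mul_apply, ← sigma_mk]
    have hkl : g₁ ⊗ₜ[ℂ] g₂ = sigma π₁ π₂ (QuotientGroup.mk (k, l)) (g₁ ⊗ₜ[ℂ] g₂) := by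
      rw [sigma_mk, h1 k hk, h2 l hl]
    congr 1
    conv_lhs => rw [hkl]
    exact hB.invariant _ _ _
  refine R.integral_eq dh _ (fun h u hu => zetaIntegrand_mul dx B h1 h2 h hu) ?_ ?_
  -- As the terms of a group are equal, the sum of their norms is the norm of their sum, so absolute
  -- convergence follows from summability of the grouped series.
  · refine hS.summable.norm.congr fun q => ?_
    rw [← hsum]
    obtain ⟨C, hC⟩ := hconst q
    simp [hC]
  · simpa only [hsum] using hS

/-! ### The operator $U_p$ and the double coset operators. -/

variable (ρ : Representation ℂ (GL (Fin 2) ℚ_[p]) W)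

/-- The operator `U_p`. -/
def heckeU : Module.End ℂ W := ∑ x : Fin p, ρ (heckeMat 1 ((x : ℕ) : ℚ_[p]))

lemma heckeU_apply (v : W) : heckeU ρ v = ∑ x : Fin p, ρ (heckeMat 1 ((x : ℕ) : ℚ_[p])) v := by
  rw [heckeU, LinearMap.sum_apply]

/-- $\begin{pmatrix}p&y\\0&1\end{pmatrix}\begin{pmatrix}p^N&x\\0&1\end{pmatrix}$ has upper right
entry $y+px$: each further power of $U_p$ adds one base $p$ digit. -/
lemma heckeU_pow (N : ℕ) (v : W) :
    (heckeU ρ ^ N) v = ∑ x : Fin (p ^ N), ρ (heckeMat N ((x : ℕ) : ℚ_[p])) v := by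
  induction N with
  | zero =>
    have : heckeMat (p := p) 0 0 = 1 := by
      apply Units.ext
      ext i j; fin_cases i <;> fin_cases j <;> simp
    rw [pow_zero, Fintype.sum_eq_single (⟨0, by simp⟩ : Fin (p ^ 0)) fun x hx => ?_]
    · simp [this]
    · have : Subsingleton (Fin (p ^ 0)) := by rw [pow_zero]; infer_instance
      exact absurd (Subsingleton.elim _ _) hx
  | succ N ih =>
    rw [pow_succ', Module.End.mul_apply, ih, map_sum]
    refine Eq.trans ?_ ((finProdFinEquiv (m := p ^ N) (n := p)).sum_comp
      (fun x : Fin (p ^ N * p) => ρ (heckeMat (N + 1) ((x : ℕ) : ℚ_[p])) v))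
    rw [Fintype.sum_prod_type]
    refine Finset.sum_congr rfl fun x _ => ?_
    rw [heckeU_apply]
    refine Finset.sum_congr rfl fun y _ => ?_
    rw [← Module.End.mul_apply, ← map_mul]
    congr 2
    apply Units.ext
    rw [Units.val_mul]
    ext i j
    fin_cases i <;> fin_cases j <;> simp [pow_succ', add_comm]

variable {ρ}

lemma CentreTrivial.scalar_mul (hρ : CentreTrivial ρ) (z : ℚ_[p]ˣ) (g : GL (Fin 2) ℚ_[p]) :
    ρ (Matrix.GeneralLinearGroup.scalar (Fin 2) z * g) = ρ g := by
  rw [map_mul, hρ, one_mul]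

lemma CentreTrivial.atkinLehner_sq (hρ : CentreTrivial ρ) (ϖ : ℚ_[p]ˣ) (v : W) :
    ρ (atkinLehner ϖ) (ρ (atkinLehner ϖ) v) = v := by
  rw [← Module.End.mul_apply, ← map_mul, SplitZeta.atkinLehner_sq, hρ]; rfl

lemma CentreTrivial.eta_inv (hρ : CentreTrivial ρ) (v : W) : ρ (eta p)⁻¹ v = ρ (eta p) v := by
  conv_lhs => rw [← hρ.atkinLehner_sq (pUnit p) v]
  rw [← Module.End.mul_apply, ← map_mul, inv_mul_cancel, map_one]; rfl

/-- The two families of representatives give $U_p^N$ and $\eta U_p^{N-1}$ with $N=2n+e$; the scalars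
act trivially. For $N=0$ the second family is empty. -/
lemma sum_sphericalRep (hρ : CentreTrivial ρ) (e : Fin 2) (n : ℕ) (v : W) :
    ∑ i, ρ (sphericalRep p e n i) v = (heckeU ρ ^ (2 * n + (e : ℕ))) v +
      if 2 * n + (e : ℕ) = 0 then 0 else ρ (eta p) ((heckeU ρ ^ (2 * n + (e : ℕ) - 1)) v) := by
  rw [Fintype.sum_sum_type]
  congr 1
  · rw [heckeU_pow]
    refine Finset.sum_congr rfl fun x _ => ?_
    rw [sphericalRep, hρ.scalar_mul]
  · have h : ∀ x : Fin (secondCard p (2 * n + (e : ℕ))), ρ (sphericalRep p e n (Sum.inr x)) v =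
        ρ (eta p) (ρ (heckeMat (2 * n + (e : ℕ) - 1) ((x : ℕ) : ℚ_[p])) v) := fun x => by
      rw [sphericalRep, map_mul, hρ.scalar_mul]; rfl
    simp_rw [h]
    rw [← Finset.sum_range fun x : ℕ =>
      ρ (eta p) (ρ (heckeMat (2 * n + (e : ℕ) - 1) (x : ℚ_[p])) v), secondCard]
    split_ifs with h0
    · simp
    · rw [heckeU_pow, map_sum, ← Finset.sum_range fun x : ℕ =>
        ρ (eta p) (ρ (heckeMat (2 * n + (e : ℕ) - 1) (x : ℚ_[p])) v)]

/-- The monomial matrices in terms of `diag(p ^ n, 1)` and the Atkin–Lehner matrix. -/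
lemma weyl_natCast (n : ℕ) : ∃ z : ℚ_[p]ˣ, weyl p n =
    Matrix.GeneralLinearGroup.scalar (Fin 2) z * (heckeMat n 0 * eta p ^ n) := by
  have hp := prime_cast_ne_zero (p := p)
  have heven : ∀ k : ℕ, (eta p ^ (2 * k) : GL (Fin 2) ℚ_[p]) =
      Matrix.GeneralLinearGroup.scalar (Fin 2) ((-pUnit p) ^ k) := fun k => by
    rw [pow_mul, pow_two, atkinLehner_sq, map_pow]
  obtain ⟨k, rfl | rfl⟩ := Nat.even_or_odd' n
  · refine ⟨((pUnit p) ^ (2 * k))⁻¹ * (-1) ^ k, ?_⟩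
    rw [heven, ← Matrix.GeneralLinearGroup.scalar_commute, ← mul_assoc, ← map_mul]
    apply Units.ext
    push_cast
    rw [coe_weyl_even, coe_scalar_eq, coe_upper, Matrix.mul_fin_two]
    have h1 : ((-1 : ℚ_[p]) ^ k) * (-1) ^ k = 1 := by rw [← mul_pow]; simp
    ext i j
    fin_cases i <;> fin_cases j <;> simp [pow_mul, neg_pow (p : ℚ_[p]), pow_two]
    · field_simp; linear_combination (-1 : ℚ_[p]) * h1
    · field_simp; linear_combination (-(p : ℚ_[p]) ^ (2 * k)) * h1
  · refine ⟨((pUnit p) ^ (2 * k + 1))⁻¹ * (-1) ^ k, ?_⟩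
    rw [pow_succ (eta p), heven, ← mul_assoc (heckeMat _ _),
      ← Matrix.GeneralLinearGroup.scalar_commute, ← mul_assoc, ← mul_assoc, ← map_mul]
    apply Units.ext
    push_cast
    rw [coe_weyl_odd, coe_scalar_eq, coe_upper, coe_atkinLehner,
      Matrix.mul_fin_two, Matrix.mul_fin_two]
    have h1 : ((-1 : ℚ_[p]) ^ k) * (-1) ^ k = 1 := by rw [← mul_pow]; simp
    ext i j
    fin_cases i <;> fin_cases j <;> simp [pow_mul, pow_succ, neg_pow (p : ℚ_[p])]
    · field_simp; linear_combination (-1 : ℚ_[p]) * h1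
    · field_simp; linear_combination (-(p : ℚ_[p]) ^ (2 * k)) * h1

lemma rho_uni_weyl (hρ : CentreTrivial ρ) (n : ℕ) (t : ℚ_[p]) (v : W) :
    ρ (uni t * weyl p n) v = ρ (heckeMat n t) ((ρ (eta p) ^ n) v) := by
  obtain ⟨z, hz⟩ := weyl_natCast (p := p) n
  rw [hz, ← mul_assoc, ← Matrix.GeneralLinearGroup.scalar_commute, mul_assoc, hρ.scalar_mul,
    ← mul_assoc, map_mul, map_pow, Module.End.mul_apply]
  congr 2
  apply Units.ext
  rw [Units.val_mul]
  ext i j; fin_cases i <;> fin_cases j <;> simp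

/-- For $n\ge0$ the double coset operator is $U_p^n\eta^{n+e}$, and for $n<0$ it is conjugated by
$\eta$. On an $\eta$-eigenvector all rightmost powers of $\eta$ become scalars. -/
lemma sum_iwahoriRep (hρ : CentreTrivial ρ) (e : Fin 2) (n : ℤ) {v : W} {ε : ℂ}
    (hv : ρ (eta p) v = ε • v) :
    ∑ x, ρ (iwahoriRep p e n x) v = if 0 ≤ n then ε ^ (n.natAbs + (e : ℕ)) • (heckeU ρ ^ n.natAbs) v
      else ε ^ (n.natAbs + (e : ℕ) + 1) • ρ (eta p) ((heckeU ρ ^ n.natAbs) v) := by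
  have hpow : ∀ k : ℕ, (ρ (eta p) ^ k) v = ε ^ k • v := fun k => by
    induction k with
    | zero => simp
    | succ k ih => rw [pow_succ, Module.End.mul_apply, hv, map_smul, ih, smul_smul, pow_succ']
  split_ifs with hn
  · obtain ⟨k, rfl⟩ := Int.eq_ofNat_of_zero_le hn
    rw [heckeU_pow, Finset.smul_sum]
    refine Finset.sum_congr rfl fun x _ => ?_
    rw [iwahoriRep, if_pos hn, map_mul, Module.End.mul_apply, map_pow, hpow, map_smul,
      rho_uni_weyl hρ, hpow, map_smul, smul_smul, ← pow_add, add_comm]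
    rfl
  · obtain ⟨k, rfl⟩ : ∃ k : ℕ, n = -k := ⟨n.natAbs, by omega⟩
    rw [heckeU_pow, map_sum, Finset.smul_sum]
    refine Finset.sum_congr rfl fun x _ => ?_
    rw [iwahoriRep, if_neg hn, neg_neg, map_mul, Module.End.mul_apply, map_pow, hpow, map_smul,
      map_mul, Module.End.mul_apply, hρ.eta_inv, hv, map_mul, map_smul, Module.End.mul_apply,
      rho_uni_weyl hρ, hpow, map_smul, map_smul, smul_smul, smul_smul, ← pow_succ, ← pow_add]
    have hk : ((-(k : ℤ)).natAbs) = k := by omega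
    simp only [hk]
    congr 2
    omega

end Representations

/-! ### Unramified characters -/

lemma IsUnramified.eq_of_norm_eq {χ : ℚ_[p]ˣ →* ℂˣ} (h : IsUnramified χ) {a b : ℚ_[p]ˣ}
    (hab : ‖(a : ℚ_[p])‖ = ‖(b : ℚ_[p])‖) : χ a = χ b := by
  have := h (a * b⁻¹) (by
    rw [Units.val_mul, norm_mul, hab, ← norm_mul, ← Units.val_mul, mul_inv_cancel, Units.val_one,
      norm_one])
  rwa [map_mul, map_inv, mul_inv_eq_one] at this

lemma IsUnramified.ext {χ χ' : ℚ_[p]ˣ →* ℂˣ} (h : IsUnramified χ) (h' : IsUnramified χ')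
    (hp : χ (pUnit p) = χ' (pUnit p)) : χ = χ' := by
  ext1 a
  obtain ⟨n, hn⟩ := exists_norm_eq_zpow a.ne_zero
  have e : ‖(a : ℚ_[p])‖ = ‖((pUnit p ^ (-n) : ℚ_[p]ˣ) : ℚ_[p])‖ := by
    rw [hn, Units.val_zpow_eq_zpow_val, coe_pUnit, Padic.norm_p_zpow, neg_neg]
  rw [h.eq_of_norm_eq e, h'.eq_of_norm_eq e, map_zpow, map_zpow, hp]

lemma coe_absChar (a : ℚ_[p]ˣ) : (absChar p a : ℂ) = (‖(a : ℚ_[p])‖ : ℝ) := rfl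

lemma isUnramified_absChar : IsUnramified (absChar p) := fun u hu =>
  Units.ext (by rw [coe_absChar, hu]; simp)

/-! ### The Iwasawa decomposition -/

/-- The matrix `(0 1; -1 0)`. -/
abbrev antidiag (p : ℕ) [Fact p.Prime] : GL (Fin 2) ℚ_[p] := atkinLehner 1

/-- The matrix `(1 0; y 1)`. -/
def lowerUni (y : ℚ_[p]) : GL (Fin 2) ℚ_[p] :=
  Matrix.GeneralLinearGroup.mkOfDetNeZero !![1, 0; y, 1] (by simp [Matrix.det_fin_two])

lemma coe_lowerUni (y : ℚ_[p]) : (lowerUni y : V p) = !![1, 0; y, 1] := rfl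

lemma lowerUni_mem {y : ℚ_[p]} {e : ℕ} (hy : ‖y‖ ≤ (p : ℝ) ^ (-(e : ℤ))) :
    lowerUni y ∈ eichlerSubgroup p e := by
  rw [mem_eichlerSubgroup, coe_lowerUni]
  have h1 : ‖y‖ ≤ 1 := hy.trans (zpow_le_one_of_nonpos₀ one_lt_prime_real.le (by simp))
  refine ⟨⟨fun i j => ?_, by simpa using hy⟩, by simp [Matrix.det_fin_two]⟩
  fin_cases i <;> fin_cases j <;> simp [h1]

lemma antidiag_mem : antidiag p ∈ eichlerSubgroup p 0 := by
  rw [mem_eichlerSubgroup_zero, coe_atkinLehner]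
  refine ⟨fun i j => ?_, by simp [Matrix.det_fin_two]⟩
  fin_cases i <;> fin_cases j <;> simp

lemma eq_upper_mul_lowerUni {g : GL (Fin 2) ℚ_[p]} (hd : (g : V p) 1 1 ≠ 0) :
    g = upper (Matrix.GeneralLinearGroup.det g / Units.mk0 _ hd) (Units.mk0 _ hd) ((g : V p) 0 1) *
      lowerUni ((g : V p) 1 0 / (g : V p) 1 1) := by
  apply Units.ext
  rw [Units.val_mul, coe_upper, coe_lowerUni]
  have := det_entries g
  ext i j
  fin_cases i <;> fin_cases j <;> simp
  · rw [this]; field_simp; ring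
  · field_simp

lemma eq_upper_mul_lowerUni_antidiag {g : GL (Fin 2) ℚ_[p]} (hc : (g : V p) 1 0 ≠ 0) :
    g = upper (Matrix.GeneralLinearGroup.det g / Units.mk0 _ (neg_ne_zero.mpr hc))
      (Units.mk0 _ (neg_ne_zero.mpr hc)) (-(g : V p) 0 0) *
      (antidiag p * uni ((g : V p) 1 1 / (g : V p) 1 0)) := by
  apply Units.ext
  rw [Units.val_mul, Units.val_mul, coe_upper, coe_upper, coe_atkinLehner]
  have := det_entries g
  ext i j
  fin_cases i <;> fin_cases j <;> simp
  · rw [this]; field_simp; ring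
  · field_simp

lemma bottom_mul (g h : GL (Fin 2) ℚ_[p]) (j : Fin 2) : ((g * h : GL (Fin 2) ℚ_[p]) : V p) 1 j =
    (g : V p) 1 0 * (h : V p) 0 j + (g : V p) 1 1 * (h : V p) 1 j := by
  rw [Units.val_mul, Matrix.mul_apply, Fin.sum_univ_two]

lemma bottom_ne_zero (g : GL (Fin 2) ℚ_[p]) : (g : V p) 1 0 ≠ 0 ∨ (g : V p) 1 1 ≠ 0 := by
  by_contra! h
  have := g.det_ne_zero
  rw [Matrix.det_fin_two, h.1, h.2] at this
  simp at this

/-- The unique `x < p` with `‖c x + d‖ < ‖c‖`, for `‖d‖ ≤ ‖c‖`. -/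
lemma exists_unique_residue {c d : ℚ_[p]} (hc : c ≠ 0) (hd : ‖d‖ ≤ ‖c‖) :
    ∃ x₀ : Fin p, ‖c * ((x₀ : ℕ) : ℚ_[p]) + d‖ ≤ ‖(p : ℚ_[p]) * c‖ ∧
      ∀ x : Fin p, x ≠ x₀ → ‖c * ((x : ℕ) : ℚ_[p]) + d‖ = ‖c‖ := by
  have hc' : 0 < ‖c‖ := norm_pos_iff.mpr hc
  obtain ⟨x₀, hx₀, hx⟩ := exists_nat_approx (p := p) (t := -d / c) (by
    rw [norm_div, norm_neg]; exact div_le_one_of_le₀ hd hc'.le) 1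
  rw [pow_one] at hx₀
  have hfac : ∀ x : ℕ, c * (x : ℚ_[p]) + d = -c * (-d / c - x) := fun x => by field_simp; ring
  refine ⟨⟨x₀, hx₀⟩, ?_, fun x hne => le_antisymm ?_ ?_⟩
  · rw [hfac, norm_mul, norm_neg, norm_mul, Padic.norm_p, mul_comm]
    simpa using mul_le_mul_of_nonneg_right hx hc'.le
  · refine padic_norm_add_le ?_ hd
    rw [norm_mul]
    exact mul_le_of_le_one_right hc'.le (norm_natCast_le_one _)
  · by_contra! hlt
    apply hne
    have h1 := prime_mul_norm_le_of_lt hlt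
    rw [hfac, norm_mul, norm_neg, ← mul_assoc, mul_comm (p : ℝ), mul_assoc] at h1
    have h2 : (p : ℝ) * ‖-d / c - (x : ℕ)‖ ≤ 1 := le_of_mul_le_mul_left (by simpa using h1) hc'
    have h3 : ‖-d / c - (x : ℕ)‖ ≤ (p : ℝ) ^ (-((1 : ℕ) : ℤ)) := by
      rw [Nat.cast_one, zpow_neg_one, ← one_div]
      exact (le_div_iff₀' prime_real_pos).mpr h2
    refine Fin.ext (nat_eq_of_norm_sub_le (p := p) (N := 1) (by simp) (by simpa using hx₀) ?_)
    have := padic_norm_sub_le hx h3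
    simpa using this

/-! ### Spherical vectors of principal series -/

/-- The norms of $a$ and $d$ are forced: the norm of the bottom row is unchanged by $k$, and the
determinant gives the other one. -/
lemma exists_iwasawa (g : GL (Fin 2) ℚ_[p]) : ∃ (a d : ℚ_[p]ˣ) (x : ℚ_[p]),
    ∃ k ∈ eichlerSubgroup p 0, g = upper a d x * k ∧
      ‖(d : ℚ_[p])‖ = max ‖(g : V p) 1 0‖ ‖(g : V p) 1 1‖ ∧
      ‖(a : ℚ_[p])‖ * ‖(d : ℚ_[p])‖ = ‖(g : V p).det‖ := by
  have hdet : ‖((Matrix.GeneralLinearGroup.det g : ℚ_[p]ˣ) : ℚ_[p])‖ = ‖(g : V p).det‖ := rfl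
  rcases le_total ‖(g : V p) 1 0‖ ‖(g : V p) 1 1‖ with h | h
  · have hd : (g : V p) 1 1 ≠ 0 := by
      rcases bottom_ne_zero g with h0 | h0
      · exact norm_pos_iff.mp ((norm_pos_iff.mpr h0).trans_le h)
      · exact h0
    refine ⟨_, _, _, _, lowerUni_mem (e := 0) ?_, eq_upper_mul_lowerUni hd, ?_, ?_⟩
    · rw [norm_div]; simpa using div_le_one_of_le₀ h (norm_nonneg _)
    · rw [max_eq_right h]; rfl
    · rw [← norm_mul, ← Units.val_mul, div_mul_cancel, hdet]
  · have hc : (g : V p) 1 0 ≠ 0 := by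
      rcases bottom_ne_zero g with h0 | h0
      · exact h0
      · exact norm_pos_iff.mp ((norm_pos_iff.mpr h0).trans_le h)
    refine ⟨_, _, _, _, mul_mem antidiag_mem (uni_mem ?_ 0), eq_upper_mul_lowerUni_antidiag hc,
      ?_, ?_⟩
    · rw [norm_div]; exact div_le_one_of_le₀ h (norm_nonneg _)
    · rw [max_eq_left h, Units.val_mk0, norm_neg]
    · rw [← norm_mul, ← Units.val_mul, div_mul_cancel, hdet]

section Spherical

variable {μ ν : ℚ_[p]ˣ →* ℂˣ} {φ : GL (Fin 2) ℚ_[p] → ℂ}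

/-- By the Iwasawa decomposition, a spherical function of unramified characters sees only the norms
of the determinant and of the bottom row. -/
lemma spherical_congr (hμ : IsUnramified μ) (hν : IsUnramified ν) (hφ : φ ∈ inducedSpace μ ν)
    (hK : ∀ k ∈ eichlerSubgroup p 0, ∀ g, φ (g * k) = φ g) {g g' : GL (Fin 2) ℚ_[p]}
    (hdet : ‖(g : V p).det‖ = ‖(g' : V p).det‖)
    (hmax : max ‖(g : V p) 1 0‖ ‖(g : V p) 1 1‖ = max ‖(g' : V p) 1 0‖ ‖(g' : V p) 1 1‖) :
    φ g = φ g' := by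
  obtain ⟨a, d, x, k, hk, hg, hd, ha⟩ := exists_iwasawa g
  obtain ⟨a', d', x', k', hk', hg', hd', ha'⟩ := exists_iwasawa g'
  have h1 : ‖(d : ℚ_[p])‖ = ‖(d' : ℚ_[p])‖ := by rw [hd, hd', hmax]
  have h2 : ‖(a : ℚ_[p])‖ = ‖(a' : ℚ_[p])‖ := by
    have : ‖(d' : ℚ_[p])‖ ≠ 0 := norm_ne_zero_iff.mpr d'.ne_zero
    apply mul_right_cancel₀ this
    rw [ha', ← hdet, ← ha, h1]
  rw [hg, hg', hK k hk, hK k' hk', ← mul_one (upper a d x), ← mul_one (upper a' d' x'), hφ.2, hφ.2,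
    hμ.eq_of_norm_eq h2, hν.eq_of_norm_eq h1, h1, h2]

/-- The Hecke relation for spherical functions. -/
lemma spherical_hecke (hμ : IsUnramified μ) (hν : IsUnramified ν) (hφ : φ ∈ inducedSpace μ ν)
    (hK : ∀ k ∈ eichlerSubgroup p 0, ∀ g, φ (g * k) = φ g) (g : GL (Fin 2) ℚ_[p]) :
    ∑ x : Fin p, φ (g * heckeMat 1 ((x : ℕ) : ℚ_[p])) + φ (g * eta p) =
      (Real.sqrt p : ℂ) * ((μ (pUnit p) : ℂ) + (ν (pUnit p) : ℂ)) * φ g := by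
  have hp := prime_real_pos (p := p)
  -- $A$ and $D$ are the values at $\mathrm{diag}(p,1)g$ and $\mathrm{diag}(1,p)g$. Each of the
  -- $p+1$ translates has the determinant and bottom row norms of one of these, and $A$ occurs $p$
  -- times.
  set A := (μ (pUnit p) : ℂ) * ((Real.sqrt p : ℂ)⁻¹) * φ g with hA
  set D := (ν (pUnit p) : ℂ) * (Real.sqrt p : ℂ) * φ g with hD
  have hA' : φ (upper (pUnit p) 1 0 * g) = A := by
    rw [hφ.2, hA]; simp
  have hD' : φ (upper 1 (pUnit p) 0 * g) = D := by
    rw [hφ.2, hD]; simp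
  have hb : ∀ x : ℚ_[p], ((g * heckeMat 1 x : GL (Fin 2) ℚ_[p]) : V p) 1 0 = p * (g : V p) 1 0 ∧
      ((g * heckeMat 1 x : GL (Fin 2) ℚ_[p]) : V p) 1 1 = (g : V p) 1 0 * x + (g : V p) 1 1 :=
    fun x => by constructor <;> rw [bottom_mul] <;> simp [mul_comm]
  have hbe : ((g * eta p : GL (Fin 2) ℚ_[p]) : V p) 1 0 = -(p * (g : V p) 1 1) ∧
      ((g * eta p : GL (Fin 2) ℚ_[p]) : V p) 1 1 = (g : V p) 1 0 := by
    constructor <;> rw [bottom_mul] <;> simp [mul_comm]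
  have hbA : ((upper (pUnit p) 1 0 * g : GL (Fin 2) ℚ_[p]) : V p) 1 0 = (g : V p) 1 0 ∧
      ((upper (pUnit p) 1 0 * g : GL (Fin 2) ℚ_[p]) : V p) 1 1 = (g : V p) 1 1 := by
    constructor <;> rw [bottom_mul] <;> simp
  have hbD : ((upper 1 (pUnit p) 0 * g : GL (Fin 2) ℚ_[p]) : V p) 1 0 = p * (g : V p) 1 0 ∧
      ((upper 1 (pUnit p) 0 * g : GL (Fin 2) ℚ_[p]) : V p) 1 1 = p * (g : V p) 1 1 := by
    constructor <;> rw [bottom_mul] <;> simp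
  have hdx : ∀ x, ((g * heckeMat 1 x : GL (Fin 2) ℚ_[p]) : V p).det = (g : V p).det * p := fun x => by
    rw [Units.val_mul, Matrix.det_mul]; simp [Matrix.det_fin_two]
  have hde : ((g * eta p : GL (Fin 2) ℚ_[p]) : V p).det = (g : V p).det * p := by
    rw [Units.val_mul, Matrix.det_mul, det_atkinLehner, coe_pUnit]
  have hdA : ((upper (pUnit p) 1 0 * g : GL (Fin 2) ℚ_[p]) : V p).det = (g : V p).det * p := by
    rw [Units.val_mul, Matrix.det_mul, mul_comm]; simp [Matrix.det_fin_two]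
  have hdD : ((upper 1 (pUnit p) 0 * g : GL (Fin 2) ℚ_[p]) : V p).det = (g : V p).det * p := by
    rw [Units.val_mul, Matrix.det_mul, mul_comm]; simp [Matrix.det_fin_two]
  have hpn : ∀ z : ℚ_[p], ‖(p : ℚ_[p]) * z‖ ≤ ‖z‖ := fun z => by
    rw [norm_mul]
    exact mul_le_of_le_one_left (norm_nonneg _) (norm_natCast_le_one p)
  have htotal : (p : ℂ) * A + D =
      (Real.sqrt p : ℂ) * ((μ (pUnit p) : ℂ) + (ν (pUnit p) : ℂ)) * φ g := by
    have h2 : (p : ℂ) = (Real.sqrt p : ℂ) * (Real.sqrt p : ℂ) := by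
      rw [← Complex.ofReal_mul, Real.mul_self_sqrt hp.le, Complex.ofReal_natCast]
    have h3 : (Real.sqrt p : ℂ) ≠ 0 := Complex.ofReal_ne_zero.mpr (Real.sqrt_pos.mpr hp).ne'
    rw [hA, hD, h2]
    field_simp
  rw [← htotal]
  -- If $\|d\|\le\|c\|$, the single value $D$ comes from the residue $x_0$ with $cx_0+d$ small;
  -- otherwise it comes from $\eta$.
  by_cases hcd : ‖(g : V p) 1 1‖ ≤ ‖(g : V p) 1 0‖
  · have hc : (g : V p) 1 0 ≠ 0 := by
      rcases bottom_ne_zero g with h0 | h0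
      · exact h0
      · exact norm_pos_iff.mp ((norm_pos_iff.mpr h0).trans_le hcd)
    obtain ⟨x₀, hx₀, hx⟩ := exists_unique_residue hc hcd
    rw [← Finset.add_sum_erase _ _ (Finset.mem_univ x₀)]
    have e1 : φ (g * heckeMat 1 ((x₀ : ℕ) : ℚ_[p])) = D := by
      rw [← hD']
      refine spherical_congr hμ hν hφ hK (by rw [hdx, hdD]) ?_
      rw [(hb _).1, (hb _).2, hbD.1, hbD.2, max_eq_left hx₀, max_eq_left]
      rw [norm_mul, norm_mul]
      exact mul_le_mul_of_nonneg_left hcd (norm_nonneg _)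
    have e2 : ∀ x ∈ Finset.univ.erase x₀, φ (g * heckeMat 1 ((x : ℕ) : ℚ_[p])) = A := fun x hx' => by
      rw [← hA']
      refine spherical_congr hμ hν hφ hK (by rw [hdx, hdA]) ?_
      rw [(hb _).1, (hb _).2, hbA.1, hbA.2, hx x (Finset.ne_of_mem_erase hx'), max_eq_left hcd,
        max_eq_right (hpn _)]
    have e3 : φ (g * eta p) = A := by
      rw [← hA']
      refine spherical_congr hμ hν hφ hK (by rw [hde, hdA]) ?_
      rw [hbe.1, hbe.2, hbA.1, hbA.2, norm_neg, max_eq_left hcd, max_eq_right ((hpn _).trans hcd)]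
    rw [Finset.sum_congr rfl e2, e1, e3, Finset.sum_const, Finset.card_erase_of_mem
      (Finset.mem_univ _), Finset.card_univ, Fintype.card_fin, nsmul_eq_mul,
      Nat.cast_sub (Fact.out : p.Prime).one_le]
    push_cast
    ring
  · push Not at hcd
    have e2 : ∀ x : Fin p, φ (g * heckeMat 1 ((x : ℕ) : ℚ_[p])) = A := fun x => by
      rw [← hA']
      refine spherical_congr hμ hν hφ hK (by rw [hdx, hdA]) ?_
      have hlt : ‖(g : V p) 1 0 * ((x : ℕ) : ℚ_[p])‖ < ‖(g : V p) 1 1‖ := by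
        rw [norm_mul]
        exact (mul_le_of_le_one_right (norm_nonneg _) (norm_natCast_le_one _)).trans_lt hcd
      rw [(hb _).1, (hb _).2, hbA.1, hbA.2, IsUltrametricDist.norm_add_eq_max_of_norm_ne_norm hlt.ne,
        max_eq_right hlt.le, max_eq_right hcd.le, max_eq_right ((hpn _).trans hcd.le)]
    have e3 : φ (g * eta p) = D := by
      rw [← hD']
      refine spherical_congr hμ hν hφ hK (by rw [hde, hdD]) ?_
      rw [hbe.1, hbe.2, hbD.1, hbD.2, norm_neg]
      have h1 : ‖(g : V p) 1 0‖ ≤ ‖(p : ℚ_[p]) * (g : V p) 1 1‖ := by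
        rw [norm_mul, Padic.norm_p, le_inv_mul_iff₀ hp]
        exact prime_mul_norm_le_of_lt hcd
      rw [max_eq_left h1, max_eq_right ((hpn _).trans h1)]
    simp [e2, e3]

end Spherical

/-! ### Iwahori-fixed vectors of special representations -/

section Special

variable {χ : ℚ_[p]ˣ →* ℂˣ} {φ : GL (Fin 2) ℚ_[p] → ℂ}

lemma det_upper (a d : ℚ_[p]ˣ) (x : ℚ_[p]) :
    Matrix.GeneralLinearGroup.det (upper a d x) = a * d := by
  ext
  simp [Matrix.GeneralLinearGroup.val_det_apply, Matrix.det_fin_two]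

/-- The factors $|\cdot|^{\mp1/2}$ cancel the normalisation of the induction. -/
lemma special_upper (hφ : φ ∈ inducedSpace (χ * (sqrtAbsChar p)⁻¹) (χ * sqrtAbsChar p))
    (a d : ℚ_[p]ˣ) (x : ℚ_[p]) (g : GL (Fin 2) ℚ_[p]) :
    φ (upper a d x * g) = (χ (a * d) : ℂ) * φ g := by
  have h : ∀ b : ℚ_[p]ˣ, (sqrtAbsChar p b : ℂ) = (Real.sqrt ‖(b : ℚ_[p])‖ : ℝ) := fun _ => rfl
  have h0 : ∀ b : ℚ_[p]ˣ, ((Real.sqrt ‖(b : ℚ_[p])‖ : ℝ) : ℂ) ≠ 0 := fun b => by simp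
  rw [hφ.2, Real.sqrt_div (norm_nonneg _)]
  simp only [MonoidHom.mul_apply, MonoidHom.inv_apply, Units.val_mul, Units.val_inv_eq_inv_val, h,
    map_mul, Complex.ofReal_div]
  have := h0 a
  have := h0 d
  field_simp

lemma norm_det_of_mem {e : ℕ} {k : GL (Fin 2) ℚ_[p]} (hk : k ∈ eichlerSubgroup p e) :
    ‖((Matrix.GeneralLinearGroup.det k : ℚ_[p]ˣ) : ℚ_[p])‖ = 1 :=
  (mem_eichlerSubgroup.mp hk).2

/-- The bottom row modulo $p$ is a point of $\mathbf P^1(\mathbf F_p)$, on which the Iwahori group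
has two orbits. So an invariant function is determined by its values at $1$ and `antidiag`. -/
lemma special_value (hφ : φ ∈ inducedSpace (χ * (sqrtAbsChar p)⁻¹) (χ * sqrtAbsChar p))
    (hI : ∀ k ∈ eichlerSubgroup p 1, ∀ g, φ (g * k) = φ g) (g : GL (Fin 2) ℚ_[p]) :
    (‖(g : V p) 1 0‖ < ‖(g : V p) 1 1‖ →
      φ g = (χ (Matrix.GeneralLinearGroup.det g) : ℂ) * φ 1) ∧
    (‖(g : V p) 1 1‖ ≤ ‖(g : V p) 1 0‖ →
      φ g = (χ (Matrix.GeneralLinearGroup.det g) : ℂ) * φ (antidiag p)) := by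
  constructor
  · intro h
    have hd : (g : V p) 1 1 ≠ 0 := norm_pos_iff.mp ((norm_nonneg _).trans_lt h)
    have hk : lowerUni ((g : V p) 1 0 / (g : V p) 1 1) ∈ eichlerSubgroup p 1 := by
      refine lowerUni_mem ?_
      have := prime_mul_norm_le_of_lt h
      rw [norm_div, Nat.cast_one, zpow_neg_one, div_le_iff₀ (norm_pos_iff.mpr hd),
        le_inv_mul_iff₀ prime_real_pos]
      exact this
    conv_lhs => rw [eq_upper_mul_lowerUni hd]
    rw [hI _ hk, ← mul_one (upper _ _ _), special_upper hφ, div_mul_cancel]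
  · intro h
    have hc : (g : V p) 1 0 ≠ 0 := by
      rcases bottom_ne_zero g with h0 | h0
      · exact h0
      · exact norm_pos_iff.mp ((norm_pos_iff.mpr h0).trans_le h)
    have hk : uni ((g : V p) 1 1 / (g : V p) 1 0) ∈ eichlerSubgroup p 1 := by
      refine uni_mem ?_ 1
      rw [norm_div]; exact div_le_one_of_le₀ h (norm_nonneg _)
    conv_lhs => rw [eq_upper_mul_lowerUni_antidiag hc]
    rw [← mul_assoc, hI _ hk, special_upper hφ, div_mul_cancel]

/-- A function whose class in the special representation is invariant under the Iwahori subgroup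
is itself invariant. -/
lemma iwahori_invariant_of_class (hχ : IsUnramified χ)
    (hφ : φ ∈ inducedSpace (χ * (sqrtAbsChar p)⁻¹) (χ * sqrtAbsChar p))
    {k : GL (Fin 2) ℚ_[p]} (hk : k ∈ eichlerSubgroup p 1) {C : ℂ}
    (hC : ∀ g, φ (g * k) - φ g = C * (χ (Matrix.GeneralLinearGroup.det g) : ℂ)) :
    ∀ g, φ (g * k) = φ g := by
  obtain ⟨U, hU, hinv⟩ := hφ.1
  have hcont : Continuous φ := by
    refine IsLocallyConstant.continuous ((IsLocallyConstant.iff_exists_open φ).mpr fun g => ?_)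
    refine ⟨(fun h => g⁻¹ * h) ⁻¹' U, hU.preimage (continuous_const_mul _), by simp, ?_⟩
    intro h hh
    have := hinv _ hh g
    rwa [mul_inv_cancel_left] at this
  obtain ⟨M, hM⟩ := (isCompact_eichlerSubgroup (p := p) 1).exists_bound_of_continuousOn
    hcont.continuousOn
  -- Iterating makes $\varphi(k^n)$ grow linearly with slope $C$, while $\varphi$ is continuous and
  -- hence bounded on the compact Iwahori group.
  have hpow : ∀ n : ℕ, φ (k ^ n) = φ 1 + n * C := fun n => by
    induction n with
    | zero => simp
    | succ n ih =>
      have h1 := hC (k ^ n)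
      rw [map_pow, map_pow, hχ _ (norm_det_of_mem hk), one_pow, Units.val_one, mul_one,
        ← pow_succ] at h1
      rw [sub_eq_iff_eq_add.mp h1, ih]
      push_cast
      ring
  have hC0 : C = 0 := by
    by_contra hne
    obtain ⟨n, hn⟩ := exists_nat_gt ((2 * M) / ‖C‖)
    rw [div_lt_iff₀ (norm_pos_iff.mpr hne)] at hn
    have h1 := hM _ (pow_mem hk n)
    have h2 := hM 1 (one_mem _)
    have h3 : (n : ℂ) * C = φ (k ^ n) - φ 1 := by rw [hpow]; ring
    have h4 : (n : ℝ) * ‖C‖ ≤ ‖φ (k ^ n)‖ + ‖φ 1‖ := by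
      rw [← Complex.norm_natCast, ← norm_mul, h3]; exact norm_sub_le _ _
    linarith
  intro g
  have := hC g
  rw [hC0, zero_mul] at this
  exact sub_eq_zero.mp this

/-- Summing over the $p+1$ cosets of the Iwahori group in $\mathrm{GL}_2(\mathbf Z_p)$ yields a
spherical function, which is a multiple of $\chi\circ\det$ and so dies in the special
representation. -/
lemma special_hecke (hφ : φ ∈ inducedSpace (χ * (sqrtAbsChar p)⁻¹) (χ * sqrtAbsChar p))
    (hI : ∀ k ∈ eichlerSubgroup p 1, ∀ g, φ (g * k) = φ g) (g : GL (Fin 2) ℚ_[p]) :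
    φ g + ∑ x : Fin p, φ (g * (uni ((x : ℕ) : ℚ_[p]) * antidiag p)) =
      (φ 1 + p * φ (antidiag p)) * (χ (Matrix.GeneralLinearGroup.det g) : ℂ) := by
  have hb : ∀ x : ℚ_[p], ((g * (uni x * antidiag p) : GL (Fin 2) ℚ_[p]) : V p) 1 0 =
      -((g : V p) 1 0 * x + (g : V p) 1 1) ∧
      ((g * (uni x * antidiag p) : GL (Fin 2) ℚ_[p]) : V p) 1 1 = (g : V p) 1 0 := fun x => by
    constructor <;> rw [bottom_mul, Units.val_mul] <;> simp [add_comm]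
  have hdet : ∀ x : ℚ_[p], Matrix.GeneralLinearGroup.det (g * (uni x * antidiag p)) =
      Matrix.GeneralLinearGroup.det g := fun x => by
    rw [map_mul, map_mul, det_upper]
    have : Matrix.GeneralLinearGroup.det (antidiag p) = 1 := by
      ext; exact det_atkinLehner 1
    rw [this, mul_one, mul_one, mul_one]
  set X := (χ (Matrix.GeneralLinearGroup.det g) : ℂ) with hX
  by_cases hcd : ‖(g : V p) 1 1‖ ≤ ‖(g : V p) 1 0‖
  · have hc : (g : V p) 1 0 ≠ 0 := by
      rcases bottom_ne_zero g with h0 | h0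
      · exact h0
      · exact norm_pos_iff.mp ((norm_pos_iff.mpr h0).trans_le hcd)
    obtain ⟨x₀, hx₀, hx⟩ := exists_unique_residue hc hcd
    rw [← Finset.add_sum_erase _ _ (Finset.mem_univ x₀)]
    have e1 : φ (g * (uni ((x₀ : ℕ) : ℚ_[p]) * antidiag p)) = X * φ 1 := by
      rw [(special_value hφ hI _).1, hdet]
      rw [(hb _).1, (hb _).2, norm_neg]
      refine hx₀.trans_lt ?_
      rw [norm_mul, Padic.norm_p]
      exact mul_lt_of_lt_one_left (norm_pos_iff.mpr hc) (inv_lt_one_of_one_lt₀ one_lt_prime_real)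
    have e2 : ∀ x ∈ Finset.univ.erase x₀, φ (g * (uni ((x : ℕ) : ℚ_[p]) * antidiag p)) =
        X * φ (antidiag p) := fun x hx' => by
      rw [(special_value hφ hI _).2, hdet]
      rw [(hb _).1, (hb _).2, norm_neg, hx x (Finset.ne_of_mem_erase hx')]
    rw [Finset.sum_congr rfl e2, e1, (special_value hφ hI g).2 hcd, Finset.sum_const,
      Finset.card_erase_of_mem (Finset.mem_univ _), Finset.card_univ, Fintype.card_fin,
      nsmul_eq_mul, Nat.cast_sub (Fact.out : p.Prime).one_le]
    push_cast
    ring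
  · push Not at hcd
    have e2 : ∀ x : Fin p, φ (g * (uni ((x : ℕ) : ℚ_[p]) * antidiag p)) =
        X * φ (antidiag p) := fun x => by
      have hlt : ‖(g : V p) 1 0 * ((x : ℕ) : ℚ_[p])‖ < ‖(g : V p) 1 1‖ := by
        rw [norm_mul]
        exact (mul_le_of_le_one_right (norm_nonneg _) (norm_natCast_le_one _)).trans_lt hcd
      rw [(special_value hφ hI _).2, hdet]
      rw [(hb _).1, (hb _).2, norm_neg, IsUltrametricDist.norm_add_eq_max_of_norm_ne_norm hlt.ne,
        max_eq_right hlt.le]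
      exact hcd.le
    rw [(special_value hφ hI g).1 hcd]
    simp only [e2, Finset.sum_const, Finset.card_univ, Fintype.card_fin, nsmul_eq_mul]
    ring

/-- Translation by $\eta$ exchanges the two orbits up to $\chi(p)$. The difference of the two values
is the coordinate that survives modulo $\chi\circ\det$. -/
lemma special_eta (hφ : φ ∈ inducedSpace (χ * (sqrtAbsChar p)⁻¹) (χ * sqrtAbsChar p))
    (hI : ∀ k ∈ eichlerSubgroup p 1, ∀ g, φ (g * k) = φ g) :
    φ (1 * eta p) - φ (antidiag p * eta p) =
      -(χ (pUnit p) : ℂ) * (φ 1 - φ (antidiag p)) := by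
  have hd : Matrix.GeneralLinearGroup.det (eta p) = pUnit p := by
    ext; exact det_atkinLehner _
  have hd1 : Matrix.GeneralLinearGroup.det (antidiag p) = 1 := by
    ext; exact det_atkinLehner _
  rw [(special_value hφ hI (1 * eta p)).2, (special_value hφ hI (antidiag p * eta p)).1]
  · simp only [map_mul, hd, hd1, one_mul]
    ring
  · rw [bottom_mul, bottom_mul]; simp
  · rw [bottom_mul, bottom_mul]; simp

end Special

/-! ### Hecke and Atkin–Lehner eigenvalues of new vectors. -/

section NewVectors

variable {W : Type*} [AddCommGroup W] [Module ℂ W] {π : Representation ℂ PGL(2, ℚ_[p]) W}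

/-- `U_p η f = p f` for `f` invariant under the maximal compact subgroup. -/
lemma heckeU_eta {ρ : Representation ℂ (GL (Fin 2) ℚ_[p]) W} (hρ : CentreTrivial ρ) {f : W}
    (hf : ∀ k ∈ eichlerSubgroup p 0, ρ k f = f) : heckeU ρ (ρ (eta p) f) = (p : ℂ) • f := by
  have h : ∀ x : ℚ_[p], heckeMat 1 x * eta p =
      Matrix.GeneralLinearGroup.scalar (Fin 2) (pUnit p) * (uni x * antidiag p) := fun x => by
    apply Units.ext
    rw [Units.val_mul, Units.val_mul, Units.val_mul, coe_scalar_eq]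
    ext i j; fin_cases i <;> fin_cases j <;> simp [mul_comm]
  rw [heckeU_apply]
  have h2 : ∀ x : Fin p, ρ (heckeMat 1 ((x : ℕ) : ℚ_[p])) (ρ (eta p) f) = f := fun x => by
    rw [← Module.End.mul_apply, ← map_mul, h, hρ.scalar_mul]
    exact hf _ (mul_mem (uni_mem (norm_natCast_le_one _) 0) antidiag_mem)
  simp [h2, Nat.cast_smul_eq_nsmul]

lemma principal_central_character {μ ν : ℚ_[p]ˣ →* ℂˣ} (h : HasType π (.principal μ ν)) {f : W}
    (hf : f ≠ 0) (z : ℚ_[p]ˣ) : (μ z : ℂ) * (ν z : ℂ) = 1 := by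
  obtain ⟨-, -, -, -, ⟨Φ⟩⟩ := h
  have he : ∀ g v, Φ.toLinearEquiv (glRep π g v) = inducedRep μ ν g (Φ.toLinearEquiv v) :=
    fun g v => LinearMap.congr_fun (Φ.isIntertwining' g) v
  set φ := Φ.toLinearEquiv f with hφ
  have hne : φ ≠ 0 := by rw [hφ]; exact (LinearEquiv.map_ne_zero_iff _).mpr hf
  obtain ⟨g, hg⟩ : ∃ g, (φ : GL (Fin 2) ℚ_[p] → ℂ) g ≠ 0 := by
    by_contra! h0
    exact hne (Subtype.ext (funext h0))
  have h1 := he (Matrix.GeneralLinearGroup.scalar (Fin 2) z) f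
  rw [centreTrivial_glRep] at h1
  have h2 := congrFun (congrArg Subtype.val h1) g
  change (φ : GL (Fin 2) ℚ_[p] → ℂ) g =
    (φ : GL (Fin 2) ℚ_[p] → ℂ) (g * Matrix.GeneralLinearGroup.scalar (Fin 2) z) at h2
  have h3 : Matrix.GeneralLinearGroup.scalar (Fin 2) z = upper z z 0 := by
    apply Units.ext; rw [coe_scalar_eq, coe_upper]
  rw [← Matrix.GeneralLinearGroup.scalar_commute, h3, φ.2.2] at h2
  rw [div_self (norm_ne_zero_iff.mpr z.ne_zero), Real.sqrt_one, Complex.ofReal_one, mul_one] at h2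
  exact mul_right_cancel₀ hg (by rw [one_mul, ← h2])

lemma principal_heckeU {μ ν : ℚ_[p]ˣ →* ℂˣ} (h : HasType π (.principal μ ν)) {f : W}
    (hf : ∀ k ∈ eichlerSubgroup p 0, glRep π k f = f) :
    heckeU (glRep π) f + glRep π (eta p) f =
      ((Real.sqrt p : ℂ) * ((μ (pUnit p) : ℂ) + (ν (pUnit p) : ℂ))) • f := by
  obtain ⟨hμ, hν, -, -, ⟨Φ⟩⟩ := h
  have he : ∀ g v, Φ.toLinearEquiv (glRep π g v) = inducedRep μ ν g (Φ.toLinearEquiv v) :=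
    fun g v => LinearMap.congr_fun (Φ.isIntertwining' g) v
  set φ := Φ.toLinearEquiv f with hφ
  have hK : ∀ k ∈ eichlerSubgroup p 0, ∀ g, (φ : GL (Fin 2) ℚ_[p] → ℂ) (g * k) =
      (φ : GL (Fin 2) ℚ_[p] → ℂ) g := fun k hk g => by
    have h1 := he k f
    rw [hf k hk] at h1
    exact (congrFun (congrArg Subtype.val h1) g).symm
  apply Φ.toLinearEquiv.injective
  rw [map_add, heckeU_apply, map_sum, map_smul]
  simp_rw [he]
  rw [← hφ]
  ext g
  rw [Submodule.coe_add, Submodule.coe_sum, Pi.add_apply, Finset.sum_apply]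
  exact spherical_hecke hμ hν φ.2 hK g

/-- The Atkin–Lehner matrices of all uniformizers act in the same way on vectors fixed by the
Iwahori subgroup. -/
lemma atkinLehner_apply {ρ : Representation ℂ (GL (Fin 2) ℚ_[p]) W} {f : W}
    (hf : ∀ k ∈ eichlerSubgroup p 1, ρ k f = f) {ϖ : ℚ_[p]ˣ} (hϖ : ‖(ϖ : ℚ_[p])‖ = (p : ℝ)⁻¹) :
    ρ (atkinLehner ϖ) f = ρ (eta p) f := by
  have h : atkinLehner ϖ = eta p * upper (ϖ / pUnit p) 1 0 := by
    apply Units.ext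
    have := prime_cast_ne_zero (p := p)
    rw [Units.val_mul]
    ext i j; fin_cases i <;> fin_cases j <;> simp
    field_simp
  have hu : ‖(ϖ : ℚ_[p]) / p‖ = 1 := by
    rw [norm_div, hϖ, Padic.norm_p]
    exact div_self (inv_ne_zero prime_real_pos.ne')
  rw [h, map_mul, Module.End.mul_apply, hf]
  rw [mem_eichlerSubgroup, coe_upper]
  refine ⟨⟨fun i j => ?_, by simp⟩, by simpa [Matrix.det_fin_two] using hu⟩
  fin_cases i <;> fin_cases j <;> simp
  simpa using hu.le

/-- $\eta^2$ is scalar, so $\varepsilon^2=1$. Lifting the vector to an Iwahori-invariant function,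
`special_eta` identifies $\varepsilon$ with $-\chi(p)$, and the vanishing of the sum over Iwahori
cosets says $U_p\eta f=-f$. -/
lemma special_newVector {χ : ℚ_[p]ˣ →* ℂˣ} (h : HasType π (.special χ)) {f : W} (hf0 : f ≠ 0)
    (hf : ∀ k ∈ eichlerSubgroup p 1, glRep π k f = f) {ε : ℂ}
    (hε : glRep π (eta p) f = ε • f) :
    ε * ε = 1 ∧ (χ (pUnit p) : ℂ) = -ε ∧ heckeU (glRep π) f = -ε • f := by
  have hε2 : ε * ε = 1 := by
    have h1 := (centreTrivial_glRep π).atkinLehner_sq (pUnit p) f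
    rw [hε, map_smul, hε, smul_smul] at h1
    by_contra hne
    have h2 : (ε * ε - 1) • f = 0 := by rw [sub_smul, h1, one_smul, sub_self]
    exact (smul_eq_zero.mp h2).elim (fun h => hne (sub_eq_zero.mp h)) hf0
  obtain ⟨hχ, ⟨Φ⟩⟩ := h
  have he : ∀ g v, Φ.toLinearEquiv (glRep π g v) = specialRep χ g (Φ.toLinearEquiv v) :=
    fun g v => LinearMap.congr_fun (Φ.isIntertwining' g) v
  obtain ⟨φ, hφ⟩ := Submodule.Quotient.mk_surjective _ (Φ.toLinearEquiv f)
  have he' : ∀ g, Φ.toLinearEquiv (glRep π g f) = Submodule.Quotient.mk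
      (inducedRep (χ * (sqrtAbsChar p)⁻¹) (χ * sqrtAbsChar p) g φ) := fun g => by
    rw [he, ← hφ]; rfl
  have hI : ∀ k ∈ eichlerSubgroup p 1, ∀ g, (φ : GL (Fin 2) ℚ_[p] → ℂ) (g * k) =
      (φ : GL (Fin 2) ℚ_[p] → ℂ) g := fun k hk => by
    have h1 := he' k
    rw [hf k hk, ← hφ, eq_comm, Submodule.Quotient.eq] at h1
    obtain ⟨C, hC⟩ := h1
    exact iwahori_invariant_of_class hχ φ.2 hk hC
  -- If the values on both orbits agreed, the function would be a multiple of $\chi\circ\det$ and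
  -- $f$ would be zero.
  have hΔ : (φ : GL (Fin 2) ℚ_[p] → ℂ) 1 - (φ : GL (Fin 2) ℚ_[p] → ℂ) (antidiag p) ≠ 0 := by
    intro h0
    apply hf0
    apply Φ.toLinearEquiv.injective
    rw [map_zero, ← hφ, Submodule.Quotient.mk_eq_zero]
    refine ⟨(φ : GL (Fin 2) ℚ_[p] → ℂ) 1, fun g => ?_⟩
    rcases lt_or_ge ‖(g : V p) 1 0‖ ‖(g : V p) 1 1‖ with hg | hg
    · rw [(special_value φ.2 hI g).1 hg, mul_comm]
    · rw [(special_value φ.2 hI g).2 hg, mul_comm, sub_eq_zero.mp h0]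
  refine ⟨hε2, ?_, ?_⟩
  · have h1 := he' (eta p)
    rw [hε, map_smul, ← hφ, ← Submodule.Quotient.mk_smul, eq_comm, Submodule.Quotient.eq] at h1
    obtain ⟨C, hC⟩ := h1
    have h2 := hC 1
    have h3 := hC (antidiag p)
    have hd1 : Matrix.GeneralLinearGroup.det (antidiag p) = 1 := by
      ext; exact det_atkinLehner _
    rw [hd1] at h3
    rw [map_one] at h2
    change (φ : GL (Fin 2) ℚ_[p] → ℂ) (1 * eta p) - ε * (φ : GL (Fin 2) ℚ_[p] → ℂ) 1 = _ at h2
    change (φ : GL (Fin 2) ℚ_[p] → ℂ) (antidiag p * eta p) -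
      ε * (φ : GL (Fin 2) ℚ_[p] → ℂ) (antidiag p) = _ at h3
    have h4 := special_eta φ.2 hI
    apply mul_right_cancel₀ hΔ
    linear_combination h4 - h2 + h3
  · have h1 : f + ∑ x : Fin p, glRep π (uni ((x : ℕ) : ℚ_[p]) * antidiag p) f = 0 := by
      apply Φ.toLinearEquiv.injective
      rw [map_zero, map_add, map_sum]
      simp_rw [he']
      rw [← hφ]
      rw [← Submodule.mkQ_apply]
      simp_rw [← Submodule.mkQ_apply]
      rw [← map_sum, ← map_add, Submodule.mkQ_apply, Submodule.Quotient.mk_eq_zero]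
      refine ⟨(φ : GL (Fin 2) ℚ_[p] → ℂ) 1 + p * (φ : GL (Fin 2) ℚ_[p] → ℂ) (antidiag p),
        fun g => ?_⟩
      rw [Submodule.coe_add, Submodule.coe_sum, Pi.add_apply, Finset.sum_apply]
      exact special_hecke φ.2 hI g
    have h2 : heckeU (glRep π) (glRep π (eta p) f) = -f := by
      rw [eq_neg_iff_add_eq_zero, add_comm, ← h1, heckeU_apply]
      congr 1
      refine Finset.sum_congr rfl fun x _ => ?_
      have h : ∀ x : ℚ_[p], heckeMat 1 x * eta p =
          Matrix.GeneralLinearGroup.scalar (Fin 2) (pUnit p) * (uni x * antidiag p) := fun x => by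
        apply Units.ext
        rw [Units.val_mul, Units.val_mul, Units.val_mul, coe_scalar_eq]
        ext i j; fin_cases i <;> fin_cases j <;> simp [mul_comm]
      rw [← Module.End.mul_apply, ← map_mul, h, (centreTrivial_glRep π).scalar_mul]
    rw [hε, map_smul] at h2
    calc heckeU (glRep π) f = (ε * ε) • heckeU (glRep π) f := by rw [hε2, one_smul]
      _ = -ε • f := by rw [mul_smul, h2, smul_neg, neg_smul]

end NewVectors

/-! ### The bound for the Hecke eigenvalue of a unitary representation -/

/-- A Hecke eigenvalue of a unitary representation is real, of absolute value at most `p + 1`. -/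
lemma exists_real_eigenvalue {W : Type*} [AddCommGroup W] [Module ℂ W]
    {ρ : Representation ℂ (GL (Fin 2) ℚ_[p]) W} (hρ : CentreTrivial ρ)
    {B : W →ₗ[ℂ] W →ₗ⋆[ℂ] ℂ} (herm : ∀ x y, B y x = (starRingEnd ℂ) (B x y))
    (hpos : ∀ x, x ≠ 0 → 0 < (B x x).re) (hinv : ∀ g x y, B (ρ g x) (ρ g y) = B x y) {f : W}
    (hf1 : B f f = 1) (hf : ∀ k ∈ eichlerSubgroup p 0, ρ k f = f) {c : ℂ}
    (hc : heckeU ρ f + ρ (eta p) f = c • f) : ∃ t : ℝ, c = t ∧ |t| ≤ p + 1 := by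
  set s := B (ρ (eta p) f) f with hs
  have hs' : B f (ρ (eta p) f) = s := by
    rw [← hinv (eta p), hρ.atkinLehner_sq]
  have hreal : (starRingEnd ℂ) s = s := by rw [← hs', ← herm, ← hs, hs']
  obtain ⟨r, hr⟩ := Complex.conj_eq_iff_real.mp hreal
  have hnn : ∀ x, 0 ≤ (B x x).re := fun x => by
    by_cases hx : x = 0
    · simp [hx]
    · exact (hpos x hx).le
  have hff : B (ρ (eta p) f) (ρ (eta p) f) = 1 := by rw [hinv, hf1]
  -- Cauchy–Schwarz, from positivity of the form on $\eta f\pm f$.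
  have h1 : |r| ≤ 1 := by
    have e1 := hnn (ρ (eta p) f - f)
    have e2 := hnn (ρ (eta p) f + f)
    simp only [map_sub, map_add, LinearMap.sub_apply, LinearMap.add_apply, hff, hf1, hs', ← hs,
      hr] at e1 e2
    simp at e1 e2
    rw [abs_le]
    constructor <;> linarith
  -- All $p+1$ cosets lie in a single double coset of $\mathrm{GL}_2(\mathbf Z_p)$, so they share
  -- one matrix coefficient $r$ and the eigenvalue is $(p+1)r$.
  have hmat : ∀ x : ℚ_[p], ‖x‖ ≤ 1 → B (ρ (heckeMat 1 x) f) f = r := fun x hx => by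
    have hk : uni x * (antidiag p)⁻¹ ∈ eichlerSubgroup p 0 :=
      mul_mem (uni_mem hx 0) (inv_mem antidiag_mem)
    have e : heckeMat 1 x = uni x * (antidiag p)⁻¹ * eta p := by
      apply Units.ext
      rw [Units.val_mul, Units.val_mul, inv_entries, det_atkinLehner]
      ext i j; fin_cases i <;> fin_cases j <;> simp
    rw [e, map_mul, Module.End.mul_apply]
    nth_rw 2 [← hf _ hk]
    rw [hinv, ← hs, hr]
  refine ⟨(p + 1) * r, ?_, ?_⟩
  · have h2 := congrArg (fun v => B v f) hc
    simp only [map_add, LinearMap.add_apply, heckeU_apply, map_sum, LinearMap.sum_apply, map_smul,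
      LinearMap.smul_apply, hf1, smul_eq_mul, mul_one, hmat _ (norm_natCast_le_one _), ← hs] at h2
    rw [← h2, hr]
    simp [add_mul]
  · rw [abs_mul, abs_of_nonneg (by positivity)]
    exact mul_le_of_le_one_right (by positivity) h1

/-- The Satake parameters are small, unless they are those of a character. -/
lemma norm_lt_of_add_real {x y : ℂ} (hxy : x * y = p) {t : ℝ} (ht : x + y = t)
    (htp : |t| ≤ p + 1) (hx : x ^ 2 ≠ (p : ℂ) ^ 2) : ‖x‖ < p := by
  have hp := one_lt_prime_real (p := p)
  by_contra! hge
  have h2 : x ^ 2 - t * x + p = 0 := by rw [← ht]; linear_combination -hxy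
  have hre := congrArg Complex.re h2
  have him := congrArg Complex.im h2
  have hn : ‖x‖ ^ 2 = x.re ^ 2 + x.im ^ 2 := by
    rw [← Complex.normSq_eq_norm_sq, Complex.normSq_apply]; ring
  simp [pow_two] at hre him
  -- A non-real root would be conjugate to the other one, giving $|x|^2=p<p^2$.
  have h0 : x.im = 0 := by
    by_contra hne
    have h3 : t = 2 * x.re := by
      apply mul_right_cancel₀ hne; linarith
    rw [h3] at hre
    nlinarith
  rw [h0] at hre hn
  have h4 : (p : ℝ) ≤ |x.re| := by
    rw [← sq_le_sq₀ (by linarith) (abs_nonneg _), sq_abs]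
    nlinarith [norm_nonneg x]
  have h5 : t * x.re ≤ (p + 1) * |x.re| := by
    calc t * x.re ≤ |t * x.re| := le_abs_self _
      _ = |t| * |x.re| := abs_mul _ _
      _ ≤ _ := mul_le_mul_of_nonneg_right htp (abs_nonneg _)
  -- This is $x^2+p=tx\le(p+1)|x|$ for real $x$. Combined with $|x|\ge p>1$ it leaves only $|x|=p$.
  have h6 : (|x.re| - p) * (|x.re| - 1) ≤ 0 := by
    have := sq_abs x.re
    nlinarith
  have h7 : |x.re| = p := by
    apply le_antisymm _ h4
    by_contra! hlt
    nlinarith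
  apply hx
  have h8 : x = (x.re : ℂ) := Complex.ext (by simp) (by simp [h0])
  rw [h8, ← Complex.ofReal_pow, ← sq_abs, h7]
  simp

/-! ### The `L`-factors -/

/-- The `L`-factor in terms of a basis of eigenvectors of the kernel of the monodromy operator. -/
lemma UnramifiedWD.LFactor_eq {W ι : Type*} [AddCommGroup W] [Module ℂ W] [Fintype ι]
    [DecidableEq ι] (ρ : UnramifiedWD p W) (v : ι → W) (c : ι → ℂ) (G : W →ₗ[ℂ] ι → ℂ)
    (hN : ∀ i, ρ.monodromy (v i) = 0) (hfrob : ∀ i, ρ.frob (v i) = c i • v i)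
    (hG : ∀ i, G (v i) = Pi.single i 1)
    (hker : ∀ w, ρ.monodromy w = 0 → ∑ i, G w i • v i = w) (s : ℂ) :
    ρ.LFactor s = (∏ i, (1 - (p : ℂ) ^ (-s) * c i))⁻¹ := by
  let F : (ι → ℂ) →ₗ[ℂ] LinearMap.ker ρ.monodromy :=
    Fintype.linearCombination ℂ fun i => ⟨v i, hN i⟩
  have hF : ∀ a, (F a : W) = ∑ i, a i • v i := fun a => by
    simp [F, Fintype.linearCombination_apply]
  let E : LinearMap.ker ρ.monodromy ≃ₗ[ℂ] (ι → ℂ) :=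
    LinearEquiv.ofLinearMap (G ∘ₗ (LinearMap.ker ρ.monodromy).subtype) F
      (by
        refine LinearMap.ext fun a => ?_
        rw [LinearMap.comp_apply, LinearMap.comp_apply, Submodule.subtype_apply, hF, map_sum]
        simp_rw [map_smul, hG]
        ext j
        simp [Finset.sum_apply, Pi.single_apply])
      (by
        refine LinearMap.ext fun w => Subtype.ext ?_
        rw [LinearMap.comp_apply, hF]
        exact hker w w.2)
  let b := Module.Basis.ofEquivFun E
  have hb : ∀ i, (b i : W) = v i := fun i => by
    rw [Module.Basis.coe_ofEquivFun]
    change (F (Pi.single i 1) : W) = _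
    rw [hF]
    simp [Pi.single_apply]
  rw [UnramifiedWD.LFactor, ← LinearMap.det_toMatrix b]
  congr 1
  have h : LinearMap.toMatrix b b (LinearMap.id - (p : ℂ) ^ (-s) • ρ.frob.restrict
      (p := LinearMap.ker ρ.monodromy) (q := LinearMap.ker ρ.monodromy) fun w hw =>
        ρ.frob_mem_ker w hw) = Matrix.diagonal fun i => 1 - (p : ℂ) ^ (-s) * c i := by
    ext i j
    rw [LinearMap.toMatrix_apply]
    have h1 : (LinearMap.id - (p : ℂ) ^ (-s) • ρ.frob.restrict
        (p := LinearMap.ker ρ.monodromy) (q := LinearMap.ker ρ.monodromy) (fun w hw =>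
          ρ.frob_mem_ker w hw) : LinearMap.ker ρ.monodromy →ₗ[ℂ] LinearMap.ker ρ.monodromy) (b j) = (1 - (p : ℂ) ^ (-s) * c j) • b j := by
      apply Subtype.ext
      simp only [LinearMap.sub_apply, LinearMap.id_apply, LinearMap.smul_apply,
        Submodule.coe_sub, Submodule.coe_smul, LinearMap.coe_restrict_apply, hb, hfrob, sub_smul,
        one_smul, mul_smul]
    rw [h1, map_smul, Module.Basis.repr_self]
    by_cases hij : i = j
    · subst hij; simp
    · rw [Matrix.diagonal_apply_ne _ hij]; simp [Ne.symm hij]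
  rw [h, Matrix.det_diagonal]

/-- The standard basis of the space of a tensor product of two parameters. -/
abbrev stdBasis : Module.Basis (Fin 2 × Fin 2) ℂ ((Fin 2 → ℂ) ⊗[ℂ] (Fin 2 → ℂ)) :=
  (Pi.basisFun ℂ (Fin 2)).tensorProduct (Pi.basisFun ℂ (Fin 2))

lemma stdBasis_apply (i j : Fin 2) :
    stdBasis (i, j) = Pi.single i (1 : ℂ) ⊗ₜ[ℂ] Pi.single j (1 : ℂ) := by
  simp [stdBasis, Module.Basis.tensorProduct_apply]

lemma toLin'_diag_single (a b : ℂ) (i : Fin 2) :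
    Matrix.toLin' !![a, 0; 0, b] (Pi.single i 1) = (![a, b] i) • Pi.single i (1 : ℂ) := by
  ext j
  fin_cases i <;> fin_cases j <;> simp [Matrix.mulVec, dotProduct, Fin.sum_univ_two]

lemma toLin'_nilpotent_single :
    Matrix.toLin' !![(0 : ℂ), 0; 1, 0] (Pi.single 0 1) = Pi.single 1 1 ∧
    Matrix.toLin' !![(0 : ℂ), 0; 1, 0] (Pi.single 1 1) = 0 := by
  constructor <;> ext j <;> fin_cases j <;> simp [Matrix.mulVec, dotProduct, Fin.sum_univ_two]

lemma asaiLFactor_principal_principal (μ ν μ' ν' : ℚ_[p]ˣ →* ℂˣ) :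
    asaiLFactor (.principal μ ν) (.principal μ' ν') 1 =
      ((1 - (p : ℂ)⁻¹ * (μ (pUnit p) * μ' (pUnit p))) *
        (1 - (p : ℂ)⁻¹ * (μ (pUnit p) * ν' (pUnit p))) *
        ((1 - (p : ℂ)⁻¹ * (ν (pUnit p) * μ' (pUnit p))) *
        (1 - (p : ℂ)⁻¹ * (ν (pUnit p) * ν' (pUnit p)))))⁻¹ := by
  rw [asaiLFactor, UnramifiedWD.LFactor_eq _ stdBasis
    (fun ij => ![(μ (pUnit p) : ℂ), ν (pUnit p)] ij.1 * ![(μ' (pUnit p) : ℂ), ν' (pUnit p)] ij.2)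
    stdBasis.equivFun.toLinearMap]
  · rw [Fintype.prod_prod_type, Complex.cpow_neg_one]
    simp [Fin.prod_univ_two]
  · intro i
    simp [LocalType.parameter, UnramifiedWD.tensor, principalParameter]
  · rintro ⟨i, j⟩
    rw [stdBasis_apply]
    change TensorProduct.map (Matrix.toLin' _) (Matrix.toLin' _) _ = _
    rw [TensorProduct.map_tmul, toLin'_diag_single, toLin'_diag_single, TensorProduct.smul_tmul_smul]
  · intro i
    ext j
    simp [Pi.single_apply, eq_comm]
  · intro w _
    exact stdBasis.sum_equivFun w

/-- The coordinates of a tensor. -/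
lemma sum_stdBasis_repr (w : (Fin 2 → ℂ) ⊗[ℂ] (Fin 2 → ℂ)) :
    stdBasis.repr w (0, 0) • stdBasis (0, 0) + stdBasis.repr w (0, 1) • stdBasis (0, 1) +
      (stdBasis.repr w (1, 0) • stdBasis (1, 0) + stdBasis.repr w (1, 1) • stdBasis (1, 1)) = w := by
  conv_rhs => rw [← stdBasis.sum_repr w, Fintype.sum_prod_type, Fin.sum_univ_two, Fin.sum_univ_two,
    Fin.sum_univ_two]

/-- The kernel of the monodromy is spanned by the $e_i\otimes e_1$, so only the eigenvalue
$\chi(p)p^{-1/2}$ of the special parameter enters. -/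
lemma asaiLFactor_principal_special (μ ν χ : ℚ_[p]ˣ →* ℂˣ) :
    asaiLFactor (.principal μ ν) (.special χ) 1 =
      ((1 - (p : ℂ)⁻¹ * (μ (pUnit p) * (χ (pUnit p) * (Real.sqrt p : ℂ)⁻¹))) *
        (1 - (p : ℂ)⁻¹ * (ν (pUnit p) * (χ (pUnit p) * (Real.sqrt p : ℂ)⁻¹))))⁻¹ := by
  have hN : ∀ i, ((LocalType.principal μ ν).parameter.tensor (LocalType.special χ).parameter).monodromy
      (stdBasis (i, 1)) = 0 ∧
      ((LocalType.principal μ ν).parameter.tensor (LocalType.special χ).parameter).monodromy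
      (stdBasis (i, 0)) = stdBasis (i, 1) := fun i => by
    have h : ((LocalType.principal μ ν).parameter.tensor (LocalType.special χ).parameter).monodromy =
        TensorProduct.map 0 LinearMap.id + TensorProduct.map LinearMap.id
          (Matrix.toLin' !![(0 : ℂ), 0; 1, 0]) := rfl
    rw [h, stdBasis_apply, stdBasis_apply]
    simp only [LinearMap.add_apply, TensorProduct.map_tmul, LinearMap.zero_apply,
      TensorProduct.zero_tmul, zero_add, LinearMap.id_apply, toLin'_nilpotent_single.1,
      toLin'_nilpotent_single.2, TensorProduct.tmul_zero, and_self]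
  rw [asaiLFactor, UnramifiedWD.LFactor_eq _ (fun i => stdBasis (i, 1))
    (fun i => ![(μ (pUnit p) : ℂ), ν (pUnit p)] i * (χ (pUnit p) * (Real.sqrt p : ℂ)⁻¹))
    (LinearMap.pi fun i => stdBasis.coord (i, 1))]
  · rw [Complex.cpow_neg_one]
    simp [Fin.prod_univ_two]
  · exact fun i => (hN i).1
  · intro i
    rw [stdBasis_apply]
    change TensorProduct.map (Matrix.toLin' _) (Matrix.toLin' _) _ = _
    rw [TensorProduct.map_tmul, toLin'_diag_single, toLin'_diag_single, TensorProduct.smul_tmul_smul]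
    rfl
  · intro i
    ext j
    simp [Pi.single_apply, eq_comm]
  · intro w hw
    have h := sum_stdBasis_repr w
    rw [← h] at hw
    simp only [map_add, map_smul, (hN _).1, (hN _).2, smul_zero, add_zero] at hw
    have h0 := congrArg (fun z => stdBasis.repr z (0, 1)) hw
    have h1 := congrArg (fun z => stdBasis.repr z (1, 1)) hw
    simp only [map_add, map_smul, Module.Basis.repr_self] at h0 h1
    simp at h0 h1
    rw [h0, h1] at h
    rw [Fin.sum_univ_two]
    simpa using h

/-- As $N(e_0\otimes e_1)=N(e_1\otimes e_0)=e_1\otimes e_1$, the kernel of the monodromy is spanned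
by $e_1\otimes e_1$ and the antisymmetric vector $e_0\otimes e_1-e_1\otimes e_0$, with Frobenius
eigenvalues $\chi\chi'(p)p^{-1}$ and $\chi\chi'(p)$. -/
lemma asaiLFactor_special_special (χ χ' : ℚ_[p]ˣ →* ℂˣ) :
    asaiLFactor (.special χ) (.special χ') 1 =
      ((1 - (p : ℂ)⁻¹ * (χ (pUnit p) * χ' (pUnit p) * (p : ℂ)⁻¹)) *
        (1 - (p : ℂ)⁻¹ * (χ (pUnit p) * χ' (pUnit p))))⁻¹ := by
  have hN : ((LocalType.special χ).parameter.tensor (LocalType.special χ').parameter).monodromy =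
      TensorProduct.map (Matrix.toLin' !![(0 : ℂ), 0; 1, 0]) LinearMap.id +
        TensorProduct.map LinearMap.id (Matrix.toLin' !![(0 : ℂ), 0; 1, 0]) := rfl
  have hF : ((LocalType.special χ).parameter.tensor (LocalType.special χ').parameter).frob =
      TensorProduct.map
        (Matrix.toLin' !![(χ (pUnit p) : ℂ) * (Real.sqrt p : ℂ), 0;
          0, (χ (pUnit p) : ℂ) * (Real.sqrt p : ℂ)⁻¹])
        (Matrix.toLin' !![(χ' (pUnit p) : ℂ) * (Real.sqrt p : ℂ), 0;
          0, (χ' (pUnit p) : ℂ) * (Real.sqrt p : ℂ)⁻¹]) := rfl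
  set N := ((LocalType.special χ).parameter.tensor (LocalType.special χ').parameter).monodromy
  have h00 : N (stdBasis (0, 0)) = stdBasis (1, 0) + stdBasis (0, 1) := by
    simp only [hN, stdBasis_apply, LinearMap.add_apply, TensorProduct.map_tmul, LinearMap.id_apply,
      toLin'_nilpotent_single.1]
  have h01 : N (stdBasis (0, 1)) = stdBasis (1, 1) := by
    simp only [hN, stdBasis_apply, LinearMap.add_apply, TensorProduct.map_tmul, LinearMap.id_apply,
      toLin'_nilpotent_single.1, toLin'_nilpotent_single.2, TensorProduct.tmul_zero, add_zero]
  have h10 : N (stdBasis (1, 0)) = stdBasis (1, 1) := by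
    simp only [hN, stdBasis_apply, LinearMap.add_apply, TensorProduct.map_tmul, LinearMap.id_apply,
      toLin'_nilpotent_single.1, toLin'_nilpotent_single.2, TensorProduct.zero_tmul, zero_add]
  have h11 : N (stdBasis (1, 1)) = 0 := by
    simp only [hN, stdBasis_apply, LinearMap.add_apply, TensorProduct.map_tmul, LinearMap.id_apply,
      toLin'_nilpotent_single.2, TensorProduct.zero_tmul, TensorProduct.tmul_zero, add_zero]
  have hp := prime_real_pos (p := p)
  have hs0 : (Real.sqrt p : ℂ) ≠ 0 := Complex.ofReal_ne_zero.mpr (Real.sqrt_pos.mpr hp).ne'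
  have hs2 : (Real.sqrt p : ℂ) * (Real.sqrt p : ℂ) = p := by
    rw [← Complex.ofReal_mul, Real.mul_self_sqrt hp.le, Complex.ofReal_natCast]
  rw [asaiLFactor, UnramifiedWD.LFactor_eq _
    (![stdBasis (1, 1), stdBasis (0, 1) - stdBasis (1, 0)])
    (![(χ (pUnit p) : ℂ) * χ' (pUnit p) * (p : ℂ)⁻¹, (χ (pUnit p) : ℂ) * χ' (pUnit p)])
    (LinearMap.pi ![stdBasis.coord (1, 1), stdBasis.coord (0, 1)])]
  · rw [Complex.cpow_neg_one]
    simp [Fin.prod_univ_two]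
  · intro i
    fin_cases i
    · exact h11
    · change N (stdBasis (0, 1) - stdBasis (1, 0)) = 0
      rw [map_sub, h01, h10, sub_self]
  · rw [hF]
    intro i
    fin_cases i <;> simp only [Fin.zero_eta, Fin.mk_one, Matrix.cons_val_zero,
      Matrix.cons_val_one, Matrix.cons_val_fin_one, map_sub, stdBasis_apply,
      TensorProduct.map_tmul, toLin'_diag_single, TensorProduct.smul_tmul_smul, smul_sub]
    · congr 1
      rw [← hs2]
      field_simp
    · congr 2 <;> field_simp
  · intro i
    ext j
    fin_cases i <;> fin_cases j <;> simp
  · intro w hw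
    have h := sum_stdBasis_repr w
    change N w = 0 at hw
    rw [← h] at hw
    simp only [map_add, map_smul, h00, h01, h10, h11, smul_zero, add_zero] at hw
    have e0 := congrArg (fun z => stdBasis.repr z (0, 1)) hw
    have e1 := congrArg (fun z => stdBasis.repr z (1, 1)) hw
    simp only [map_add, map_smul, Module.Basis.repr_self] at e0 e1
    simp at e0 e1
    rw [e0, eq_neg_of_add_eq_zero_right e1] at h
    rw [Fin.sum_univ_two]
    conv_rhs => rw [← h]
    simp
    module

/-! ### Series -/

lemma hasSum_fin_prod {k : ℕ} {β : Type*} {f : Fin k × β → ℂ} {S : Fin k → ℂ}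
    (h : ∀ e, HasSum (fun b => f (e, b)) (S e)) : HasSum f (∑ e, S e) := by
  have h1 : ∀ e, HasSum (fun x : Fin k × β => if x.1 = e then f x else 0) (S e) := fun e => by
    have h2 : Function.Injective fun b : β => (e, b) := fun _ _ hb => (Prod.mk.inj hb).2
    refine (h2.hasSum_iff fun x hx => if_neg fun hxe => hx ⟨x.2, Prod.ext hxe.symm rfl⟩).mp ?_
    simpa [Function.comp_def] using h e
  simpa using hasSum_sum fun e (_ : e ∈ Finset.univ) => h1 e

/-- The recurrence bounds each partial sum by a constant plus $\|x\|r<1$ times itself, so the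
partial sums are bounded. -/
lemma summable_of_affine_recurrence {w g : ℕ → ℂ} {x : ℂ} (hw : ∀ N, w (N + 1) = x * w N + g N)
    {r : ℝ} (hr : 0 ≤ r) (hx : ‖x‖ * r < 1) (hg : Summable fun N => ‖g N‖ * r ^ N) :
    Summable fun N => ‖w N‖ * r ^ N := by
  have hnn : ∀ N, 0 ≤ ‖w N‖ * r ^ N := fun N => by positivity
  have hgn : ∀ N, 0 ≤ ‖g N‖ * r ^ N := fun N => by positivity
  refine summable_of_sum_range_le (c := (‖w 0‖ + r * ∑' N, ‖g N‖ * r ^ N) / (1 - ‖x‖ * r)) hnn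
    fun K => ?_
  rw [le_div_iff₀ (by linarith)]
  have h1 : ∑ N ∈ Finset.range K, ‖w N‖ * r ^ N ≤ ∑ N ∈ Finset.range (K + 1), ‖w N‖ * r ^ N :=
    Finset.sum_le_sum_of_subset_of_nonneg (Finset.range_mono K.le_succ) fun N _ _ => hnn N
  rw [Finset.sum_range_succ'] at h1
  have h2 : ∑ N ∈ Finset.range K, ‖w (N + 1)‖ * r ^ (N + 1) ≤
      ∑ N ∈ Finset.range K, (‖x‖ * r * (‖w N‖ * r ^ N) + r * (‖g N‖ * r ^ N)) :=
    Finset.sum_le_sum fun N _ => by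
      rw [hw]
      calc ‖x * w N + g N‖ * r ^ (N + 1) ≤ (‖x‖ * ‖w N‖ + ‖g N‖) * r ^ (N + 1) := by
            gcongr
            exact (norm_add_le _ _).trans_eq (by rw [norm_mul])
        _ = _ := by ring
  rw [Finset.sum_add_distrib, ← Finset.mul_sum, ← Finset.mul_sum] at h2
  have h3 := mul_le_mul_of_nonneg_left (hg.sum_le_tsum (Finset.range K) fun N _ => hgn N) hr
  simp only [pow_zero, mul_one] at h1
  linarith

/-- $z_{N+1}-x'z_N$ is geometric of ratio $x$, which reduces to an affine recurrence of order one.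
No case distinction is needed when $x=x'$. -/
lemma summable_of_recurrence {z : ℕ → ℂ} {x x' : ℂ}
    (hz : ∀ N, z (N + 2) = (x + x') * z (N + 1) - x * x' * z N) {r : ℝ} (hr : 0 ≤ r)
    (hx : ‖x‖ * r < 1) (hx' : ‖x'‖ * r < 1) : Summable fun N => ‖z N‖ * r ^ N := by
  have hD : ∀ N, z (N + 1) = x' * z N + x ^ N * (z 1 - x' * z 0) := fun N => by
    induction N with
    | zero => ring
    | succ N ih => rw [hz]; linear_combination x * ih
  refine summable_of_affine_recurrence hD hr hx' ?_
  have h := (summable_geometric_of_lt_one (by positivity) hx).mul_left ‖z 1 - x' * z 0‖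
  refine h.congr fun N => ?_
  rw [norm_mul, norm_pow, mul_pow]
  ring

/-- Summation over the square shells of `ℕ × ℕ`. -/
lemma hasSum_max {a b : ℕ → ℂ} {r T : ℂ}
    (hs : Summable fun t : ℕ × ℕ => r ^ max t.1 t.2 * (a t.1 * b t.2))
    (hT : HasSum (fun j => r ^ j *
      ((∑ n ∈ Finset.range (j + 1), a n) * ∑ m ∈ Finset.range (j + 1), b m)) T) :
    HasSum (fun t : ℕ × ℕ => r ^ max t.1 t.2 * (a t.1 * b t.2)) ((1 - r) * T) := by
  set P : ℕ → ℂ := fun k => (∑ n ∈ Finset.range k, a n) * ∑ m ∈ Finset.range k, b m with hP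
  set f : ℕ × ℕ → ℂ := fun t => r ^ max t.1 t.2 * (a t.1 * b t.2) with hf
  -- Abel summation: the shell $\max(n,m)=k$ contributes $r^k(P_{k+1}-P_k)$.
  have hQ : ∀ k, ∑ t ∈ Finset.range k ×ˢ Finset.range k, f t =
      (1 - r) * ∑ j ∈ Finset.range k, r ^ j * P (j + 1) + r ^ k * P k := fun k => by
    induction k with
    | zero => simp [hP]
    | succ k ih =>
      have hstep : ∑ t ∈ Finset.range (k + 1) ×ˢ Finset.range (k + 1), f t =
          ∑ t ∈ Finset.range k ×ˢ Finset.range k, f t + r ^ k * (P (k + 1) - P k) := by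
        have h1 : ∀ n ∈ Finset.range k, f (n, k) = r ^ k * (a n * b k) := fun n hn => by
          simp only [hf, max_eq_right (Finset.mem_range.mp hn).le]
        have h2 : ∀ n ∈ Finset.range k, f (k, n) = r ^ k * (a k * b n) := fun n hn => by
          simp only [hf, max_eq_left (Finset.mem_range.mp hn).le]
        simp only [Finset.sum_product, Finset.sum_range_succ, Finset.sum_add_distrib,
          Finset.sum_congr rfl h1, Finset.sum_congr rfl h2, hP, ← Finset.mul_sum, ← Finset.sum_mul]
        simp only [hf, max_self]
        ring
      rw [hstep, ih, Finset.sum_range_succ]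
      ring
  have hlim : Filter.Tendsto (fun k => ∑ t ∈ Finset.range k ×ˢ Finset.range k, f t) Filter.atTop
      (nhds ((1 - r) * T)) := by
    simp_rw [hQ]
    -- The boundary term at $k+1$ is $r$ times a term of the convergent series.
    have h0 : Filter.Tendsto (fun k => r ^ k * P k) Filter.atTop (nhds 0) := by
      rw [← Filter.tendsto_add_atTop_iff_nat 1]
      have h1 := hT.summable.tendsto_atTop_zero.const_mul r
      rw [mul_zero] at h1
      refine h1.congr fun k => ?_
      rw [pow_succ]; simp only [hP]; ring
    simpa using (hT.tendsto_sum_nat.const_mul (1 - r)).add h0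
  have hfin : Filter.Tendsto (fun k => Finset.range k ×ˢ Finset.range k) Filter.atTop
      (Filter.atTop : Filter (Finset (ℕ × ℕ))) := by
    refine Filter.tendsto_atTop_finset_of_monotone
      (fun i j hij => Finset.product_subset_product (Finset.range_mono hij) (Finset.range_mono hij))
      fun t => ⟨max t.1 t.2 + 1, ?_⟩
    rw [Finset.mem_product, Finset.mem_range, Finset.mem_range]
    omega
  have := tendsto_nhds_unique (hs.hasSum.comp hfin) hlim
  exact this ▸ hs.hasSum

/-- The complete homogeneous polynomials in the roots of `X² - c X + d`. -/
def satakeSeq (c d : ℂ) : ℕ → ℂ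
  | 0 => 1
  | 1 => c
  | N + 2 => c * satakeSeq c d (N + 1) - d * satakeSeq c d N

/-- The eigenvalues of the Hecke operators of elementary divisors `(p ^ N, 1)`. -/
def doubleCosetEigenvalue (c d : ℂ) : ℕ → ℂ
  | 0 => 1
  | 1 => c
  | N + 2 => satakeSeq c d (N + 2) - satakeSeq c d N

lemma sum_doubleCosetEigenvalue (c d : ℂ) (e : Fin 2) (k : ℕ) :
    ∑ n ∈ Finset.range (k + 1), doubleCosetEigenvalue c d (2 * n + e) =
      satakeSeq c d (2 * k + e) := by
  induction k with
  | zero => fin_cases e <;> simp [doubleCosetEigenvalue, satakeSeq]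
  | succ k ih =>
    rw [Finset.sum_range_succ, ih, show 2 * (k + 1) + (e : ℕ) = (2 * k + e) + 2 by ring,
      doubleCosetEigenvalue]
    ring

lemma summable_satakeSeq {x x' : ℂ} {r : ℝ} (hr : 0 ≤ r) (hx : ‖x‖ * r < 1) (hx' : ‖x'‖ * r < 1) :
    Summable fun N => ‖satakeSeq (x + x') (x * x') N‖ * r ^ N :=
  summable_of_recurrence (fun _ => rfl) hr hx hx'

/-- The sequence satisfies the recurrence of order two only from index 1 on, because its value at 0
is 1 while the recurrence fails at the first step; hence the shift. -/
lemma summable_doubleCosetEigenvalue {x x' : ℂ} {r : ℝ} (hr : 0 ≤ r) (hx : ‖x‖ * r < 1)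
    (hx' : ‖x'‖ * r < 1) :
    Summable fun N => ‖doubleCosetEigenvalue (x + x') (x * x') N‖ * r ^ N := by
  rw [← summable_nat_add_iff 1]
  have h := summable_of_recurrence
    (z := fun N => doubleCosetEigenvalue (x + x') (x * x') (N + 1)) (x := x) (x' := x')
    (fun N => ?_) hr hx hx'
  · refine (h.mul_left r).congr fun N => ?_
    ring
  · rcases N with _ | N <;> simp only [doubleCosetEigenvalue, satakeSeq] <;> ring

/-- The generating series of the products of two sequences of complete homogeneous polynomials. -/
lemma hasSum_satakeSeq_mul {x x' y y' T : ℂ} {r : ℝ} (hr : 0 ≤ r) (hT : ‖T‖ = r ^ 2)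
    (hx : ‖x‖ * r < 1) (hx' : ‖x'‖ * r < 1) (hy : ‖y‖ * r < 1) (hy' : ‖y'‖ * r < 1) :
    HasSum (fun N => T ^ N * (satakeSeq (x + x') (x * x') N * satakeSeq (y + y') (y * y') N))
      ((1 - x * x' * (y * y') * T ^ 2) / ((1 - T * (x * y)) * (1 - T * (x * y')) *
        ((1 - T * (x' * y)) * (1 - T * (x' * y'))))) := by
  set A := satakeSeq (x + x') (x * x') with hA
  set B := satakeSeq (y + y') (y * y') with hB
  have hs : Summable fun N => T ^ N * (A N * B N) := by
    refine Summable.of_norm ?_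
    have h := ((summable_satakeSeq hr hx hx').mul_of_nonneg (summable_satakeSeq hr hy hy')
      (fun N => by positivity) (fun N => by positivity)).comp_injective
      (i := fun N : ℕ => (N, N)) fun _ _ h => (Prod.mk.inj h).1
    refine h.congr fun N => ?_
    rw [norm_mul, norm_mul, norm_pow, hT]
    simp only [Function.comp_apply]
    ring
  have hne : ∀ u v : ℂ, ‖u‖ * r < 1 → ‖v‖ * r < 1 → 1 - T * (u * v) ≠ 0 := fun u v hu hv h0 => by
    have h1 : ‖T * (u * v)‖ = 1 := by rw [← sub_eq_zero.mp h0, norm_one]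
    rw [norm_mul, norm_mul, hT] at h1
    nlinarith [mul_nonneg (norm_nonneg u) hr, mul_nonneg (norm_nonneg v) hr]
  -- The product of two recurrent sequences of order two satisfies the recurrence of order four with
  -- roots $x_iy_j$. Its coefficients are the elementary symmetric functions of the four products.
  have hrec : ∀ N, T ^ (N + 4) * (A (N + 4) * B (N + 4)) =
      T * ((x + x') * (y + y')) * (T ^ (N + 3) * (A (N + 3) * B (N + 3))) -
      T ^ 2 * (x * x' * (y + y') ^ 2 + y * y' * (x + x') ^ 2 - 2 * (x * x' * (y * y'))) *
        (T ^ (N + 2) * (A (N + 2) * B (N + 2))) +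
      T ^ 3 * (x * x' * (y * y') * ((x + x') * (y + y'))) * (T ^ (N + 1) * (A (N + 1) * B (N + 1))) -
      T ^ 4 * (x * x' * (y * y')) ^ 2 * (T ^ N * (A N * B N)) := fun N => by
    have a2 : A (N + 2) = (x + x') * A (N + 1) - x * x' * A N := rfl
    have a3 : A (N + 3) = (x + x') * A (N + 2) - x * x' * A (N + 1) := rfl
    have a4 : A (N + 4) = (x + x') * A (N + 3) - x * x' * A (N + 2) := rfl
    have b2 : B (N + 2) = (y + y') * B (N + 1) - y * y' * B N := rfl
    have b3 : B (N + 3) = (y + y') * B (N + 2) - y * y' * B (N + 1) := rfl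
    have b4 : B (N + 4) = (y + y') * B (N + 3) - y * y' * B (N + 2) := rfl
    rw [a4, b4, a3, b3, a2, b2]
    ring
  obtain ⟨S, hS⟩ := hs
  have h1 := (hasSum_nat_add_iff' 1).mpr hS
  have h2 := (hasSum_nat_add_iff' 2).mpr hS
  have h3 := (hasSum_nat_add_iff' 3).mpr hS
  have h4 := (hasSum_nat_add_iff' 4).mpr hS
  have h5 := (((h3.mul_left (T * ((x + x') * (y + y')))).sub
    (h2.mul_left (T ^ 2 * (x * x' * (y + y') ^ 2 + y * y' * (x + x') ^ 2 -
      2 * (x * x' * (y * y')))))).add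
    (h1.mul_left (T ^ 3 * (x * x' * (y * y') * ((x + x') * (y + y')))))).sub
    (hS.mul_left (T ^ 4 * (x * x' * (y * y')) ^ 2))
  simp only [hrec] at h4
  have h6 := h4.unique h5
  have a0 : A 0 = 1 := rfl
  have a1 : A 1 = x + x' := rfl
  have a2 : A 2 = (x + x') * A 1 - x * x' * A 0 := rfl
  have a3 : A 3 = (x + x') * A 2 - x * x' * A 1 := rfl
  have b0 : B 0 = 1 := rfl
  have b1 : B 1 = y + y' := rfl
  have b2 : B 2 = (y + y') * B 1 - y * y' * B 0 := rfl
  have b3 : B 3 = (y + y') * B 2 - y * y' * B 1 := rfl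
  simp only [Finset.sum_range_succ, Finset.sum_range_zero, a3, b3, a2, b2, a1, b1, a0, b0] at h6
  have h7 : S = (1 - x * x' * (y * y') * T ^ 2) / ((1 - T * (x * y)) * (1 - T * (x * y')) *
        ((1 - T * (x' * y)) * (1 - T * (x' * y')))) := by
    rw [eq_div_iff (mul_ne_zero (mul_ne_zero (hne _ _ hx hy) (hne _ _ hx hy'))
      (mul_ne_zero (hne _ _ hx' hy) (hne _ _ hx' hy')))]
    linear_combination h6
  rw [← h7]
  exact hS

/-- The series over double cosets of the maximal compact subgroup. -/
lemma hasSum_spherical {x x' y y' T : ℂ} {r : ℝ} (hr : 0 ≤ r) (hr1 : r ≤ 1) (hT : ‖T‖ = r ^ 2)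
    (hx : ‖x‖ * r < 1) (hx' : ‖x'‖ * r < 1) (hy : ‖y‖ * r < 1) (hy' : ‖y'‖ * r < 1) :
    HasSum (fun t : Fin 2 × ℕ × ℕ => T ^ max (2 * t.2.1 + (t.1 : ℕ)) (2 * t.2.2 + (t.1 : ℕ)) *
      (doubleCosetEigenvalue (x + x') (x * x') (2 * t.2.1 + (t.1 : ℕ)) *
        doubleCosetEigenvalue (y + y') (y * y') (2 * t.2.2 + (t.1 : ℕ))))
      ((1 - T ^ 2) * ((1 - x * x' * (y * y') * T ^ 2) / ((1 - T * (x * y)) * (1 - T * (x * y')) *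
        ((1 - T * (x' * y)) * (1 - T * (x' * y')))))) := by
  set a := doubleCosetEigenvalue (x + x') (x * x') with ha
  set b := doubleCosetEigenvalue (y + y') (y * y') with hb
  have hC := hasSum_satakeSeq_mul hr hT hx hx' hy hy'
  set C : ℕ → ℂ := fun N =>
    T ^ N * (satakeSeq (x + x') (x * x') N * satakeSeq (y + y') (y * y') N) with hCdef
  have hinj : ∀ e : Fin 2, Function.Injective fun k : ℕ => 2 * k + (e : ℕ) := fun e i j h => by
    simp only at h; omega
  have hpow : ∀ (e : Fin 2) (n m : ℕ), T ^ max (2 * n + (e : ℕ)) (2 * m + (e : ℕ)) =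
      (T ^ 2) ^ max n m * T ^ (e : ℕ) := fun e n m => by
    rw [← pow_mul, ← pow_add]; congr 1; omega
  have hsum : ∀ e : Fin 2, HasSum (fun t : ℕ × ℕ => T ^ max (2 * t.1 + (e : ℕ)) (2 * t.2 + (e : ℕ)) *
      (a (2 * t.1 + e) * b (2 * t.2 + e))) ((1 - T ^ 2) * ∑' k, C (2 * k + e)) := fun e => by
    have h1 : Summable fun t : ℕ × ℕ => T ^ max (2 * t.1 + (e : ℕ)) (2 * t.2 + (e : ℕ)) *
        (a (2 * t.1 + e) * b (2 * t.2 + e)) := by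
      have h2 := ((summable_doubleCosetEigenvalue hr hx hx').comp_injective (hinj e)).mul_of_nonneg
        ((summable_doubleCosetEigenvalue hr hy hy').comp_injective (hinj e))
        (fun N => by simp only [Function.comp_apply]; positivity)
        (fun N => by simp only [Function.comp_apply]; positivity)
      refine Summable.of_norm_bounded h2 fun t => ?_
      rw [norm_mul, norm_mul, norm_pow, hT, ← pow_mul]
      -- Since $|T|=r^2$ and $2\max(N,M)\ge N+M$, the weight is at most $r^{N+M}$. The double series
      -- is then dominated by a product of two single series.
      have h3 : r ^ (2 * max (2 * t.1 + (e : ℕ)) (2 * t.2 + (e : ℕ))) ≤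
          r ^ ((2 * t.1 + (e : ℕ)) + (2 * t.2 + (e : ℕ))) :=
        pow_le_pow_of_le_one hr hr1 (by omega)
      calc _ ≤ r ^ ((2 * t.1 + (e : ℕ)) + (2 * t.2 + (e : ℕ))) *
            (‖a (2 * t.1 + e)‖ * ‖b (2 * t.2 + e)‖) := by gcongr
        _ = _ := by simp only [Function.comp_apply]; rw [pow_add]; ring
    have h4 : HasSum (fun k => C (2 * k + e)) (∑' k, C (2 * k + e)) :=
      (hC.summable.comp_injective (hinj e)).hasSum
    -- Within one parity class the shell parameter is $T^2$, and the partial sums of eigenvalues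
    -- telescope to `satakeSeq`.
    have h5 := hasSum_max (a := fun n => T ^ (e : ℕ) * a (2 * n + e)) (b := fun m => b (2 * m + e))
      (r := T ^ 2) (T := ∑' k, C (2 * k + e)) (h1.congr fun t => by rw [hpow]; ring) (by
        refine h4.congr_fun fun j => ?_
        rw [← Finset.mul_sum, sum_doubleCosetEigenvalue, sum_doubleCosetEigenvalue, hCdef]
        simp only
        rw [pow_add, pow_mul]; ring)
    refine h5.congr_fun fun t => ?_
    rw [hpow]; ring
  have h6 := hasSum_fin_prod (f := fun t : Fin 2 × ℕ × ℕ =>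
    T ^ max (2 * t.2.1 + (t.1 : ℕ)) (2 * t.2.2 + (t.1 : ℕ)) *
      (a (2 * t.2.1 + (t.1 : ℕ)) * b (2 * t.2.2 + (t.1 : ℕ)))) hsum
  have h7 := ((hC.summable.comp_injective (hinj 0)).hasSum.even_add_odd
    (hC.summable.comp_injective (hinj 1)).hasSum).unique hC
  rw [← h7, mul_add]
  rw [Fin.sum_univ_two] at h6
  exact h6

lemma hasSum_natAbs {g : ℕ → ℂ} {s : ℂ} (h : HasSum g s) :
    HasSum (fun n : ℤ => g n.natAbs) (2 * s - g 0) := by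
  have h1 := (hasSum_nat_add_iff' 1).mpr h
  have h2 := HasSum.of_nat_of_neg_add_one (f := fun n : ℤ => g n.natAbs) (m := s)
    (by simpa using h) (m' := s - ∑ i ∈ Finset.range 1, g i) (h1.congr_fun fun n => by
      congr 1)
  convert h2 using 1
  simp
  ring

lemma summable_natAbs {g : ℕ → ℝ} (h : Summable g) : Summable fun n : ℤ => g n.natAbs :=
  Summable.of_nat_of_neg_add_one (by simpa using h) (((summable_nat_add_iff 1).mpr h).congr
    fun n => by congr 1)

/-- The weight is constant for $|m|\le k$, where the signs sum to a partial alternating sum, and the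
remainder is a geometric tail of ratio $-T$. Doubling and removing the term at $m=0$ cancels the
non-alternating part. -/
lemma hasSum_alternating_max {T : ℂ} (hT : ‖T‖ < 1) (k : ℕ) :
    HasSum (fun m : ℤ => T ^ max k m.natAbs * (-1) ^ m.natAbs) ((-T) ^ k * ((1 - T) / (1 + T))) := by
  have h0 : (1 : ℂ) + T ≠ 0 := fun h => by
    rw [add_comm, ← eq_neg_iff_add_eq_zero] at h
    rw [h, norm_neg, norm_one] at hT
    exact lt_irrefl _ hT
  have h1 : HasSum (fun m : ℕ => T ^ max k (m + k) * (-1 : ℂ) ^ (m + k)) ((-T) ^ k * (1 + T)⁻¹) := by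
    have h2 := (hasSum_geometric_of_norm_lt_one (ξ := -T) (by rwa [norm_neg])).mul_left ((-T) ^ k)
    rw [sub_neg_eq_add] at h2
    refine h2.congr_fun fun m => ?_
    rw [max_eq_right (Nat.le_add_left k m), ← mul_pow, ← pow_add]
    congr 1 <;> ring
  have h3 := (hasSum_nat_add_iff (f := fun m : ℕ => T ^ max k m * (-1 : ℂ) ^ m) k).mp h1
  have h4 : ∀ j : ℕ, 2 * ∑ i ∈ Finset.range j, (-1 : ℂ) ^ i = 1 - (-1) ^ j := fun j => by
    induction j with
    | zero => simp
    | succ j ih => rw [Finset.sum_range_succ, mul_add, ih]; ring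
  have h5 : ∑ i ∈ Finset.range k, T ^ max k i * (-1 : ℂ) ^ i =
      T ^ k * ∑ i ∈ Finset.range k, (-1 : ℂ) ^ i := by
    rw [Finset.mul_sum]
    exact Finset.sum_congr rfl fun i hi => by rw [max_eq_left (Finset.mem_range.mp hi).le]
  convert hasSum_natAbs h3 using 1
  rw [h5, mul_add, mul_left_comm 2 (T ^ k), h4, neg_pow T]
  simp only [Nat.zero_le, max_eq_left, pow_zero, mul_one]
  field_simp
  ring

/-- The series over double cosets of the Iwahori subgroup. -/
lemma hasSum_iwahori {z : ℕ → ℂ} {ε δ T s : ℂ} {r : ℝ} (hr : 0 ≤ r) (hr1 : r < 1)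
    (hT : ‖T‖ = r ^ 2) (hε : ‖ε‖ = 1) (hz : Summable fun N => ‖z N‖ * r ^ N)
    (hs : HasSum (fun N => (-(T * ε)) ^ N * z N) s) :
    HasSum (fun t : Fin 2 × ℤ × ℤ => T ^ (1 + max t.2.1.natAbs t.2.2.natAbs) *
      (δ ^ (t.1 : ℕ) * ((ε ^ t.2.1.natAbs * z t.2.1.natAbs) * (-1) ^ t.2.2.natAbs)))
      (T * (1 + δ) * ((1 - T) / (1 + T) * (2 * s - z 0))) := by
  have hT1 : ‖T‖ < 1 := by rw [hT]; exact pow_lt_one₀ hr hr1 two_ne_zero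
  set f : ℤ × ℤ → ℂ := fun t => T ^ max t.1.natAbs t.2.natAbs *
    ((ε ^ t.1.natAbs * z t.1.natAbs) * (-1) ^ t.2.natAbs) with hf
  have hsum : Summable f := by
    have h2 := (summable_natAbs hz).mul_of_nonneg
      (summable_natAbs (summable_geometric_of_lt_one hr hr1))
      (fun N => by positivity) (fun N => by positivity)
    refine Summable.of_norm_bounded h2 fun t => ?_
    rw [hf]
    simp only [norm_mul, norm_pow, hT, hε, one_pow, norm_neg, norm_one, mul_one, one_mul]
    rw [← pow_mul]
    have h3 : r ^ (2 * max t.1.natAbs t.2.natAbs) ≤ r ^ (t.1.natAbs + t.2.natAbs) :=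
      pow_le_pow_of_le_one hr hr1.le (by omega)
    calc _ ≤ r ^ (t.1.natAbs + t.2.natAbs) * ‖z t.1.natAbs‖ := by gcongr
      _ = _ := by rw [pow_add]; ring
  have hin : ∀ n : ℤ, HasSum (fun m => f (n, m))
      ((1 - T) / (1 + T) * ((-(T * ε)) ^ n.natAbs * z n.natAbs)) := fun n => by
    have h1 := (hasSum_alternating_max hT1 n.natAbs).mul_left (ε ^ n.natAbs * z n.natAbs)
    rw [show (1 - T) / (1 + T) * ((-(T * ε)) ^ n.natAbs * z n.natAbs) =
      ε ^ n.natAbs * z n.natAbs * ((-T) ^ n.natAbs * ((1 - T) / (1 + T))) by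
        rw [show -(T * ε) = -T * ε by ring, mul_pow]; ring]
    exact h1.congr_fun fun m => by simp only [hf]; ring
  have htot : HasSum f ((1 - T) / (1 + T) * (2 * s - z 0)) := by
    have h1 := hsum.hasSum.prod_fiberwise hin
    have h2 := (hasSum_natAbs hs).mul_left ((1 - T) / (1 + T))
    rw [pow_zero, one_mul] at h2
    exact h1.unique h2 ▸ hsum.hasSum
  have h3 : ∀ e : Fin 2, HasSum (fun t : ℤ × ℤ => T ^ (1 + max t.1.natAbs t.2.natAbs) *
      (δ ^ (e : ℕ) * ((ε ^ t.1.natAbs * z t.1.natAbs) * (-1) ^ t.2.natAbs)))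
      (T * δ ^ (e : ℕ) * ((1 - T) / (1 + T) * (2 * s - z 0))) := fun e => by
    refine (htot.mul_left (T * δ ^ (e : ℕ))).congr_fun fun t => ?_
    simp only [hf]; ring
  convert hasSum_fin_prod (f := fun t : Fin 2 × ℤ × ℤ => T ^ (1 + max t.2.1.natAbs t.2.2.natAbs) *
      (δ ^ (t.1 : ℕ) * ((ε ^ t.2.1.natAbs * z t.2.1.natAbs) * (-1) ^ t.2.2.natAbs))) h3 using 1
  rw [Fin.sum_univ_two]
  simp
  ring

/-- The generating series of a linear recurrence of order two. -/
lemma hasSum_recurrence {z : ℕ → ℂ} {x x' u : ℂ}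
    (hz : ∀ N, z (N + 2) = (x + x') * z (N + 1) - x * x' * z N)
    (hx : ‖x‖ * ‖u‖ < 1) (hx' : ‖x'‖ * ‖u‖ < 1) :
    HasSum (fun N => u ^ N * z N)
      ((z 0 + (z 1 - (x + x') * z 0) * u) / ((1 - x * u) * (1 - x' * u))) := by
  have hsum : Summable fun N => u ^ N * z N := by
    refine Summable.of_norm ((summable_of_recurrence hz (norm_nonneg u) hx hx').congr fun N => ?_)
    rw [norm_mul, norm_pow, mul_comm]
  have hne : ∀ v : ℂ, ‖v‖ * ‖u‖ < 1 → 1 - v * u ≠ 0 := fun v hv h0 => by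
    rw [← norm_mul, ← sub_eq_zero.mp h0, norm_one] at hv
    exact lt_irrefl _ hv
  obtain ⟨S, hS⟩ := hsum
  have h1 := (hasSum_nat_add_iff' 1).mpr hS
  have h2 := (hasSum_nat_add_iff' 2).mpr hS
  have hrec : ∀ N, u ^ (N + 2) * z (N + 2) =
      (x + x') * u * (u ^ (N + 1) * z (N + 1)) - x * x' * u ^ 2 * (u ^ N * z N) := fun N => by
    rw [hz]; ring
  simp only [hrec] at h2
  have h3 := h2.unique ((h1.mul_left ((x + x') * u)).sub (hS.mul_left (x * x' * u ^ 2)))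
  simp only [Finset.sum_range_succ, Finset.sum_range_zero] at h3
  have h4 : S = (z 0 + (z 1 - (x + x') * z 0) * u) / ((1 - x * u) * (1 - x' * u)) := by
    rw [eq_div_iff (mul_ne_zero (hne x hx) (hne x' hx'))]
    linear_combination h3
  exact h4 ▸ hS

/-! ### Weights and zeta factors as powers of $p^{-1}$. -/

lemma weight_eq {p : ℕ} (k : ℕ) : (((p : ℝ) ^ (-2 * (k : ℤ)) : ℝ) : ℂ) = ((p : ℂ)⁻¹ ^ 2) ^ k := by
  rw [← pow_mul, inv_pow, Complex.ofReal_zpow, Complex.ofReal_natCast, neg_mul, zpow_neg]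
  norm_cast

lemma norm_inv_prime_sq {p : ℕ} : ‖(p : ℂ)⁻¹ ^ 2‖ = ((p : ℝ)⁻¹) ^ 2 := by
  rw [norm_pow, norm_inv, Complex.norm_natCast]

lemma zetaFactor_natCast {p : ℕ} (n : ℕ) : zetaFactor p n = (1 - (p : ℂ)⁻¹ ^ n)⁻¹ := by
  rw [zetaFactor, Complex.cpow_neg, Complex.cpow_natCast, inv_pow]

lemma zetaFactor_one {p : ℕ} : zetaFactor p 1 = (1 - (p : ℂ)⁻¹)⁻¹ := by
  simpa using zetaFactor_natCast (p := p) 1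

lemma zetaFactor_two {p : ℕ} : zetaFactor p 2 = (1 - (p : ℂ)⁻¹ ^ 2)⁻¹ := by
  simpa using zetaFactor_natCast (p := p) 2

lemma zetaFactor_four {p : ℕ} : zetaFactor p 4 = (1 - (p : ℂ)⁻¹ ^ 4)⁻¹ := by
  simpa using zetaFactor_natCast (p := p) 4

lemma one_sub_inv_pow_ne_zero {n : ℕ} (hn : n ≠ 0) : 1 - (p : ℂ)⁻¹ ^ n ≠ 0 := fun h => by
  have h1 : ‖(p : ℂ)⁻¹ ^ n‖ = 1 := by rw [← sub_eq_zero.mp h, norm_one]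
  rw [norm_pow, norm_inv, Complex.norm_natCast] at h1
  exact (pow_lt_one₀ (inv_nonneg.mpr prime_real_pos.le)
    (inv_lt_one_of_one_lt₀ one_lt_prime_real) hn).ne h1

lemma one_add_inv_sq_ne_zero : 1 + (p : ℂ)⁻¹ ^ 2 ≠ 0 := fun h => by
  apply one_sub_inv_pow_ne_zero (p := p) (n := 4) (by norm_num)
  linear_combination (1 - (p : ℂ)⁻¹ ^ 2) * h

/-! ### Double coset operators on new vectors. -/

section Family

variable {W : Type*} [AddCommGroup W] [Module ℂ W] {ρ : Representation ℂ (GL (Fin 2) ℚ_[p]) W}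

/-- The vectors $f$ and $\eta f$ are stable under $U_p$, with $U_pf=cf-\eta f$ and $U_p\eta f=pf$.
The characteristic polynomial $X^2-cX+p$ is the one defining `satakeSeq`. -/
lemma heckeU_pow_spherical (hρ : CentreTrivial ρ) {f : W} (hf : ∀ k ∈ eichlerSubgroup p 0, ρ k f = f)
    {c : ℂ} (hc : heckeU ρ f + ρ (eta p) f = c • f) (N : ℕ) :
    (heckeU ρ ^ (N + 1)) f =
      satakeSeq c p (N + 1) • f - satakeSeq c p N • ρ (eta p) f := by
  induction N with
  | zero =>
    rw [zero_add, pow_one, eq_sub_of_add_eq hc]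
    simp [satakeSeq]
  | succ N ih =>
    rw [pow_succ', Module.End.mul_apply, ih, map_sub, map_smul, map_smul, heckeU_eta hρ hf,
      eq_sub_of_add_eq hc, satakeSeq]
    module

/-- In $U_p^Nf+\eta U_p^{N-1}f$ the multiples of $\eta f$ cancel, because $\eta^2$ acts trivially,
and the coefficient $h_N-h_{N-2}$ remains. -/
lemma sum_sphericalRep_apply (hρ : CentreTrivial ρ) {f : W}
    (hf : ∀ k ∈ eichlerSubgroup p 0, ρ k f = f) {c : ℂ}
    (hc : heckeU ρ f + ρ (eta p) f = c • f) (e : Fin 2) (n : ℕ) :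
    ∑ i, ρ (sphericalRep p e n i) f = doubleCosetEigenvalue c p (2 * n + (e : ℕ)) • f := by
  rw [sum_sphericalRep hρ]
  rcases 2 * n + (e : ℕ) with _ | _ | N
  · simp [doubleCosetEigenvalue]
  · simpa [doubleCosetEigenvalue] using hc
  · rw [if_neg (by omega), Nat.add_sub_cancel, heckeU_pow_spherical hρ hf hc,
      heckeU_pow_spherical hρ hf hc, map_sub, map_smul, map_smul, hρ.atkinLehner_sq,
      doubleCosetEigenvalue]
    module

lemma heckeU_pow_of_eigen {f : W} {a : ℂ} (h : heckeU ρ f = a • f) (N : ℕ) :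
    (heckeU ρ ^ N) f = a ^ N • f := by
  induction N with
  | zero => simp
  | succ N ih => rw [pow_succ', Module.End.mul_apply, ih, map_smul, h, smul_smul, pow_succ]

/-- With $U_p=-\varepsilon$ and $\eta=\varepsilon$, the signs $\varepsilon^{|n|}$ cancel and only
$\varepsilon^e(-1)^{|n|}$ survives. -/
lemma sum_iwahoriRep_special (hρ : CentreTrivial ρ) {f : W} {ε : ℂ} (hε : ε * ε = 1)
    (hη : ρ (eta p) f = ε • f) (hU : heckeU ρ f = -ε • f) (e : Fin 2) (n : ℤ) :
    ∑ x, ρ (iwahoriRep p e n x) f = (ε ^ (e : ℕ) * (-1) ^ n.natAbs) • f := by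
  have hpow : ∀ k : ℕ, ε ^ k * ε ^ k = 1 := fun k => by rw [← mul_pow, hε, one_pow]
  rw [sum_iwahoriRep hρ e n hη, heckeU_pow_of_eigen hU, neg_pow]
  split_ifs
  · rw [smul_smul]
    congr 1
    rw [pow_add]
    linear_combination (ε ^ (e : ℕ) * (-1) ^ n.natAbs) * hpow n.natAbs
  · rw [map_smul, hη, smul_smul, smul_smul]
    congr 1
    rw [pow_add, pow_add]
    linear_combination (ε ^ (e : ℕ) * (-1) ^ n.natAbs) * (ε * ε * hpow n.natAbs + hε)

end Family

/-- The identity behind the evaluation of the Iwahori series for a principal series and a special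
representation. -/
lemma iwahori_series_identity {x x' ε β t P : ℂ} (hx : x * x' = P) (hP : P * t = 1)
    (hε : ε * ε = 1) (hT : 1 + t ^ 2 ≠ 0) (hD : 1 - x * -(t ^ 2 * ε) ≠ 0)
    (hD' : 1 - x' * -(t ^ 2 * ε) ≠ 0) :
    (1 - t ^ 2) / (1 + t ^ 2) *
      (2 * ((2 * β + ((x + x' + ε * P - ε) * β - (x + x') * (2 * β)) * -(t ^ 2 * ε)) /
        ((1 - x * -(t ^ 2 * ε)) * (1 - x' * -(t ^ 2 * ε)))) - 2 * β) =
      ((1 - x * -(t ^ 2 * ε)) * (1 - x' * -(t ^ 2 * ε)))⁻¹ /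
        ((1 - t)⁻¹ * (1 - t ^ 2)⁻¹) * (2 * β) := by
  have hDD := mul_ne_zero hD hD'
  -- Here $t=p^{-1}$ and $P=p$, so $xx't^4=t^3$. After this the identity depends on $x,x'$ only
  -- through $(x+x')t^2\varepsilon$.
  have e1 : (1 - x * -(t ^ 2 * ε)) * (1 - x' * -(t ^ 2 * ε)) =
      1 + (x + x') * (t ^ 2 * ε) + t ^ 3 := by
    linear_combination t ^ 4 * ε * ε * hx + t ^ 4 * P * hε + t ^ 3 * hP
  have e2 : 2 * β + ((x + x' + ε * P - ε) * β - (x + x') * (2 * β)) * -(t ^ 2 * ε) =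
      β * (2 + (x + x') * (t ^ 2 * ε) - t + t ^ 2) := by
    linear_combination (β * t ^ 2 - β * P * t ^ 2) * hε - β * t * hP
  rw [e2]
  rw [e1] at hDD ⊢
  generalize (x + x') * (t ^ 2 * ε) = c at *
  rw [div_eq_mul_inv _ ((1 - t)⁻¹ * _), mul_inv, inv_inv, inv_inv]
  field_simp
  ring

/-! ### The zeta integrals for the possible pairs of types. -/

section Main

variable {W₁ W₂ : Type*} [AddCommGroup W₁] [Module ℂ W₁] [AddCommGroup W₂] [Module ℂ W₂]
  {π₁ : Representation ℂ PGL(2, ℚ_[p]) W₁} {π₂ : Representation ℂ PGL(2, ℚ_[p]) W₂}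
  {B : W₁ ⊗[ℂ] W₂ →ₗ[ℂ] W₁ ⊗[ℂ] W₂ →ₗ⋆[ℂ] ℂ}

/-- The Hecke eigenvalue in the first factor. -/
lemma exists_real_eigenvalue_left (hB : IsInvariantHermitian (sigma π₁ π₂) B) {f₁ : W₁} {f₂ : W₂}
    (hB1 : B (f₁ ⊗ₜ[ℂ] f₂) (f₁ ⊗ₜ[ℂ] f₂) = 1)
    (hf₁ : ∀ k ∈ eichlerSubgroup p 0, glRep π₁ k f₁ = f₁) {c : ℂ}
    (hc : heckeU (glRep π₁) f₁ + glRep π₁ (eta p) f₁ = c • f₁) :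
    ∃ t : ℝ, c = t ∧ |t| ≤ p + 1 := by
  let ρ : Representation ℂ (GL (Fin 2) ℚ_[p]) (W₁ ⊗[ℂ] W₂) :=
    (sigma π₁ π₂).comp ((QuotientGroup.mk' (center2 p)).comp (MonoidHom.inl _ _))
  have hρ : ∀ g v w, ρ g (v ⊗ₜ[ℂ] w) = glRep π₁ g v ⊗ₜ[ℂ] w := fun g v w => by
    change glRep π₁ g v ⊗ₜ[ℂ] glRep π₂ 1 w = _
    rw [map_one]; rfl
  refine exists_real_eigenvalue (ρ := ρ) (f := f₁ ⊗ₜ[ℂ] f₂) (fun z => ?_) hB.hermitian hB.pos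
    (fun g x y => hB.invariant _ x y) hB1 (fun k hk => by rw [hρ, hf₁ k hk]) ?_
  · refine TensorProduct.ext' fun v w => ?_
    rw [hρ, centreTrivial_glRep]; rfl
  · rw [heckeU_apply]
    simp_rw [hρ]
    rw [← TensorProduct.sum_tmul, ← TensorProduct.add_tmul, ← heckeU_apply, hc,
      TensorProduct.smul_tmul']

/-- The Hecke eigenvalue in the second factor. -/
lemma exists_real_eigenvalue_right (hB : IsInvariantHermitian (sigma π₁ π₂) B) {f₁ : W₁} {f₂ : W₂}
    (hB1 : B (f₁ ⊗ₜ[ℂ] f₂) (f₁ ⊗ₜ[ℂ] f₂) = 1)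
    (hf₂ : ∀ k ∈ eichlerSubgroup p 0, glRep π₂ k f₂ = f₂) {c : ℂ}
    (hc : heckeU (glRep π₂) f₂ + glRep π₂ (eta p) f₂ = c • f₂) :
    ∃ t : ℝ, c = t ∧ |t| ≤ p + 1 := by
  let ρ : Representation ℂ (GL (Fin 2) ℚ_[p]) (W₁ ⊗[ℂ] W₂) :=
    (sigma π₁ π₂).comp ((QuotientGroup.mk' (center2 p)).comp (MonoidHom.inr _ _))
  have hρ : ∀ g v w, ρ g (v ⊗ₜ[ℂ] w) = v ⊗ₜ[ℂ] glRep π₂ g w := fun g v w => by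
    change glRep π₁ 1 v ⊗ₜ[ℂ] glRep π₂ g w = _
    rw [map_one]; rfl
  refine exists_real_eigenvalue (ρ := ρ) (f := f₁ ⊗ₜ[ℂ] f₂) (fun z => ?_) hB.hermitian hB.pos
    (fun g x y => hB.invariant _ x y) hB1 (fun k hk => by rw [hρ, hf₂ k hk]) ?_
  · refine TensorProduct.ext' fun v w => ?_
    rw [hρ, centreTrivial_glRep]; rfl
  · rw [heckeU_apply]
    simp_rw [hρ]
    rw [← TensorProduct.tmul_sum, ← TensorProduct.tmul_add, ← heckeU_apply, hc,
      TensorProduct.tmul_smul]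

/-- The Satake parameters of a principal series component of a unitary representation. -/
lemma satake_parameters {W : Type*} [AddCommGroup W] [Module ℂ W]
    {π : Representation ℂ PGL(2, ℚ_[p]) W} {μ ν : ℚ_[p]ˣ →* ℂˣ} (h : HasType π (.principal μ ν))
    {f : W} (hf : f ≠ 0) {t : ℝ}
    (ht : (Real.sqrt p : ℂ) * ((μ (pUnit p) : ℂ) + (ν (pUnit p) : ℂ)) = t) (htp : |t| ≤ p + 1) :
    (Real.sqrt p * μ (pUnit p) : ℂ) * (Real.sqrt p * ν (pUnit p)) = p ∧
      ‖(Real.sqrt p * μ (pUnit p) : ℂ)‖ * (p : ℝ)⁻¹ < 1 ∧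
      ‖(Real.sqrt p * ν (pUnit p) : ℂ)‖ * (p : ℝ)⁻¹ < 1 := by
  have hp := prime_real_pos (p := p)
  have hpC : (p : ℂ) ≠ 0 := Nat.cast_ne_zero.mpr (Fact.out : p.Prime).ne_zero
  have hs2 : (Real.sqrt p : ℂ) ^ 2 = p := by
    rw [← Complex.ofReal_pow, Real.sq_sqrt hp.le, Complex.ofReal_natCast]
  have hμν := principal_central_character h hf (pUnit p)
  have hprod : (Real.sqrt p * μ (pUnit p) : ℂ) * (Real.sqrt p * ν (pUnit p)) = p := by
    linear_combination (Real.sqrt p : ℂ) ^ 2 * hμν + hs2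
  have habs : (absChar p (pUnit p) : ℂ) = (p : ℂ)⁻¹ := by
    rw [coe_absChar, coe_pUnit, Padic.norm_p]; simp
  have hinv : (ν (pUnit p))⁻¹ = μ (pUnit p) :=
    (eq_inv_of_mul_eq_one_left (Units.ext (by simpa using hμν))).symm
  have hunr : IsUnramified (μ * ν⁻¹) := fun u hu => by
    rw [MonoidHom.mul_apply, MonoidHom.inv_apply, h.1 u hu, h.2.1 u hu, inv_one, mul_one]
  -- As $\mu\nu=1$ at $p$, the equality $x^2=p^2$ would give $\mu\nu^{-1}(p)=\mu(p)^2=p$, that is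
  -- $\mu\nu^{-1}=|\cdot|^{-1}$. The other parameter meets the other excluded character.
  have hμ2 : (Real.sqrt p * μ (pUnit p) : ℂ) ^ 2 ≠ (p : ℂ) ^ 2 := fun h0 => by
    refine h.2.2.2.1 (hunr.ext (fun u hu => ?_) (Units.ext ?_))
    · rw [MonoidHom.inv_apply, isUnramified_absChar u hu, inv_one]
    · rw [MonoidHom.mul_apply, MonoidHom.inv_apply, MonoidHom.inv_apply, hinv,
        Units.val_inv_eq_inv_val, habs, inv_inv, Units.val_mul]
      apply mul_left_cancel₀ hpC
      rw [mul_pow, hs2] at h0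
      linear_combination h0
  have hν2 : (Real.sqrt p * ν (pUnit p) : ℂ) ^ 2 ≠ (p : ℂ) ^ 2 := fun h0 => by
    refine h.2.2.1 (hunr.ext isUnramified_absChar (Units.ext ?_))
    rw [MonoidHom.mul_apply, MonoidHom.inv_apply, hinv, habs, Units.val_mul]
    apply mul_left_cancel₀ hpC
    rw [mul_pow, hs2] at h0
    have h1 : (ν (pUnit p) : ℂ) ^ 2 = p := by
      apply mul_left_cancel₀ hpC
      linear_combination h0
    rw [mul_inv_cancel₀ hpC, ← h1]
    linear_combination ((μ (pUnit p) : ℂ) * ν (pUnit p) + 1) * hμν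
  have hdiv : ∀ y : ℂ, ‖y‖ < p → ‖y‖ * (p : ℝ)⁻¹ < 1 := fun y hy => by
    rwa [← div_eq_mul_inv, div_lt_one hp]
  refine ⟨hprod, hdiv _ (norm_lt_of_add_real hprod (by rw [← ht]; ring) htp hμ2), hdiv _ ?_⟩
  exact norm_lt_of_add_real ((mul_comm _ _).trans hprod) (by rw [← ht]; ring) htp hν2

variable {ψ : AddChar ℚ_[p] Circle} {dx : Measure (X p)}

/-- The zeta integral in the unramified case. -/
theorem zeta_principal_principal {μ ν μ' ν' : ℚ_[p]ˣ →* ℂˣ} (h₁ : HasType π₁ (.principal μ ν))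
    (h₂ : HasType π₂ (.principal μ' ν')) {f₁ : W₁} {f₂ : W₂}
    (hf₁ : ∀ k ∈ eichlerSubgroup p 0, glRep π₁ k f₁ = f₁)
    (hf₂ : ∀ k ∈ eichlerSubgroup p 0, glRep π₂ k f₂ = f₂) (hf₁0 : f₁ ≠ 0) (hf₂0 : f₂ ≠ 0)
    (hB : IsInvariantHermitian (sigma π₁ π₂) B) (hB1 : B (f₁ ⊗ₜ[ℂ] f₂) (f₁ ⊗ₜ[ℂ] f₂) = 1)
    (hψ : HasConductorZp ψ) (hdx : IsSelfDual ψ dx) (dh : Measure (H01 p)) [dh.IsHaarMeasure] :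
    Integrable (zetaIntegrand dx (sigma π₁ π₂) B (phiStar p 0) (f₁ ⊗ₜ[ℂ] f₂)) dh ∧
      localZetaIntegral dx dh (sigma π₁ π₂) B (phiStar p 0) (f₁ ⊗ₜ[ℂ] f₂) =
        (dh.real (calU p 0) : ℂ) * (asaiLFactor (.principal μ ν) (.principal μ' ν') 1 /
          (zetaFactor p 2 * zetaFactor p 4)) := by
  have hp := prime_real_pos (p := p)
  have hpC : (p : ℂ) ≠ 0 := Nat.cast_ne_zero.mpr (Fact.out : p.Prime).ne_zero
  have hc₁ := principal_heckeU h₁ hf₁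
  have hc₂ := principal_heckeU h₂ hf₂
  obtain ⟨t₁, ht₁, htp₁⟩ := exists_real_eigenvalue_left hB hB1 hf₁ hc₁
  obtain ⟨t₂, ht₂, htp₂⟩ := exists_real_eigenvalue_right hB hB1 hf₂ hc₂
  obtain ⟨hx, hx1, hx2⟩ := satake_parameters h₁ hf₁0 ht₁ htp₁
  obtain ⟨hy, hy1, hy2⟩ := satake_parameters h₂ hf₂0 ht₂ htp₂
  have hS := hasSum_spherical (T := (p : ℂ)⁻¹ ^ 2) (inv_nonneg.mpr hp.le)
    (inv_le_one_of_one_le₀ one_lt_prime_real.le) norm_inv_prime_sq hx1 hx2 hy1 hy2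
  rw [hx, hy, ← mul_add, ← mul_add] at hS
  -- For $T=p^{-2}$ the factors $1-T^2$ and $1-xx'yy'T^2=1-p^{-2}$ are $\zeta_p(4)^{-1}$ and
  -- $\zeta_p(2)^{-1}$. The factors $1-Tx_iy_j$ form the Euler factor at $s=1$.
  have hval : (1 - ((p : ℂ)⁻¹ ^ 2) ^ 2) * ((1 - p * p * ((p : ℂ)⁻¹ ^ 2) ^ 2) /
      ((1 - (p : ℂ)⁻¹ ^ 2 * (Real.sqrt p * μ (pUnit p) * (Real.sqrt p * μ' (pUnit p)))) *
        (1 - (p : ℂ)⁻¹ ^ 2 * (Real.sqrt p * μ (pUnit p) * (Real.sqrt p * ν' (pUnit p)))) *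
        ((1 - (p : ℂ)⁻¹ ^ 2 * (Real.sqrt p * ν (pUnit p) * (Real.sqrt p * μ' (pUnit p)))) *
        (1 - (p : ℂ)⁻¹ ^ 2 * (Real.sqrt p * ν (pUnit p) * (Real.sqrt p * ν' (pUnit p))))))) =
      asaiLFactor (.principal μ ν) (.principal μ' ν') 1 / (zetaFactor p 2 * zetaFactor p 4) := by
    have hs2 : (Real.sqrt p : ℂ) * (Real.sqrt p : ℂ) = p := by
      rw [← Complex.ofReal_mul, Real.mul_self_sqrt hp.le, Complex.ofReal_natCast]
    have hfac : ∀ a b : ℂ, (p : ℂ)⁻¹ ^ 2 * (Real.sqrt p * a * (Real.sqrt p * b)) =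
        (p : ℂ)⁻¹ * (a * b) := fun a b => by
      rw [show (Real.sqrt p : ℂ) * a * (Real.sqrt p * b) =
        (Real.sqrt p * Real.sqrt p : ℂ) * (a * b) by ring, hs2]
      field_simp
    simp only [hfac]
    rw [asaiLFactor_principal_principal, zetaFactor_two, zetaFactor_four,
      show (p : ℂ) * p * ((p : ℂ)⁻¹ ^ 2) ^ 2 = (p : ℂ)⁻¹ ^ 2 by field_simp, ← mul_inv,
      div_eq_mul_inv, div_eq_mul_inv, inv_inv]
    ring
  rw [hval] at hS
  refine CosetReps.zeta_eq (sphericalReps p) (fun e n => ⟨_, fun x => sphericalRep_eq e n x⟩)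
    (fun q => ((p : ℂ)⁻¹ ^ 2) ^ max (2 * q.2.1 + (q.1 : ℕ)) (2 * q.2.2 + (q.1 : ℕ)))
    (fun q x => (weilPairing_sphericalRep hψ hdx q.1 q.2.1 q.2.2 x.1 x.2 _).trans (weight_eq _))
    hB hf₁ hf₂ dh (hS.congr_fun fun q => ?_)
  have e1 : ∑ x, glRep π₁ ((sphericalReps p).rep q.1 q.2.1 x) f₁ = _ :=
    sum_sphericalRep_apply (centreTrivial_glRep π₁) hf₁ hc₁ q.1 q.2.1
  have e2 : ∑ x, glRep π₂ ((sphericalReps p).rep q.1 q.2.2 x) f₂ = _ :=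
    sum_sphericalRep_apply (centreTrivial_glRep π₂) hf₂ hc₂ q.1 q.2.2
  rw [e1, e2, TensorProduct.smul_tmul_smul, map_smul, LinearMap.smul_apply, hB1, smul_eq_mul,
    mul_one]

/-- $\eta$ acts as a unitary involution, hence is self-adjoint. -/
lemma apply_eta_left (hB : IsInvariantHermitian (sigma π₁ π₂) B) (v w : W₁) (f₂ : W₂) :
    B (glRep π₁ (eta p) v ⊗ₜ[ℂ] f₂) (w ⊗ₜ[ℂ] f₂) =
      B (v ⊗ₜ[ℂ] f₂) (glRep π₁ (eta p) w ⊗ₜ[ℂ] f₂) := by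
  have h := hB.invariant (QuotientGroup.mk (eta p, 1)) (v ⊗ₜ[ℂ] f₂)
    (glRep π₁ (eta p) w ⊗ₜ[ℂ] f₂)
  rw [sigma_mk, sigma_mk, (centreTrivial_glRep π₁).atkinLehner_sq, map_one] at h
  exact h

/-- The zeta integral at Iwahori level, in terms of the generating series of matrix coefficients
of powers of `U_p`. -/
theorem zeta_iwahori (hB : IsInvariantHermitian (sigma π₁ π₂) B) {g₁ : W₁} {f₂ : W₂}
    (hg₁ : ∀ k ∈ eichlerSubgroup p 1, glRep π₁ k g₁ = g₁)
    (hf₂ : ∀ k ∈ eichlerSubgroup p 1, glRep π₂ k f₂ = f₂) {ε₁ ε₂ : ℂ} (hε₁ : ε₁ * ε₁ = 1)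
    (hε₂ : ε₂ * ε₂ = 1) (hη₁ : glRep π₁ (eta p) g₁ = ε₁ • g₁)
    (hη₂ : glRep π₂ (eta p) f₂ = ε₂ • f₂) (hU₂ : heckeU (glRep π₂) f₂ = -ε₂ • f₂) {z : ℕ → ℂ}
    (hz : ∀ N, z N = B ((heckeU (glRep π₁) ^ N) g₁ ⊗ₜ[ℂ] f₂) (g₁ ⊗ₜ[ℂ] f₂))
    (hzs : Summable fun N => ‖z N‖ * (p : ℝ)⁻¹ ^ N) {s : ℂ}
    (hs : HasSum (fun N => (-((p : ℂ)⁻¹ ^ 2 * ε₁)) ^ N * z N) s) (hψ : HasConductorZp ψ)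
    (hdx : IsSelfDual ψ dx) (dh : Measure (H01 p)) [dh.IsHaarMeasure] :
    Integrable (zetaIntegrand dx (sigma π₁ π₂) B (phiStar p 1) (g₁ ⊗ₜ[ℂ] f₂)) dh ∧
      localZetaIntegral dx dh (sigma π₁ π₂) B (phiStar p 1) (g₁ ⊗ₜ[ℂ] f₂) =
        (dh.real (calU p 1) : ℂ) * ((p : ℂ)⁻¹ ^ 2 * (1 + ε₁ * ε₂) *
          ((1 - (p : ℂ)⁻¹ ^ 2) / (1 + (p : ℂ)⁻¹ ^ 2) * (2 * s - z 0))) := by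
  have hp := prime_real_pos (p := p)
  have hsign : ε₁ = 1 ∨ ε₁ = -1 := mul_self_eq_one_iff.mp hε₁
  have hconj : (starRingEnd ℂ) ε₁ = ε₁ := by rcases hsign with h | h <;> simp [h]
  have hS := hasSum_iwahori (δ := ε₁ * ε₂) (T := (p : ℂ)⁻¹ ^ 2) (inv_nonneg.mpr hp.le)
    (inv_lt_one_of_one_lt₀ one_lt_prime_real) norm_inv_prime_sq
    (by rcases hsign with h | h <;> simp [h]) hzs hs
  refine CosetReps.zeta_eq (iwahoriReps p)
    (fun e n => ⟨weyl p n * eta p ^ (e : ℕ), fun x => ?_⟩)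
    (fun q => ((p : ℂ)⁻¹ ^ 2) ^ (1 + max q.2.1.natAbs q.2.2.natAbs))
    (fun q x => ?_) hB hg₁ hf₂ dh (hS.congr_fun fun q => ?_)
  · obtain ⟨u, hu, h⟩ := iwahoriRep_eq e n x
    exact ⟨u, hu, by rw [← mul_assoc]; exact h⟩
  · refine (weilPairing_iwahoriRep hψ hdx q.1 q.2.1 q.2.2 x.1 x.2 _).trans ?_
    rw [← weight_eq]
    push_cast
    rfl
  · have e1 : ∑ x, glRep π₁ ((iwahoriReps p).rep q.1 q.2.1 x) g₁ = _ :=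
      sum_iwahoriRep (centreTrivial_glRep π₁) q.1 q.2.1 hη₁
    have e2 : ∑ x, glRep π₂ ((iwahoriReps p).rep q.1 q.2.2 x) f₂ = _ :=
      sum_iwahoriRep_special (centreTrivial_glRep π₂) hε₂ hη₂ hU₂ q.1 q.2.2
    rw [e1, e2]
    congr 1
    split_ifs
    · rw [TensorProduct.smul_tmul_smul, map_smul, LinearMap.smul_apply, ← hz, smul_eq_mul, pow_add]
      rw [mul_pow]; ring
    -- For negative length the outer $\eta$ is moved to the second argument, where it acts by the
    -- real scalar $\varepsilon_1$. The coefficient then agrees with that for $|n|$.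
    · rw [TensorProduct.smul_tmul_smul, map_smul, LinearMap.smul_apply, apply_eta_left hB, hη₁,
        ← TensorProduct.smul_tmul', LinearMap.map_smulₛₗ, hconj, ← hz, smul_eq_mul, smul_eq_mul,
        pow_add, pow_add, mul_pow]
      linear_combination (ε₁ ^ q.2.1.natAbs * ε₁ ^ (q.1 : ℕ) * ε₂ ^ (q.1 : ℕ) *
        (-1) ^ q.2.2.natAbs * z q.2.1.natAbs) * hε₁

/-- The zeta integral for two special representations. -/
theorem zeta_special_special {χ χ' : ℚ_[p]ˣ →* ℂˣ} (h₁ : HasType π₁ (.special χ))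
    (h₂ : HasType π₂ (.special χ')) {f₁ : W₁} {f₂ : W₂}
    (hf₁ : ∀ k ∈ eichlerSubgroup p 1, glRep π₁ k f₁ = f₁)
    (hf₂ : ∀ k ∈ eichlerSubgroup p 1, glRep π₂ k f₂ = f₂) (hf₁0 : f₁ ≠ 0) (hf₂0 : f₂ ≠ 0)
    {ε₁ ε₂ : ℂ} (hη₁ : glRep π₁ (eta p) f₁ = ε₁ • f₁) (hη₂ : glRep π₂ (eta p) f₂ = ε₂ • f₂)
    (hB : IsInvariantHermitian (sigma π₁ π₂) B)
    (hψ : HasConductorZp ψ) (hdx : IsSelfDual ψ dx) (dh : Measure (H01 p)) [dh.IsHaarMeasure] :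
    Integrable (zetaIntegrand dx (sigma π₁ π₂) B (phiStar p 1) (f₁ ⊗ₜ[ℂ] f₂)) dh ∧
      localZetaIntegral dx dh (sigma π₁ π₂) B (phiStar p 1) (f₁ ⊗ₜ[ℂ] f₂) =
        (dh.real (calU p 1) : ℂ) * (p : ℂ)⁻¹ ^ 2 * (1 + ε₁ * ε₂) *
          (asaiLFactor (.special χ) (.special χ') 1 / (zetaFactor p 1 * zetaFactor p 2)) *
          B (f₁ ⊗ₜ[ℂ] f₂) (f₁ ⊗ₜ[ℂ] f₂) := by
  have hp := prime_real_pos (p := p)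
  obtain ⟨hε₁, hχ, hU₁⟩ := special_newVector h₁ hf₁0 hf₁ hη₁
  obtain ⟨hε₂, hχ', hU₂⟩ := special_newVector h₂ hf₂0 hf₂ hη₂
  have hsign : ε₁ = 1 ∨ ε₁ = -1 := mul_self_eq_one_iff.mp hε₁
  have hn : ‖-ε₁‖ = 1 := by rcases hsign with h | h <;> simp [h]
  set b := B (f₁ ⊗ₜ[ℂ] f₂) (f₁ ⊗ₜ[ℂ] f₂) with hb
  have hz : ∀ N, (-ε₁) ^ N * b = B ((heckeU (glRep π₁) ^ N) f₁ ⊗ₜ[ℂ] f₂) (f₁ ⊗ₜ[ℂ] f₂) :=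
    fun N => by
      rw [heckeU_pow_of_eigen hU₁, ← TensorProduct.smul_tmul', map_smul, LinearMap.smul_apply,
        smul_eq_mul]
  have hzs : Summable fun N => ‖(-ε₁) ^ N * b‖ * (p : ℝ)⁻¹ ^ N := by
    refine ((summable_geometric_of_lt_one (inv_nonneg.mpr hp.le)
      (inv_lt_one_of_one_lt₀ one_lt_prime_real)).mul_left ‖b‖).congr fun N => ?_
    rw [norm_mul, norm_pow, hn, one_pow, one_mul]
  have hs : HasSum (fun N => (-((p : ℂ)⁻¹ ^ 2 * ε₁)) ^ N * ((-ε₁) ^ N * b))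
      ((1 - (p : ℂ)⁻¹ ^ 2)⁻¹ * b) := by
    refine ((hasSum_geometric_of_norm_lt_one (ξ := (p : ℂ)⁻¹ ^ 2) ?_).mul_right b).congr_fun
      fun N => ?_
    · rw [norm_inv_prime_sq]
      exact pow_lt_one₀ (inv_nonneg.mpr hp.le) (inv_lt_one_of_one_lt₀ one_lt_prime_real) two_ne_zero
    · rw [← mul_assoc, ← mul_pow]
      congr 2
      linear_combination (p : ℂ)⁻¹ ^ 2 * hε₁
  obtain ⟨hi, hv⟩ := zeta_iwahori hB hf₁ hf₂ hε₁ hε₂ hη₁ hη₂ hU₂ hz hzs hs hψ hdx dh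
  refine ⟨hi, hv.trans ?_⟩
  have hT1 := one_sub_inv_pow_ne_zero (p := p) two_ne_zero
  have hp1 := one_sub_inv_pow_ne_zero (p := p) one_ne_zero
  rw [pow_one] at hp1
  have hT2 := one_add_inv_sq_ne_zero (p := p)
  have h1 : (1 - (p : ℂ)⁻¹ ^ 2) / (1 + (p : ℂ)⁻¹ ^ 2) *
      (2 * ((1 - (p : ℂ)⁻¹ ^ 2)⁻¹ * b) - (-ε₁) ^ 0 * b) = b := by
    rw [pow_zero, one_mul]
    generalize (p : ℂ)⁻¹ ^ 2 = T at *
    field_simp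
    ring
  rw [h1, asaiLFactor_special_special, hχ, hχ', zetaFactor_one, zetaFactor_two]
  -- If $\varepsilon_1\varepsilon_2=1$ the Asai factor equals $\zeta_p(1)\zeta_p(2)$ and the
  -- quotient is 1. If it is $-1$, the factor $1+\varepsilon_1\varepsilon_2$ kills both sides.
  rcases mul_self_eq_one_iff.mp (show (ε₁ * ε₂) * (ε₁ * ε₂) = 1 by
    linear_combination ε₂ * ε₂ * hε₁ + hε₂) with h | h
  · rw [show -ε₁ * -ε₂ = 1 by linear_combination h, h,
      show (p : ℂ)⁻¹ * (1 * (p : ℂ)⁻¹) = (p : ℂ)⁻¹ ^ 2 by ring, mul_one,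
      show ((1 - (p : ℂ)⁻¹ ^ 2) * (1 - (p : ℂ)⁻¹))⁻¹ /
        ((1 - (p : ℂ)⁻¹)⁻¹ * (1 - (p : ℂ)⁻¹ ^ 2)⁻¹) = 1 by
          generalize (p : ℂ)⁻¹ ^ 2 = T at *
          generalize (p : ℂ)⁻¹ = t at *
          field_simp]
    ring
  · rw [h]; ring

/-- The zeta integral for a principal series and a special representation. -/
theorem zeta_principal_special {μ ν χ : ℚ_[p]ˣ →* ℂˣ} (h₁ : HasType π₁ (.principal μ ν))
    (h₂ : HasType π₂ (.special χ)) {f₁ : W₁} {f₂ : W₂}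
    (hf₁ : ∀ k ∈ eichlerSubgroup p 0, glRep π₁ k f₁ = f₁)
    (hf₂ : ∀ k ∈ eichlerSubgroup p 1, glRep π₂ k f₂ = f₂) (hf₁0 : f₁ ≠ 0) (hf₂0 : f₂ ≠ 0)
    {ε : ℂ} (hη₂ : glRep π₂ (eta p) f₂ = ε • f₂)
    (hB : IsInvariantHermitian (sigma π₁ π₂) B) (hB1 : B (f₁ ⊗ₜ[ℂ] f₂) (f₁ ⊗ₜ[ℂ] f₂) = 1)
    (hψ : HasConductorZp ψ) (hdx : IsSelfDual ψ dx) (dh : Measure (H01 p)) [dh.IsHaarMeasure]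
    {g₁ : W₁} (hg : g₁ = f₁ + ε • glRep π₁ (eta p) f₁) :
    Integrable (zetaIntegrand dx (sigma π₁ π₂) B (phiStar p 1) (g₁ ⊗ₜ[ℂ] f₂)) dh ∧
      localZetaIntegral dx dh (sigma π₁ π₂) B (phiStar p 1) (g₁ ⊗ₜ[ℂ] f₂) =
        (dh.real (calU p 1) : ℂ) * (p : ℂ)⁻¹ ^ 2 * (1 + 1) *
          (asaiLFactor (.principal μ ν) (.special χ) 1 / (zetaFactor p 1 * zetaFactor p 2)) *
          B (g₁ ⊗ₜ[ℂ] f₂) (g₁ ⊗ₜ[ℂ] f₂) := by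
  have hp := prime_real_pos (p := p)
  have hpC : (p : ℂ) ≠ 0 := Nat.cast_ne_zero.mpr (Fact.out : p.Prime).ne_zero
  have hρ := centreTrivial_glRep π₁
  obtain ⟨hε, hχ, hU₂⟩ := special_newVector h₂ hf₂0 hf₂ hη₂
  have hsign : ε = 1 ∨ ε = -1 := mul_self_eq_one_iff.mp hε
  have hconj : (starRingEnd ℂ) ε = ε := by rcases hsign with h | h <;> simp [h]
  have hc := principal_heckeU h₁ hf₁
  obtain ⟨t, ht, htp⟩ := exists_real_eigenvalue_left hB hB1 hf₁ hc
  obtain ⟨hx, hx1, hx2⟩ := satake_parameters h₁ hf₁0 ht htp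
  set x : ℂ := Real.sqrt p * μ (pUnit p) with hxdef
  set x' : ℂ := Real.sqrt p * ν (pUnit p) with hxdef'
  rw [mul_add, ← hxdef, ← hxdef'] at hc
  -- $\eta f_1$ is fixed by the Iwahori group because $\eta$ normalises it.
  have hg₁ : ∀ k ∈ eichlerSubgroup p 1, glRep π₁ k g₁ = g₁ := fun k hk => by
    have h1 : glRep π₁ k (glRep π₁ (eta p) f₁) = glRep π₁ (eta p) f₁ := by
      conv_rhs => rw [← hf₁ _ (eichlerSubgroup_one_le (eta_conj_mem hk))]
      rw [← Module.End.mul_apply, ← Module.End.mul_apply, ← map_mul, ← map_mul]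
      congr 2
      group
    rw [hg, map_add, map_smul, h1, hf₁ _ (eichlerSubgroup_one_le hk)]
  have hη₁ : glRep π₁ (eta p) g₁ = ε • g₁ := by
    rw [hg, map_add, map_smul, hρ.atkinLehner_sq, smul_add, smul_smul, hε, one_smul, add_comm]
  have hUf : heckeU (glRep π₁) f₁ = (x + x') • f₁ - glRep π₁ (eta p) f₁ := eq_sub_of_add_eq hc
  have hUη := heckeU_eta hρ hf₁
  have hUg : heckeU (glRep π₁) g₁ = (x + x' + ε * p) • f₁ - glRep π₁ (eta p) f₁ := by
    rw [hg, map_add, map_smul, hUf, hUη]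
    module
  -- Cayley–Hamilton for $U_p$ on the span of $f_1$ and $\eta f_1$; it yields the recurrence for the
  -- coefficients $z_N$.
  have hU2 : heckeU (glRep π₁) (heckeU (glRep π₁) g₁) =
      (x + x') • heckeU (glRep π₁) g₁ - (x * x') • g₁ := by
    rw [hUg, map_sub, map_smul, hUf, hUη, hg, hx]
    module
  set z : ℕ → ℂ := fun N => B ((heckeU (glRep π₁) ^ N) g₁ ⊗ₜ[ℂ] f₂) (g₁ ⊗ₜ[ℂ] f₂) with hz
  have hrec : ∀ N, z (N + 2) = (x + x') * z (N + 1) - x * x' * z N := fun N => by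
    have h1 : (heckeU (glRep π₁) ^ (N + 2)) g₁ = (x + x') • (heckeU (glRep π₁) ^ (N + 1)) g₁ -
        (x * x') • (heckeU (glRep π₁) ^ N) g₁ := by
      rw [pow_add, pow_two, Module.End.mul_apply, Module.End.mul_apply, hU2, map_sub, map_smul,
        map_smul, pow_succ, Module.End.mul_apply]
    simp only [hz]
    rw [h1, TensorProduct.sub_tmul, ← TensorProduct.smul_tmul', ← TensorProduct.smul_tmul',
      map_sub, map_smul, map_smul]
    rfl
  set β := B (f₁ ⊗ₜ[ℂ] f₂) (g₁ ⊗ₜ[ℂ] f₂) with hβ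
  -- Self-adjointness of $\eta$ and $\eta g_1=\varepsilon g_1$ express every coefficient against
  -- $g_1\otimes f_2$ through the single number $\beta$, in particular $z_0=2\beta$.
  have hβη : B (glRep π₁ (eta p) f₁ ⊗ₜ[ℂ] f₂) (g₁ ⊗ₜ[ℂ] f₂) = ε * β := by
    rw [apply_eta_left hB, hη₁, ← TensorProduct.smul_tmul', LinearMap.map_smulₛₗ, hconj, smul_eq_mul]
  have hlin : ∀ a b : ℂ, B ((a • f₁ + b • glRep π₁ (eta p) f₁) ⊗ₜ[ℂ] f₂) (g₁ ⊗ₜ[ℂ] f₂) =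
      a * β + b * (ε * β) := fun a b => by
    rw [TensorProduct.add_tmul, ← TensorProduct.smul_tmul', ← TensorProduct.smul_tmul', map_add,
      map_smul, map_smul, LinearMap.add_apply, LinearMap.smul_apply, LinearMap.smul_apply, hβη]
    rfl
  have hz0' : z 0 = B (g₁ ⊗ₜ[ℂ] f₂) (g₁ ⊗ₜ[ℂ] f₂) := rfl
  have hz0 : z 0 = 2 * β := by
    have h1 := hlin 1 ε
    rw [one_smul, ← hg] at h1
    rw [hz0', h1]
    linear_combination β * hε
  have hz1 : z 1 = (x + x' + ε * p - ε) * β := by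
    have h1 := hlin (x + x' + ε * p) (-1)
    rw [neg_one_smul, ← sub_eq_add_neg, ← hUg] at h1
    have h2 : z 1 = B (heckeU (glRep π₁) g₁ ⊗ₜ[ℂ] f₂) (g₁ ⊗ₜ[ℂ] f₂) := by
      simp only [hz, pow_one]
    rw [h2, h1]
    ring
  have hzs := summable_of_recurrence hrec (inv_nonneg.mpr hp.le) hx1 hx2
  have hr1 : (p : ℝ)⁻¹ ≤ 1 := inv_le_one_of_one_le₀ one_lt_prime_real.le
  have hun : ‖-((p : ℂ)⁻¹ ^ 2 * ε)‖ ≤ (p : ℝ)⁻¹ := by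
    have h1 : ‖ε‖ = 1 := by rcases hsign with h | h <;> simp [h]
    rw [norm_neg, norm_mul, norm_inv_prime_sq, h1, mul_one, pow_two]
    exact mul_le_of_le_one_left (inv_nonneg.mpr hp.le) hr1
  have hxu : ‖x‖ * ‖-((p : ℂ)⁻¹ ^ 2 * ε)‖ < 1 :=
    (mul_le_mul_of_nonneg_left hun (norm_nonneg _)).trans_lt hx1
  have hxu' : ‖x'‖ * ‖-((p : ℂ)⁻¹ ^ 2 * ε)‖ < 1 :=
    (mul_le_mul_of_nonneg_left hun (norm_nonneg _)).trans_lt hx2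
  have hs := hasSum_recurrence hrec hxu hxu'
  obtain ⟨hi, hv⟩ := zeta_iwahori (z := z) hB hg₁ hf₂ hε hε hη₁ hη₂ hU₂ (fun N => rfl) hzs hs hψ hdx dh
  refine ⟨hi, hv.trans ?_⟩
  rw [← hz0', hε]
  have hne : ∀ v : ℂ, ‖v‖ * ‖-((p : ℂ)⁻¹ ^ 2 * ε)‖ < 1 → 1 - v * -((p : ℂ)⁻¹ ^ 2 * ε) ≠ 0 :=
    fun v hv h0 => by
      rw [← norm_mul, ← sub_eq_zero.mp h0, norm_one] at hv
      exact lt_irrefl _ hv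
  have hD := hne x hxu
  have hD' := hne x' hxu'
  have hT2 := one_add_inv_sq_ne_zero (p := p)
  have hs2 : (Real.sqrt p : ℂ) * (Real.sqrt p : ℂ) = p := by
    rw [← Complex.ofReal_mul, Real.mul_self_sqrt hp.le, Complex.ofReal_natCast]
  have hs0 : (Real.sqrt p : ℂ) ≠ 0 := Complex.ofReal_ne_zero.mpr (Real.sqrt_pos.mpr hp).ne'
  have hfac : ∀ a : ℂ, 1 - (p : ℂ)⁻¹ * (a * (-ε * (Real.sqrt p : ℂ)⁻¹)) =
      1 - Real.sqrt p * a * -((p : ℂ)⁻¹ ^ 2 * ε) := fun a => by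
    rw [← hs2]
    field_simp
  rw [asaiLFactor_principal_special, hχ, zetaFactor_one, zetaFactor_two, hfac, hfac, ← hxdef,
    ← hxdef', hz0, hz1]
  rw [iwahori_series_identity hx (mul_inv_cancel₀ hpC) hε hT2 hD hD']
  ring

end Main

end SplitZeta
end

/-! ### Assembly of the cases. -/

theorem propositionP (p : ℕ) [Fact p.Prime]
    {W₁ W₂ : Type*} [AddCommGroup W₁] [Module ℂ W₁] [AddCommGroup W₂] [Module ℂ W₂]
    (π₁ : Representation ℂ PGL(2, ℚ_[p]) W₁) (π₂ : Representation ℂ PGL(2, ℚ_[p]) W₂)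
    (τ₁ τ₂ : SplitZeta.LocalType p)
    (hτ₁ : SplitZeta.HasType π₁ τ₁) (hτ₂ : SplitZeta.HasType π₂ τ₂)
    (f₁ : W₁) (f₂ : W₂)
    (hf₁ : SplitZeta.IsNewVector π₁ τ₁.level f₁) (hf₂ : SplitZeta.IsNewVector π₂ τ₂.level f₂)
    (ϖ₁ ϖ₂ : ℚ_[p]ˣ) (hϖ₁ : ‖(ϖ₁ : ℚ_[p])‖ = (p : ℝ)⁻¹) (hϖ₂ : ‖(ϖ₂ : ℚ_[p])‖ = (p : ℝ)⁻¹)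
    (ε₁ ε₂ : ℂ)
    (hε₁ : τ₁.level = 1 →
      π₁ (Matrix.ProjGenLinGroup.mk (SplitZeta.atkinLehner ϖ₁)) f₁ = ε₁ • f₁)
    (hε₂ : τ₂.level = 1 →
      π₂ (Matrix.ProjGenLinGroup.mk (SplitZeta.atkinLehner ϖ₂)) f₂ = ε₂ • f₂)
    (B : W₁ ⊗[ℂ] W₂ →ₗ[ℂ] W₁ ⊗[ℂ] W₂ →ₗ⋆[ℂ] ℂ)
    (hB : SplitZeta.IsInvariantHermitian (SplitZeta.sigma π₁ π₂) B)
    (hB₁ : B (f₁ ⊗ₜ[ℂ] f₂) (f₁ ⊗ₜ[ℂ] f₂) = 1)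
    (ψ : AddChar ℚ_[p] Circle) (hψ : SplitZeta.HasConductorZp ψ)
    (dx : Measure (SplitZeta.X p)) (hdx : SplitZeta.IsSelfDual ψ dx)
    (dh : Measure (SplitZeta.H01 p)) [dh.IsHaarMeasure] :
    let σ := SplitZeta.sigma π₁ π₂
    let fd := SplitZeta.fDagger σ τ₁.level τ₂.level ϖ₁ ε₂ (f₁ ⊗ₜ[ℂ] f₂)
    (τ₁.level = 0 → τ₂.level = 0 →
      Integrable (SplitZeta.zetaIntegrand dx σ B (SplitZeta.phiStar p 0) fd) dh ∧
      SplitZeta.localZetaIntegral dx dh σ B (SplitZeta.phiStar p 0) fd =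
        (dh.real (SplitZeta.calU p 0) : ℂ) * (SplitZeta.asaiLFactor τ₁ τ₂ 1 /
          (SplitZeta.zetaFactor p 2 * SplitZeta.zetaFactor p 4))) ∧
    (τ₂.level = 1 →
      Integrable (SplitZeta.zetaIntegrand dx σ B (SplitZeta.phiStar p 1) fd) dh ∧
      SplitZeta.localZetaIntegral dx dh σ B (SplitZeta.phiStar p 1) fd =
        (dh.real (SplitZeta.calU p 1) : ℂ) * (p : ℂ)⁻¹ ^ 2 *
          (1 + if τ₁.level = 0 then 1 else ε₁ * ε₂) *
          (SplitZeta.asaiLFactor τ₁ τ₂ 1 /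
            (SplitZeta.zetaFactor p 1 * SplitZeta.zetaFactor p 2)) *
          B fd fd) := by
  have h10 : (1 : ℕ) ≠ 0 := one_ne_zero
  cases τ₂ with
  | principal μ' ν' =>
    intro σ fd
    refine ⟨fun h1 _ => ?_, fun h2 => absurd h2.symm h10⟩
    cases τ₁ with
    | special χ => exact absurd h1 h10
    | principal μ ν =>
      have hfd : fd = f₁ ⊗ₜ[ℂ] f₂ := if_neg fun h => h10 h.2.symm
      rw [hfd]
      exact SplitZeta.zeta_principal_principal hτ₁ hτ₂ hf₁.2 hf₂.2 hf₁.1 hf₂.1 hB hB₁ hψ hdx dh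
  | special χ' =>
    intro σ fd
    refine ⟨fun _ h2 => absurd h2 h10, fun _ => ?_⟩
    -- Atkin–Lehner matrices of different uniformizers differ by an element of the Iwahori group, so
    -- the uniformizer may be taken to be $p$.
    have hη₂ : SplitZeta.glRep π₂ (SplitZeta.eta p) f₂ = ε₂ • f₂ :=
      (SplitZeta.atkinLehner_apply hf₂.2 hϖ₂).symm.trans (hε₂ rfl)
    cases τ₁ with
    | special χ =>
      have hfd : fd = f₁ ⊗ₜ[ℂ] f₂ := if_neg fun h => h10 h.1
      rw [hfd, if_neg (show ¬ (SplitZeta.LocalType.special χ).level = 0 from h10)]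
      exact SplitZeta.zeta_special_special hτ₁ hτ₂ hf₁.2 hf₂.2 hf₁.1 hf₂.1
        ((SplitZeta.atkinLehner_apply hf₁.2 hϖ₁).symm.trans (hε₁ rfl)) hη₂ hB hψ hdx dh
    | principal μ ν =>
      have hfd : fd = (f₁ + ε₂ • SplitZeta.glRep π₁ (SplitZeta.eta p) f₁) ⊗ₜ[ℂ] f₂ := by
        refine (if_pos ⟨rfl, rfl⟩).trans ?_
        rw [SplitZeta.sigma_mk, map_one, TensorProduct.add_tmul, TensorProduct.smul_tmul',
          ← SplitZeta.atkinLehner_apply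
            (fun k hk => hf₁.2 k (SplitZeta.eichlerSubgroup_one_le hk)) hϖ₁]
        rfl
      rw [hfd, if_pos (show (SplitZeta.LocalType.principal μ ν).level = 0 from rfl)]
      exact SplitZeta.zeta_principal_special hτ₁ hτ₂ hf₁.2 hf₂.2 hf₁.1 hf₂.1 hη₂ hB hB₁ hψ hdx dh
        rfl
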